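/- Let $d\ge 2$ and consider $\mathbb Z^d$ with edges $E(\mathbb Z^d)$ between points at Euclidean distance $1$. Let $Q$ be a probability measure on $\mathbb R$ such that $0$ is an interior point of the support of $Q$, and let $J=(J_e)_{e\in E(\mathbb Z^d)}$ be i.i.d. random variables with law $Q$. For $L\in\mathbb N$ let $\Lambda_L=[-L,L]^d\cap\mathbb Z^d$, let $E(\Lambda_L)$ be the set of edges with both endpoints in $\Lambda_L$, let $\Omega_L=\{-1,1\}^{\Lambda_L}$, and for $\beta>0$ let $$\pi_L(\sigma)=\frac1{Z_L}\exp\Big(\beta\sum_{\{x,y\}\in E(\Lambda_L)}J_{xy}\sigma_x\sigma_y\Big),\qquad \sigma\in\Omega_L,$$ be the Ising measure. The Swendsen–Wang chain is the Markov chain on $\Omega_L$ whose transition matrix $M_L$ is given by the following two steps from $\sigma$. (1) Independently for each edge $e=\{x,y\}\in E(\Lambda_L)$ with $J_e\sigma_x\sigma_y\ge 0$, open $e$ with probability $p_e=1-e^{-2\beta|J_e|}$; all other edges are closed. (2) For each connected component of the graph formed by $\Lambda_L$ and the open edges, choose the spin at one of its vertices to be $\pm1$ with probability $1/2$ each, independently,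 and determine the other spins of the component by the rule $J_e\sigma'_x\sigma'_y\ge 0$ on every open edge $e=\{x,y\}$. Let $1=\lambda_0,\lambda_1,\dots,\lambda_n$ be the eigenvalues of $M_L$, with multiplicity, and put $R_L=\sup_{i>0}|\lambda_i|$. For $f:\Omega_L\to\mathbb R$ and $t\in\mathbb N$ let $$C_{ff}(t)=\sum_{\omega,\tilde\omega}f(\omega)f(\tilde\omega)\pi_L(\omega)M_L^t(\omega,\tilde\omega)-\Big(\sum_\omega f(\omega)\pi_L(\omega)\Big)^2,\qquad \rho_{ff}(t)=\frac{C_{ff}(t)}{C_{ff}(0)},$$ and let $$\tau_{\exp,L}=\sup_{f:\,C_{ff}(0)\ne0}\ \limsup_{t\to\infty}\frac{t}{-\log|\rho_{ff}(t)|}\in[0,\infty]$$ (with $-\log 0=\infty$, $t/\infty=0$, and $t/0=\infty$ for $t>0$). Then for every $\delta\in(0,1/2)$ there is $\tilde\beta(\delta)\in(0,\infty)$, depending only on $\delta$, $d$ and $Q$, such that for every $\beta>\tilde\beta(\delta)$, almost surely with respect to $J$, $$\lim_{L\to\infty}R_L=1\qquad\text{and}\qquad\lim_{L\to\infty}\tau_{\exp,L}=\infty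 .$$ -/

import Mathlib

noncomputable section

open scoped Classical ENNReal

namespace SwendsenWang

section Lattice

/-- The nearest-neighbour graph on `ℤ^d`: edges join points at Euclidean distance one. -/
def latticeGraph (d : ℕ) : SimpleGraph (Fin d → ℤ) where
  Adj x y := ∑ i, (x i - y i) ^ 2 = 1
  symm := ⟨fun x y h => by
    rw [← h]
    exact Finset.sum_congr rfl fun i _ => by ring⟩
  loopless := ⟨fun x h => by simp at h⟩

/-- The box `Λ_L = [-L, L]^d ∩ ℤ^d`. -/
def box (d L : ℕ) : Finset (Fin d → ℤ) :=
  Finset.Icc (fun _ => -(L : ℤ)) (fun _ => (L : ℤ))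

/-- The graph `(Λ_L, E(Λ_L))`. -/
def boxGraph (d L : ℕ) : SimpleGraph {x // x ∈ box d L} :=
  (latticeGraph d).comap (Function.Embedding.subtype _)

/-- The couplings on the edges of the box, read off from couplings on all of `ℤ^d`. -/
def boxCouplings {d : ℕ} (J : (latticeGraph d).edgeSet → ℝ) (L : ℕ) :
    (boxGraph d L).edgeSet → ℝ :=
  fun e => J ((SimpleGraph.Embedding.comap (Function.Embedding.subtype _)
    (latticeGraph d)).mapEdgeSet e)

end Lattice

section Ising

variable {V : Type*} [Fintype V] (G : SimpleGraph V) (J : G.edgeSet → ℝ) (β : ℝ)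

/-- Spin configurations, with values in `{-1, 1} = ℤˣ`. -/
abbrev Spins (V : Type*) : Type _ := V → ℤˣ

/-- The product `σ_x σ_y` along the edge `{x, y}`. -/
def edgeSpin {V : Type*} (σ : Spins V) (e : Sym2 V) : ℝ := (((e.map σ).mul : ℤˣ) : ℤ)

/-- `H(σ) = - ∑_{x,y} J_{xy} σ_x σ_y`, each edge of the graph being counted once. -/
def hamiltonian (σ : Spins V) : ℝ := -∑ e : G.edgeSet, J e * edgeSpin σ e

/-- The Ising (Gibbs) measure at inverse temperature `β`. -/
def gibbs (σ : Spins V) : ℝ :=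
  Real.exp (-β * hamiltonian G J σ) / ∑ ω : Spins V, Real.exp (-β * hamiltonian G J ω)

/-- The probability with which an edge with `J_e σ_x σ_y ≥ 0` is opened. -/
def bondProb (e : G.edgeSet) : ℝ := 1 - Real.exp (-2 * β * |J e|)

/-- First half-step: the probability of producing the edge configuration `η` from the spins `σ`.
Edges with `J_e σ_x σ_y ≥ 0` are opened independently with probability `bondProb e`;
all other edges are closed. -/
def bondStep (σ : Spins V) (η : G.edgeSet → Bool) : ℝ :=
  ∏ e : G.edgeSet,
    if 0 ≤ J e * edgeSpin σ e then
      (if η e = true then bondProb G J β e else 1 - bondProb G J β e)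
    else (if η e = true then 0 else 1)

/-- The graph on the vertices formed by the open edges; its connected components are the
clusters of `η`. -/
def openGraph {V : Type*} (G : SimpleGraph V) (η : G.edgeSet → Bool) : SimpleGraph V :=
  SimpleGraph.fromEdgeSet {e | ∃ h : e ∈ G.edgeSet, η ⟨e, h⟩ = true}

/-- Second half-step: the probability of producing the spins `σ` from the edge configuration `η`.
One fair coin is tossed per cluster, and the rule `J_e σ_x σ_y ≥ 0` on open edges propagates its
value through the cluster. So each of the configurations obeying the rule has probability
`2^{-#clusters}`. (Open edges have `J_e ≠ 0` with probability one.) -/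
def spinStep (η : G.edgeSet → Bool) (σ : Spins V) : ℝ :=
  if ∀ e : G.edgeSet, η e = true → 0 ≤ J e * edgeSpin σ e then
    (1 / 2 : ℝ) ^ Nat.card (openGraph G η).ConnectedComponent
  else 0

/-- The Swendsen–Wang transition matrix on spin configurations. -/
def swMatrix : Matrix (Spins V) (Spins V) ℝ :=
  fun σ σ' => ∑ η : G.edgeSet → Bool, bondStep G J β σ η * spinStep G J η σ'

end Ising

section Markov

variable {S : Type*} [Fintype S]

/-- `R = sup_{i > 0} |λ_i|`, where `λ_0 = 1, λ_1, …` are the eigenvalues of the transition matrix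
`P` with multiplicity (one copy of the eigenvalue `1` is left out). -/
def secondSpectralRadius (P : Matrix S S ℝ) : ℝ :=
  sSup ((fun z : ℂ => ‖z‖) '' {z | z ∈ (P.map (fun a : ℝ => (a : ℂ))).charpoly.roots.erase 1})

/-- The autocorrelation function `C_ff(t)` of the chain with transition matrix `P` started from
`π`. -/
def autocorr (P : Matrix S S ℝ) (π : S → ℝ) (f : S → ℝ) (t : ℕ) : ℝ :=
  ∑ ω, ∑ ω', f ω * f ω' * π ω * (P ^ t) ω ω' - (∑ ω, f ω * π ω) ^ 2

/-- The normalized autocorrelation function `ρ_ff(t) = C_ff(t) / C_ff(0)`. -/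
def normAutocorr (P : Matrix S S ℝ) (π : S → ℝ) (f : S → ℝ) (t : ℕ) : ℝ :=
  autocorr P π f t / autocorr P π f 0

/-- `τ_{exp,f} = limsup_t t / (-log |ρ_ff(t)|)` in `[0, ∞]`, with `-log 0 = ∞`, `t / ∞ = 0` and
`t / 0 = ∞` for `t > 0`. -/
def expTimeOf (P : Matrix S S ℝ) (π : S → ℝ) (f : S → ℝ) : ℝ≥0∞ :=
  Filter.limsup
    (fun t : ℕ => (t : ℝ≥0∞) /
      (-ENNReal.log (ENNReal.ofReal |normAutocorr P π f t|)).toENNReal) Filter.atTop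

/-- `τ_exp`, the supremum of `τ_{exp,f}` over all `f` of nonzero variance `C_ff(0)`. -/
def expTime (P : Matrix S S ℝ) (π : S → ℝ) : ℝ≥0∞ :=
  ⨆ (f : S → ℝ) (_ : autocorr P π f 0 ≠ 0), expTimeOf P π f

end Markov

/-- `R_L`. -/
def boxSpectralRadius {d : ℕ} (J : (latticeGraph d).edgeSet → ℝ) (β : ℝ) (L : ℕ) : ℝ :=
  secondSpectralRadius (swMatrix (boxGraph d L) (boxCouplings J L) β)

/-- `τ_{exp,L}`. -/
def boxExpTime {d : ℕ} (J : (latticeGraph d).edgeSet → ℝ) (β : ℝ) (L : ℕ) : ℝ≥0∞ :=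
  expTime (swMatrix (boxGraph d L) (boxCouplings J L) β)
    (gibbs (boxGraph d L) (boxCouplings J L) β)

end SwendsenWang

end

/-! The chain is slowed down by one rare local pattern in the couplings, which occurs almost surely
somewhere in the lattice. The pattern (`Gadget`) consists of two adjacent `n × n` squares in a
coordinate plane. Couplings inside the squares are ferromagnetic with `β J > 50`; the `n` links
between the squares have couplings close to `± h / β`, half of them of each sign; the other edges at
the squares have couplings close to zero. Put `M = h n`.

Each square then acts as one large spin. As the link signs cancel, the states "both squares aligned"
and "both squares opposite" have comparable weight: relative to the weight without links, each has
at least order `exp (-0.26 M)`. A Swendsen–Wang step can change the state only if every link pinned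
to the two large spins is closed. At least 7/8 of the links are pinned, so this event has relative
weight of order at most `exp (-0.74 M)`. The flow between the two states is thus a small multiple of
the product of their probabilities (`Gadget.slow`), and the variational principle turns this into an
eigenvalue of at least `1 - 16 exp (2 - 0.4 M)`, which controls both `R` and `τ_exp` (`bottleneck`).

That a square acts as one spin is a percolation statement about the open strong edges. Whatever the
environment, opening a strong edge multiplies the weight by at least a large constant `r`
(`Gadget.mass_insert`), so the edges of `W` are all closed with probability at most `(1 + r)^{-|W|}`
(`sum_bad_le`). A multiscale argument (`cover_side`) shows that at the scale `n = side k`, up to an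
error `2^{-4k-25}`, the open edges link at least 15/16 of each row and column of a square. The
required `r` is an absolute constant. Since `M` is fixed before `k` is taken large and `h = M / n`,
the threshold for `β` does not depend on `M`.

As `0` is interior to the support of `Q`, the finitely many conditions of the pattern have positive
probability, and disjoint translates are independent. By Borel–Cantelli (`ae_exists_pattern`) the
pattern occurs, and all boxes large enough to contain it are slow. Letting `M` tend to infinity
through the integers gives both limits. -/

noncomputable section

open scoped Classical ENNReal

namespace SwendsenWang

/-! ### Finite reversible chains: a bottleneck yields a large second eigenvalue. -/

section ReversibleChains

variable {S : Type*} [Fintype S]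

/-- `P` is a stochastic matrix, reversible with respect to the positive probability vector `π`. -/
structure IsReversibleChain (P : Matrix S S ℝ) (π : S → ℝ) : Prop where
  pos : ∀ x, 0 < π x
  sum_eq_one : ∑ x, π x = 1
  nonneg : ∀ x y, 0 ≤ P x y
  row_sum : ∀ x, ∑ y, P x y = 1
  reversible : ∀ x y, π x * P x y = π y * P y x

/-- The stationary probability of stepping from `A` to its complement. -/
def flow (P : Matrix S S ℝ) (π : S → ℝ) (A : S → Prop) : ℝ :=
  ∑ x, ∑ y, if A x ∧ ¬ A y then π x * P x y else 0

/-- Gershgorin: the disc of row `k` has centre `P k k` and radius `1 - P k k`, so it lies in the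
unit disc. -/
theorem norm_le_one_of_mem_roots {P : Matrix S S ℝ} {π : S → ℝ} (h : IsReversibleChain P π)
    {z : ℂ} (hz : z ∈ (P.map (fun a : ℝ => (a : ℂ))).charpoly.roots) : ‖z‖ ≤ 1 := by
  have hev : Module.End.HasEigenvalue (Matrix.toLin' (P.map (fun a : ℝ => (a : ℂ)))) z := by
    rw [Module.End.hasEigenvalue_iff_isRoot_charpoly, Matrix.charpoly_toLin']
    exact Polynomial.isRoot_of_mem_roots hz
  obtain ⟨k, hk⟩ := eigenvalue_mem_ball hev
  rw [mem_closedBall_iff_norm] at hk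
  have h1 : ∀ j, ‖(P.map (fun a : ℝ => (a : ℂ))) k j‖ = P k j := fun j => by
    simp [abs_of_nonneg (h.nonneg k j)]
  simp only [h1] at hk
  have h2 := Finset.add_sum_erase Finset.univ (fun j => P k j) (Finset.mem_univ k)
  simp only [h.row_sum] at h2
  calc ‖z‖ = ‖(z - (P.map (fun a : ℝ => (a : ℂ))) k k) + (P.map (fun a : ℝ => (a : ℂ))) k k‖ := by
        ring_nf
    _ ≤ _ := norm_add_le _ _
    _ ≤ 1 := by rw [h1]; linarith

theorem secondSpectralRadius_le_one {P : Matrix S S ℝ} {π : S → ℝ} (h : IsReversibleChain P π) :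
    secondSpectralRadius P ≤ 1 := by
  apply Real.sSup_le _ zero_le_one
  rintro _ ⟨z, hz, rfl⟩
  exact norm_le_one_of_mem_roots h (Multiset.mem_of_mem_erase hz)

/-- An eigenvector orthogonal to the constants contributes its eigenvalue to `R`. -/
theorem le_secondSpectralRadius {P : Matrix S S ℝ} {π : S → ℝ} (h : IsReversibleChain P π)
    {f : S → ℝ} {μ : ℝ} (hf : f ≠ 0) (hmean : ∑ x, π x * f x = 0) (hev : P.mulVec f = μ • f) :
    |μ| ≤ secondSpectralRadius P := by
  apply le_csSup
  · refine ⟨1, ?_⟩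
    rintro _ ⟨z, hz, rfl⟩
    exact norm_le_one_of_mem_roots h (Multiset.mem_of_mem_erase hz)
  refine ⟨(μ : ℂ), ?_, by simp⟩
  set Q := P.map (fun a : ℝ => (a : ℂ)) with hQ
  set g : S → ℂ := fun x => (f x : ℂ) with hg
  have hmv : ∀ u : S → ℝ, Q.mulVec (fun x => (u x : ℂ)) = fun x => ((P.mulVec u x : ℝ) : ℂ) := by
    intro u; ext x; simp [hQ, Matrix.mulVec, dotProduct]
  have hgev : g ∈ Module.End.eigenspace (Matrix.toLin' Q) (μ : ℂ) := by
    rw [Module.End.mem_eigenspace_iff, Matrix.toLin'_apply, hmv, hev]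
    ext x; simp [hg]
  have hg0 : g ≠ 0 := by
    intro h0; apply hf; ext x
    have := congrFun h0 x
    simpa [hg] using this
  have hne : Q.charpoly ≠ 0 := (Matrix.charpoly_monic Q).ne_zero
  change (μ : ℂ) ∈ Q.charpoly.roots.erase 1
  -- Only the eigenvalue `1` is affected by the erasure. If `μ = 1`, then `f` and the constants are
  -- independent in the eigenspace (pair with `π`), so `1` is a root of multiplicity at least two
  -- and one copy survives.
  by_cases hμ : (μ : ℂ) = 1
  · rw [hμ] at hgev ⊢
    have hone : (fun _ => 1 : S → ℂ) ∈ Module.End.eigenspace (Matrix.toLin' Q) (1 : ℂ) := by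
      rw [Module.End.mem_eigenspace_iff, Matrix.toLin'_apply]
      have := hmv (fun _ => 1)
      simp only [Complex.ofReal_one] at this
      rw [this]; ext x
      simp [Matrix.mulVec, dotProduct, h.row_sum]
    have hli : LinearIndependent ℂ
        ![(⟨_, hgev⟩ : Module.End.eigenspace (Matrix.toLin' Q) (1 : ℂ)), ⟨_, hone⟩] := by
      rw [LinearIndependent.pair_iff]
      intro s t hst
      have hst' : ∀ x, s * g x + t = 0 := fun x => by
        have := congrArg (fun v : Module.End.eigenspace (Matrix.toLin' Q) (1 : ℂ) => v.1 x) hst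
        simpa using this
      have ht : t = 0 := by
        have h1 : ∑ x, (π x : ℂ) * (s * g x + t) = 0 := by simp [hst']
        have h2 : ∑ x, (π x : ℂ) * (s * g x + t)
            = s * ((∑ x, π x * f x : ℝ) : ℂ) + t * ((∑ x, π x : ℝ) : ℂ) := by
          push_cast
          rw [Finset.mul_sum, Finset.mul_sum, ← Finset.sum_add_distrib]
          exact Finset.sum_congr rfl fun x _ => by simp only [hg]; ring
        rw [h2, hmean, h.sum_eq_one] at h1
        simpa using h1
      subst ht
      refine ⟨?_, rfl⟩
      by_contra hs
      exact hg0 (funext fun x => by simpa [hs] using hst' x)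
    have h2 := hli.fintype_card_le_finrank
    have h3 := LinearMap.finrank_eigenspace_le (Matrix.toLin' Q) (1 : ℂ)
    rw [Matrix.charpoly_toLin', ← Polynomial.count_roots] at h3
    rw [← Multiset.count_pos, Multiset.count_erase_self]
    simp at h2
    omega
  · rw [Multiset.mem_erase_of_ne hμ, Polynomial.mem_roots hne, ← Matrix.charpoly_toLin',
      ← Module.End.hasEigenvalue_iff_isRoot_charpoly]
    exact Module.End.hasEigenvalue_of_hasEigenvector ⟨hgev, hg0⟩

theorem pow_mulVec_of_eigenvector {P : Matrix S S ℝ} {f : S → ℝ} {μ : ℝ}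
    (hev : P.mulVec f = μ • f) (t : ℕ) : (P ^ t).mulVec f = μ ^ t • f := by
  induction t with
  | zero => simp
  | succ t ih => rw [pow_succ, ← Matrix.mulVec_mulVec, hev, Matrix.mulVec_smul, ih, smul_smul,
      pow_succ, mul_comm]

theorem autocorr_of_eigenvector {P : Matrix S S ℝ} {π : S → ℝ}
    {f : S → ℝ} {μ : ℝ} (hmean : ∑ x, π x * f x = 0) (hev : P.mulVec f = μ • f) (t : ℕ) :
    autocorr P π f t = μ ^ t * ∑ x, π x * f x ^ 2 := by
  have h0 : ∑ x, f x * π x = 0 := by rw [← hmean]; exact Finset.sum_congr rfl fun x _ => mul_comm _ _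
  rw [autocorr, h0, Finset.mul_sum]
  simp only [ne_eq, OfNat.ofNat_ne_zero, not_false_eq_true, zero_pow, sub_zero]
  refine Finset.sum_congr rfl fun x _ => ?_
  have h1 := congrFun (pow_mulVec_of_eigenvector hev t) x
  simp only [Matrix.mulVec, dotProduct, Pi.smul_apply, smul_eq_mul] at h1
  calc ∑ y, f x * f y * π x * (P ^ t) x y = f x * π x * ∑ y, (P ^ t) x y * f y := by
        rw [Finset.mul_sum]; exact Finset.sum_congr rfl fun y _ => by ring
    _ = _ := by rw [h1]; ring

/-- The eigenvector itself is the test function: its normalized autocorrelation is exactly `μ ^ t`,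
so the quotient inside the limsup does not vary with `t > 0`. For `μ ≥ 1` the truncation in
`ENNReal.ofReal` makes the denominator zero, in agreement with the bound. -/
theorem le_expTime {P : Matrix S S ℝ} {π : S → ℝ} (h : IsReversibleChain P π)
    {f : S → ℝ} {μ c : ℝ} (hf : f ≠ 0) (hmean : ∑ x, π x * f x = 0) (hev : P.mulVec f = μ • f)
    (hc : 0 < c) (hcμ : c ≤ μ) :
    (ENNReal.ofReal (-Real.log c))⁻¹ ≤ expTime P π := by
  have hμ : 0 < μ := hc.trans_le hcμ
  have hvar : 0 < ∑ x, π x * f x ^ 2 := by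
    obtain ⟨x, hx⟩ := Function.ne_iff.mp hf
    refine Finset.sum_pos' (fun y _ => mul_nonneg (h.pos y).le (sq_nonneg _))
      ⟨x, Finset.mem_univ _, mul_pos (h.pos x) ?_⟩
    have : f x ≠ 0 := hx
    positivity
  have h0 : autocorr P π f 0 ≠ 0 := by
    rw [autocorr_of_eigenvector hmean hev]; simpa using hvar.ne'
  refine le_trans ?_ (le_iSup₂ (f := fun f (_ : autocorr P π f 0 ≠ 0) => expTimeOf P π f) f h0)
  apply Filter.le_limsup_of_frequently_le'
  apply Filter.Eventually.frequently
  filter_upwards [Filter.eventually_gt_atTop 0] with t ht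
  have hρ : normAutocorr P π f t = μ ^ t := by
    rw [normAutocorr, autocorr_of_eigenvector hmean hev, autocorr_of_eigenvector hmean hev]
    field_simp
  rw [hρ, abs_of_pos (pow_pos hμ t), ENNReal.log_ofReal_of_pos (pow_pos hμ t)]
  have h1 : (-((Real.log (μ ^ t) : ℝ) : EReal)).toENNReal = ENNReal.ofReal (-Real.log (μ ^ t)) := by
    rw [← EReal.coe_neg, EReal.toENNReal_of_ne_top (EReal.coe_ne_top _), EReal.toReal_coe]
  rw [h1, Real.log_pow]
  have h2 : ENNReal.ofReal (-((t : ℝ) * Real.log μ)) ≤ t * ENNReal.ofReal (-Real.log c) := by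
    rw [← ENNReal.ofReal_natCast, ← ENNReal.ofReal_mul (Nat.cast_nonneg t)]
    apply ENNReal.ofReal_le_ofReal
    have := Real.log_le_log hc hcμ
    have ht' : (0 : ℝ) ≤ t := Nat.cast_nonneg t
    nlinarith
  calc (ENNReal.ofReal (-Real.log c))⁻¹ = (t : ℝ≥0∞) / (t * ENNReal.ofReal (-Real.log c)) := by
        rw [ENNReal.div_eq_inv_mul, ENNReal.mul_inv (by simp) (by simp), mul_comm, ← mul_assoc,
          ENNReal.mul_inv_cancel (by positivity) (by simp), one_mul]
    _ ≤ _ := ENNReal.div_le_div_left h2 _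

/-- A test function of mean zero with a large Rayleigh quotient yields an eigenvector of mean zero
with a large eigenvalue. -/
theorem exists_eigenvector {P : Matrix S S ℝ} {π : S → ℝ} (h : IsReversibleChain P π)
    {c : ℝ} (hc : 0 < c) {g : S → ℝ} (hg : g ≠ 0) (hgmean : ∑ x, π x * g x = 0)
    (hgc : c * ∑ x, π x * g x ^ 2 ≤ ∑ x, ∑ y, π x * P x y * (g x * g y)) :
    ∃ (f : S → ℝ) (μ : ℝ), f ≠ 0 ∧ ∑ x, π x * f x = 0 ∧ P.mulVec f = μ • f ∧ c ≤ μ := by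
  set w : S → ℝ := fun x => √(π x) with hw
  have hwpos : ∀ x, 0 < w x := fun x => Real.sqrt_pos.mpr (h.pos x)
  have hww : ∀ x, w x * w x = π x := fun x => Real.mul_self_sqrt (h.pos x).le
  -- Conjugation by the square root of `π` makes `P` symmetric, by reversibility; the constant
  -- function becomes the unit vector `w`.
  set A : Matrix S S ℝ := fun x y => w x * P x y * (w y)⁻¹ with hA
  have hAsymm : ∀ x y, A x y = A y x := by
    intro x y
    have h1 := h.reversible x y
    rw [← hww, ← hww] at h1
    have hx := (hwpos x).ne'
    have hy := (hwpos y).ne'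
    simp only [hA]
    field_simp
    linarith
  -- The rank one term removes the trivial eigenvector: `A w = w` gives `H w = c w`, with `c > 0`. A
  -- nonpositive eigenvalue `l` of `H` must therefore come from a vector orthogonal to `w`, on which
  -- `A` has the eigenvalue `c - l ≥ c`.
  set H : Matrix S S ℝ := c • (1 : Matrix S S ℝ) - A + Matrix.of (fun x y => w x * w y) with hH
  have hHapp : ∀ (v : S → ℝ) x, H.mulVec v x =
      c * v x - ∑ y, A x y * v y + w x * ∑ y, w y * v y := by
    intro v x
    simp only [hH, Matrix.add_mulVec, Matrix.sub_mulVec, Matrix.smul_mulVec, Matrix.one_mulVec,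
      Pi.add_apply, Pi.sub_apply, Pi.smul_apply, smul_eq_mul]
    congr 1
    simp only [Matrix.mulVec, dotProduct, Matrix.of_apply, Finset.mul_sum]
    exact Finset.sum_congr rfl fun y _ => by ring
  have hHherm : H.IsHermitian := by
    ext x y
    simp only [hH, Matrix.conjTranspose_apply, Matrix.add_apply, Matrix.sub_apply,
      Matrix.smul_apply, Matrix.of_apply, star_trivial, hAsymm y x, Matrix.one_apply, eq_comm,
      mul_comm]
  have hnot : ¬ H.PosDef := by
    intro hpd
    have hv0 : (fun x => w x * g x) ≠ 0 := by
      intro h0; apply hg; ext x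
      have := congrFun h0 x
      simpa [(hwpos x).ne'] using this
    have h1 := hpd.dotProduct_mulVec_pos hv0
    simp only [dotProduct, Pi.star_apply, star_trivial, hHapp] at h1
    have hz : ∑ y, w y * (w y * g y) = 0 := by
      rw [← hgmean]; exact Finset.sum_congr rfl fun y _ => by rw [← mul_assoc, hww]
    have h2 : ∑ x, w x * g x * (c * (w x * g x) - ∑ y, A x y * (w y * g y)
        + w x * ∑ y, w y * (w y * g y)) = c * ∑ x, π x * g x ^ 2
        - ∑ x, ∑ y, π x * P x y * (g x * g y) := by
      rw [hz, Finset.mul_sum, ← Finset.sum_sub_distrib]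
      refine Finset.sum_congr rfl fun x _ => ?_
      have h3 : ∑ y, A x y * (w y * g y) = ∑ y, w x * P x y * g y :=
        Finset.sum_congr rfl fun y _ => by
          simp only [hA]; have := (hwpos y).ne'; field_simp
      rw [h3, mul_zero, add_zero, mul_sub, Finset.mul_sum]
      congr 1
      · rw [← hww]; ring
      · exact Finset.sum_congr rfl fun y _ => by rw [← hww]; ring
    rw [h2] at h1
    linarith
  rw [hHherm.posDef_iff_eigenvalues_pos] at hnot
  push Not at hnot
  obtain ⟨i, hi⟩ := hnot
  set v : S → ℝ := ⇑(hHherm.eigenvectorBasis i) with hv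
  set l := hHherm.eigenvalues i
  have hvne : v ≠ 0 := by
    intro h0
    apply hHherm.eigenvectorBasis.orthonormal.ne_zero i
    ext x; exact congrFun h0 x
  have hHv : ∀ x, c * v x - ∑ y, A x y * v y + w x * ∑ y, w y * v y = l * v x := by
    intro x
    rw [← hHapp]
    exact congrFun (hHherm.mulVec_eigenvectorBasis i) x
  have hcol : ∀ y, ∑ x, w x * A x y = w y := by
    intro y
    calc ∑ x, w x * A x y = ∑ x, w y * P y x := by
          refine Finset.sum_congr rfl fun x _ => ?_
          rw [hAsymm]; simp only [hA]; have := (hwpos x).ne'; field_simp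
      _ = w y := by rw [← Finset.mul_sum, h.row_sum, mul_one]
  -- Pairing `H v = l v` with `w` gives `(c - l) ⟨w, v⟩ = 0`, and `c - l > 0`.
  have hwv : ∑ y, w y * v y = 0 := by
    have h1 : ∑ x, w x * (c * v x - ∑ y, A x y * v y + w x * ∑ y, w y * v y)
        = ∑ x, w x * (l * v x) := Finset.sum_congr rfl fun x _ => by rw [hHv]
    have h2 : ∑ x, w x * (c * v x - ∑ y, A x y * v y + w x * ∑ y, w y * v y)
        = c * ∑ y, w y * v y := by
      have h3 : ∑ x, w x * ∑ y, A x y * v y = ∑ y, w y * v y := by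
        simp only [Finset.mul_sum]
        rw [Finset.sum_comm]
        refine Finset.sum_congr rfl fun y _ => ?_
        conv_rhs => rw [← hcol y, Finset.sum_mul]
        exact Finset.sum_congr rfl fun x _ => by ring
      have h4 : ∑ x, w x * (w x * ∑ y, w y * v y) = ∑ y, w y * v y := by
        simp only [← mul_assoc, hww]
        rw [← Finset.sum_mul, h.sum_eq_one, one_mul]
      calc _ = ∑ x, (c * (w x * v x) - w x * ∑ y, A x y * v y
              + w x * (w x * ∑ y, w y * v y)) := Finset.sum_congr rfl fun x _ => by ring
        _ = _ := by
            rw [Finset.sum_add_distrib, Finset.sum_sub_distrib, h3, h4, ← Finset.mul_sum]; ring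
    have h5 : ∑ x, w x * (l * v x) = l * ∑ y, w y * v y := by
      rw [Finset.mul_sum]; exact Finset.sum_congr rfl fun y _ => by ring
    rw [h2, h5] at h1
    have h6 : (c - l) * ∑ y, w y * v y = 0 := by linarith
    rcases mul_eq_zero.mp h6 with h7 | h7
    · linarith
    · exact h7
  refine ⟨fun x => (w x)⁻¹ * v x, c - l, ?_, ?_, ?_, by linarith⟩
  · intro h0; apply hvne; ext x
    have := congrFun h0 x
    simpa [(hwpos x).ne'] using this
  · rw [← hwv]
    refine Finset.sum_congr rfl fun x _ => ?_
    rw [← hww]; have := (hwpos x).ne'; field_simp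
  · ext x
    simp only [Matrix.mulVec, dotProduct, Pi.smul_apply, smul_eq_mul]
    have h1 := hHv x
    rw [hwv, mul_zero, add_zero] at h1
    have h2 : ∑ y, A x y * v y = w x * ∑ y, P x y * ((w y)⁻¹ * v y) := by
      rw [Finset.mul_sum]
      exact Finset.sum_congr rfl fun y _ => by simp only [hA]; ring
    have hx := (hwpos x).ne'
    rw [h2] at h1
    have h3 : w x * ∑ y, P x y * ((w y)⁻¹ * v y) = w x * ((c - l) * ((w x)⁻¹ * v x)) := by
      have : w x * ((c - l) * ((w x)⁻¹ * v x)) = (c - l) * v x := by field_simp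
      rw [this]; linarith
    exact mul_left_cancel₀ hx h3

/-- A bottleneck forces an eigenvalue close to one: if the flow out of `A` is at most
`η π(A) π(Aᶜ)`, then `R ≥ 1 - η` and `τ_exp ≥ 1 / (-log (1 - η))`. -/
theorem bottleneck {P : Matrix S S ℝ} {π : S → ℝ} (h : IsReversibleChain P π) (A : S → Prop)
    {η : ℝ} (hη : η < 1)
    (hA : 0 < ∑ x, if A x then π x else 0) (hA' : 0 < ∑ x, if A x then 0 else π x)
    (hflow : flow P π A ≤ η * ((∑ x, if A x then π x else 0) * ∑ x, if A x then 0 else π x)) :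
    1 - η ≤ secondSpectralRadius P ∧
      (ENNReal.ofReal (-Real.log (1 - η)))⁻¹ ≤ expTime P π := by
  set a := ∑ x, if A x then π x else 0 with ha
  set b := ∑ x, if A x then 0 else π x with hb
  have hab : a + b = 1 := by
    rw [ha, hb, ← Finset.sum_add_distrib, ← h.sum_eq_one]
    exact Finset.sum_congr rfl fun x _ => by split_ifs <;> simp
  set g : S → ℝ := fun x => if A x then b else -a with hg
  have hsum : ∀ u v : ℝ, ∑ x, π x * (if A x then u else v) = u * a + v * b := by
    intro u v
    rw [ha, hb, Finset.mul_sum, Finset.mul_sum, ← Finset.sum_add_distrib]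
    exact Finset.sum_congr rfl fun x _ => by split_ifs <;> ring
  have hmean : ∑ x, π x * g x = 0 := by rw [hg, hsum]; ring
  have hsq : ∑ x, π x * g x ^ 2 = a * b := by
    have : ∀ x, g x ^ 2 = if A x then b ^ 2 else a ^ 2 := fun x => by
      simp only [hg]; split_ifs <;> ring
    simp only [this]; rw [hsum]
    have : b ^ 2 * a + a ^ 2 * b = a * b * (a + b) := by ring
    rw [this, hab, mul_one]
  have hg0 : g ≠ 0 := by
    intro h0
    rw [h0] at hsq
    simp at hsq
    rcases hsq with h1 | h1 <;> linarith
  have hflow' : ∑ x, ∑ y, (if ¬ A x ∧ A y then π x * P x y else 0) = flow P π A := by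
    rw [flow, Finset.sum_comm]
    refine Finset.sum_congr rfl fun x _ => Finset.sum_congr rfl fun y _ => ?_
    rw [h.reversible y x]
    simp only [and_comm]
  have hdir : ∑ x, ∑ y, π x * P x y * (g x * g y) = a * b - flow P π A := by
    -- This is `2 g(x) g(y) = g(x)² + g(y)² - (g(x) - g(y))²`, where the last square is the
    -- indicator of a crossing in either direction.
    have h1 : ∀ x y, π x * P x y * (g x * g y) = π x * P x y * g x ^ 2 / 2
        + π y * P y x * g y ^ 2 / 2 - (if A x ∧ ¬ A y then π x * P x y else 0) / 2
        - (if ¬ A x ∧ A y then π x * P x y else 0) / 2 := by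
      intro x y
      rw [← h.reversible x y]
      have hb' : b = 1 - a := by linarith
      simp only [hg, hb']
      by_cases hx : A x <;> by_cases hy : A y <;> simp only [hx, hy, not_true, not_false_iff, and_true, and_false,
        if_true, if_false] <;> ring
    have h2 : ∑ x, ∑ y, π x * P x y * g x ^ 2 / 2 = a * b / 2 := by
      rw [← hsq, Finset.sum_div]
      refine Finset.sum_congr rfl fun x _ => ?_
      calc ∑ y, π x * P x y * g x ^ 2 / 2 = π x * g x ^ 2 / 2 * ∑ y, P x y := by
            rw [Finset.mul_sum]; exact Finset.sum_congr rfl fun y _ => by ring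
        _ = _ := by rw [h.row_sum, mul_one]
    have h3 : ∑ x, ∑ y, π y * P y x * g y ^ 2 / 2 = a * b / 2 := by
      rw [Finset.sum_comm]; exact h2
    simp only [h1, Finset.sum_sub_distrib, Finset.sum_add_distrib, h2, h3]
    simp only [← Finset.sum_div, hflow']
    rw [← flow]
    ring
  obtain ⟨f, μ, hf, hfm, hev, hμ⟩ := exists_eigenvector h (c := 1 - η) (by linarith) hg0 hmean (by
    rw [hsq, hdir]; linarith)
  exact ⟨hμ.trans ((le_abs_self μ).trans (le_secondSpectralRadius h hf hfm hev)),
    le_expTime h hf hfm hev (by linarith) hμ⟩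

end ReversibleChains

/-! ### The Edwards–Sokal coupling: reversibility and flow of the Swendsen–Wang chain. -/

section EdwardsSokal

set_option linter.unusedSectionVars false

theorem edgeSpin_mk {V : Type*} (σ : Spins V) (x y : V) :
    edgeSpin σ s(x, y) = ((σ x * σ y : ℤˣ) : ℤ) := rfl

theorem edgeSpin_eq_one_or {V : Type*} (σ : Spins V) (e : Sym2 V) :
    edgeSpin σ e = 1 ∨ edgeSpin σ e = -1 := by
  rcases Int.units_eq_one_or ((e.map σ).mul : ℤˣ) with h | h <;> simp [edgeSpin, h]

theorem abs_edgeSpin {V : Type*} (σ : Spins V) (e : Sym2 V) : |edgeSpin σ e| = 1 := by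
  rcases edgeSpin_eq_one_or σ e with h | h <;> simp [h]

theorem edgeSpin_mk_inj {V : Type*} {σ σ' : Spins V} {x y : V}
    (h : edgeSpin σ s(x, y) = edgeSpin σ' s(x, y)) : σ x * σ y = σ' x * σ' y := by
  rw [edgeSpin_mk, edgeSpin_mk] at h
  exact Units.ext (by exact_mod_cast h)

variable {V : Type*} [Fintype V] (G : SimpleGraph V) (J : G.edgeSet → ℝ) (β : ℝ)

/-- The unnormalized Gibbs weight. -/
def boltzmann (σ : Spins V) : ℝ := Real.exp (-β * hamiltonian G J σ)

/-- The unnormalized Edwards–Sokal weight of a single edge in the state `b`. -/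
def edgeWeight (σ : Spins V) (e : G.edgeSet) (b : Bool) : ℝ :=
  if b = true then
    (if 0 ≤ J e * edgeSpin σ e then Real.exp (β * |J e|) - Real.exp (-(β * |J e|)) else 0)
  else Real.exp (-(β * |J e|))

/-- The unnormalized Edwards–Sokal weight. -/
def jointWeight (σ : Spins V) (η : G.edgeSet → Bool) : ℝ := ∏ e, edgeWeight G J β σ e (η e)

/-- The spins obey the rule `J_e σ_x σ_y ≥ 0` on every open edge. -/
def Consistent (σ : Spins V) (η : G.edgeSet → Bool) : Prop :=
  ∀ e : G.edgeSet, η e = true → 0 ≤ J e * edgeSpin σ e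

/-- The random cluster weight without the cluster counting factor. -/
def bondWeight (η : G.edgeSet → Bool) : ℝ :=
  ∏ e, if η e = true then Real.exp (β * |J e|) - Real.exp (-(β * |J e|))
    else Real.exp (-(β * |J e|))

variable {G J β}

theorem boltzmann_eq_prod (σ : Spins V) :
    boltzmann G J β σ = ∏ e, Real.exp (β * (J e * edgeSpin σ e)) := by
  rw [boltzmann, hamiltonian, ← Real.exp_sum, ← Finset.mul_sum]
  congr 1; ring

theorem boltzmann_pos (σ : Spins V) : 0 < boltzmann G J β σ := Real.exp_pos _

theorem coupling_mul_spin {σ : Spins V} {e : G.edgeSet} (h : 0 ≤ J e * edgeSpin σ e) :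
    J e * edgeSpin σ e = |J e| := by
  rw [← abs_of_nonneg h, abs_mul, abs_edgeSpin, mul_one]

theorem coupling_mul_spin_neg {σ : Spins V} {e : G.edgeSet} (h : ¬ 0 ≤ J e * edgeSpin σ e) :
    J e * edgeSpin σ e = -|J e| := by
  have h1 := abs_of_neg (not_le.mp h)
  rw [abs_mul, abs_edgeSpin, mul_one] at h1
  linarith

theorem edgeWeight_nonneg (hβ : 0 ≤ β) (σ : Spins V) (e : G.edgeSet) (b : Bool) :
    0 ≤ edgeWeight G J β σ e b := by
  have h : 0 ≤ β * |J e| := mul_nonneg hβ (abs_nonneg _)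
  have h2 : Real.exp (-(β * |J e|)) ≤ Real.exp (β * |J e|) := Real.exp_le_exp.mpr (by linarith)
  unfold edgeWeight
  split_ifs
  · linarith
  · exact le_rfl
  · exact (Real.exp_pos _).le

theorem jointWeight_nonneg (hβ : 0 ≤ β) (σ : Spins V) (η : G.edgeSet → Bool) :
    0 ≤ jointWeight G J β σ η := Finset.prod_nonneg fun e _ => edgeWeight_nonneg hβ σ e _

theorem edgeWeight_sum (σ : Spins V) (e : G.edgeSet) :
    ∑ b, edgeWeight G J β σ e b = Real.exp (β * (J e * edgeSpin σ e)) := by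
  simp only [Fintype.sum_bool, edgeWeight, if_true, Bool.false_eq_true, if_false]
  split_ifs with h
  · rw [coupling_mul_spin h]; ring
  · rw [coupling_mul_spin_neg h]; simp

theorem jointWeight_sum (σ : Spins V) :
    ∑ η, jointWeight G J β σ η = boltzmann G J β σ := by
  rw [boltzmann_eq_prod]
  simp only [← edgeWeight_sum, jointWeight]
  rw [Finset.prod_univ_sum, Fintype.piFinset_univ]

/-- The spins enter only through consistency with the bonds. This symmetry is the source of
reversibility, and it allows spins to be resampled given the bonds. -/
theorem jointWeight_eq (σ : Spins V) (η : G.edgeSet → Bool) :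
    jointWeight G J β σ η = if Consistent G J σ η then bondWeight G J β η else 0 := by
  split_ifs with h
  · refine Finset.prod_congr rfl fun e _ => ?_
    unfold edgeWeight
    by_cases hb : η e = true
    · simp [hb, h e hb]
    · simp [hb]
  · unfold Consistent at h
    push Not at h
    obtain ⟨e, he, hlt⟩ := h
    exact Finset.prod_eq_zero (Finset.mem_univ e) (by simp [edgeWeight, he, hlt.not_ge])

/-- Edge by edge: for `J_e σ_x σ_y ≥ 0` the factor `exp (β |J|)` is split by the opening probability
into `exp (β |J|) - exp (-β |J|)` for open and `exp (-β |J|)` for closed; otherwise the factor `exp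
(-β |J|)` goes entirely to closed. -/
theorem boltzmann_mul_bondStep (σ : Spins V) (η : G.edgeSet → Bool) :
    boltzmann G J β σ * bondStep G J β σ η = jointWeight G J β σ η := by
  rw [boltzmann_eq_prod, bondStep, ← Finset.prod_mul_distrib]
  refine Finset.prod_congr rfl fun e _ => ?_
  unfold edgeWeight bondProb
  by_cases h : 0 ≤ J e * edgeSpin σ e
  · have h1 : Real.exp (β * |J e|) * Real.exp (-2 * β * |J e|) = Real.exp (-(β * |J e|)) := by
      rw [← Real.exp_add]; congr 1; ring
    rw [if_pos h, if_pos h, coupling_mul_spin h]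
    split_ifs
    · rw [mul_sub, h1, mul_one]
    · rw [sub_sub_cancel, h1]
  · rw [if_neg h, if_neg h, coupling_mul_spin_neg h]
    split_ifs <;> simp

theorem bondStep_nonneg (hβ : 0 ≤ β) (σ : Spins V) (η : G.edgeSet → Bool) :
    0 ≤ bondStep G J β σ η := by
  have h := boltzmann_mul_bondStep (G := G) (J := J) (β := β) σ η
  have h1 := jointWeight_nonneg (G := G) (J := J) hβ σ η
  rw [← h] at h1
  exact nonneg_of_mul_nonneg_right h1 (boltzmann_pos σ)

theorem bondStep_sum (σ : Spins V) : ∑ η, bondStep G J β σ η = 1 := by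
  have h := jointWeight_sum (G := G) (J := J) (β := β) σ
  simp only [← boltzmann_mul_bondStep] at h
  rw [← Finset.mul_sum] at h
  exact mul_left_cancel₀ (boltzmann_pos σ).ne' (by rw [h, mul_one])

theorem spinStep_eq (η : G.edgeSet → Bool) (σ : Spins V) :
    spinStep G J η σ = if Consistent G J σ η then
      (1 / 2 : ℝ) ^ Nat.card (openGraph G η).ConnectedComponent else 0 := by
  unfold spinStep Consistent
  congr

theorem spinStep_nonneg (η : G.edgeSet → Bool) (σ : Spins V) : 0 ≤ spinStep G J η σ := by
  unfold spinStep; split_ifs <;> positivity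

/-- The configurations consistent with `η` are parametrized by the spins of the clusters. -/
theorem card_consistent {σ : Spins V} {η : G.edgeSet → Bool} (hσ : Consistent G J σ η)
    (hJ : ∀ e, η e = true → J e ≠ 0) :
    Nat.card {σ' : Spins V // Consistent G J σ' η}
      = 2 ^ Nat.card (openGraph G η).ConnectedComponent := by
  have hadj : ∀ x y, (openGraph G η).Adj x y → ∃ h : s(x, y) ∈ G.edgeSet,
      η ⟨s(x, y), h⟩ = true := fun x y h => by
    rw [openGraph, SimpleGraph.fromEdgeSet_adj] at h; exact h.1
  have hopen : ∀ x y (h : s(x, y) ∈ G.edgeSet), η ⟨s(x, y), h⟩ = true →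
      (openGraph G η).Adj x y := fun x y h hη => by
    rw [openGraph, SimpleGraph.fromEdgeSet_adj]
    exact ⟨⟨h, hη⟩, G.ne_of_adj h⟩
  have hmk : ∀ x y, (openGraph G η).Adj x y →
      (openGraph G η).connectedComponentMk x = (openGraph G η).connectedComponentMk y :=
    fun x y h => SimpleGraph.ConnectedComponent.eq.mpr h.reachable
  -- Relative to the reference configuration `σ`, a sign is chosen freely on each cluster.
  let F : ((openGraph G η).ConnectedComponent → ℤˣ) → {σ' : Spins V // Consistent G J σ' η} :=
    fun τ => ⟨fun x => σ x * τ ((openGraph G η).connectedComponentMk x), by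
      rintro ⟨e, he⟩ hη
      induction e with
      | _ x y =>
        have h1 := hσ ⟨s(x, y), he⟩ hη
        have h2 := hmk x y (hopen x y he hη)
        have h3 : edgeSpin (fun x => σ x * τ ((openGraph G η).connectedComponentMk x)) s(x, y)
            = edgeSpin σ s(x, y) := by
          rw [edgeSpin_mk, edgeSpin_mk, h2, mul_mul_mul_comm, Int.units_mul_self, mul_one]
        simpa only [h3] using h1⟩
  have hF : Function.Bijective F := by
    constructor
    · intro τ τ' h
      ext c
      induction c using SimpleGraph.ConnectedComponent.ind with
      | _ x =>
        have := congrFun (Subtype.ext_iff.mp h) x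
        rw [mul_left_cancel this]
    · rintro ⟨σ', hσ'⟩
      -- Both configurations satisfy the open edge and its coupling is nonzero, so they have the
      -- same product along it; hence `σ * σ'` is constant on clusters.
      have key : ∀ x y, (openGraph G η).Adj x y → σ x * σ' x = σ y * σ' y := by
        intro x y hxy
        obtain ⟨he, hη⟩ := hadj x y hxy
        have h1 := coupling_mul_spin (hσ _ hη)
        have h2 := coupling_mul_spin (hσ' _ hη)
        have h3 := edgeSpin_mk_inj (mul_left_cancel₀ (hJ _ hη) (h1.trans h2.symm))
        calc σ x * σ' x = (σ x * σ y) * (σ' x * σ' y) * (σ y * σ' y)  := by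
              have a := Int.units_mul_self (σ y)
              have b := Int.units_mul_self (σ' y)
              calc σ x * σ' x = σ x * σ' x * (σ y * σ y) * (σ' y * σ' y) := by rw [a, b]; simp
                _ = _ := by ac_rfl
          _ = σ y * σ' y := by rw [h3, Int.units_mul_self, one_mul]
      refine ⟨SimpleGraph.ConnectedComponent.lift (fun x => σ x * σ' x) ?_, ?_⟩
      · intro x y p _
        induction p with
        | nil => rfl
        | cons h _ ih => exact (key _ _ h).trans (ih (by simp_all [SimpleGraph.Walk.isPath_def]))
      · apply Subtype.ext
        ext x
        simp [F, ← mul_assoc]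
  rw [← Nat.card_eq_of_bijective F hF, Nat.card_fun]
  simp

theorem coupling_ne_zero {η : G.edgeSet → Bool} (h : bondWeight G J β η ≠ 0) (e : G.edgeSet)
    (he : η e = true) : J e ≠ 0 := by
  intro h0
  exact Finset.prod_ne_zero_iff.mp h e (Finset.mem_univ e) (by simp [he, h0])

/-- An open edge of zero coupling imposes no constraint, so there the count `2 ^ #clusters` of
consistent spins may fail. Such bond configurations have `bondWeight` zero and are excluded by the
hypothesis. -/
theorem spinStep_sum {σ : Spins V} {η : G.edgeSet → Bool} (h : jointWeight G J β σ η ≠ 0) :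
    ∑ σ', spinStep G J η σ' = 1 := by
  rw [jointWeight_eq] at h
  have hσ : Consistent G J σ η := by by_contra hσ; simp [hσ] at h
  rw [if_pos hσ] at h
  have hc := card_consistent hσ (coupling_ne_zero h)
  simp only [spinStep_eq]
  rw [← Finset.sum_filter, Finset.sum_const, nsmul_eq_mul]
  have h2 : (Finset.univ.filter fun σ' => Consistent G J σ' η).card
      = 2 ^ Nat.card (openGraph G η).ConnectedComponent := by
    rw [← hc, Nat.card_eq_fintype_card, Fintype.card_subtype]
  rw [h2]
  push_cast
  rw [← mul_pow]; norm_num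

theorem gibbs_eq (σ : Spins V) :
    gibbs G J β σ = boltzmann G J β σ / ∑ ω, boltzmann G J β ω := rfl

theorem sum_boltzmann_pos : 0 < ∑ ω, boltzmann G J β ω :=
  Finset.sum_pos (fun ω _ => boltzmann_pos ω) Finset.univ_nonempty

/-- The Swendsen–Wang chain is reversible with respect to the Ising measure. -/
theorem isReversibleChain_swMatrix (hβ : 0 ≤ β) :
    IsReversibleChain (swMatrix G J β) (gibbs G J β) where
  pos σ := div_pos (boltzmann_pos σ) sum_boltzmann_pos
  sum_eq_one := by
    simp only [gibbs_eq]
    rw [← Finset.sum_div, div_self sum_boltzmann_pos.ne']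
  nonneg σ σ' := Finset.sum_nonneg fun η _ =>
    mul_nonneg (bondStep_nonneg hβ σ η) (spinStep_nonneg η σ')
  row_sum σ := by
    simp only [swMatrix]
    rw [Finset.sum_comm, ← bondStep_sum (G := G) (J := J) (β := β) σ]
    refine Finset.sum_congr rfl fun η _ => ?_
    rw [← Finset.mul_sum]
    by_cases h : jointWeight G J β σ η = 0
    · rw [← boltzmann_mul_bondStep] at h
      rw [(mul_eq_zero.mp h).resolve_left (boltzmann_pos σ).ne', zero_mul]
    · rw [spinStep_sum h, mul_one]
  reversible σ σ' := by
    rw [gibbs_eq, gibbs_eq, div_mul_eq_mul_div, div_mul_eq_mul_div]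
    congr 1
    simp only [swMatrix, Finset.mul_sum, ← mul_assoc, boltzmann_mul_bondStep]
    refine Finset.sum_congr rfl fun η _ => ?_
    -- Both sides are now the weight of `η` times its cluster factor, restricted to the `η`
    -- consistent with both `σ` and `σ'`.
    rw [jointWeight_eq, jointWeight_eq, spinStep_eq, spinStep_eq]
    split_ifs <;> simp

/-- The flow out of `A` is at most the probability that the bond configuration does not determine
whether the spins lie in `A`. -/
theorem flow_swMatrix_le (hβ : 0 ≤ β) (A : Spins V → Prop) :
    flow (swMatrix G J β) (gibbs G J β) A * ∑ ω, boltzmann G J β ω ≤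
      ∑ σ, ∑ η, if A σ ∧ ∃ σ', ¬ A σ' ∧ Consistent G J σ' η then jointWeight G J β σ η else 0 := by
  rw [flow, Finset.sum_mul]
  refine Finset.sum_le_sum fun σ _ => ?_
  rw [Finset.sum_mul]
  have h1 : ∀ σ', (if A σ ∧ ¬ A σ' then gibbs G J β σ * swMatrix G J β σ σ' else 0)
      * ∑ ω, boltzmann G J β ω = ∑ η, if A σ ∧ ¬ A σ' then
        jointWeight G J β σ η * spinStep G J η σ' else 0 := by
    intro σ'
    split_ifs with h
    · rw [gibbs_eq, div_mul_eq_mul_div, div_mul_cancel₀ _ sum_boltzmann_pos.ne', swMatrix,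
        Finset.mul_sum]
      exact Finset.sum_congr rfl fun η _ => by rw [← mul_assoc, boltzmann_mul_bondStep]
    · simp
  simp only [h1]
  rw [Finset.sum_comm]
  refine Finset.sum_le_sum fun η _ => ?_
  have hw := jointWeight_nonneg (G := G) (J := J) hβ σ η
  split_ifs with h
  · by_cases h0 : jointWeight G J β σ η = 0
    · simp [h0]
    calc _ ≤ ∑ σ', jointWeight G J β σ η * spinStep G J η σ' := by
          refine Finset.sum_le_sum fun σ' _ => ?_
          have := mul_nonneg hw (spinStep_nonneg (J := J) η σ')
          split_ifs
          · exact le_rfl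
          · exact this
      _ = _ := by rw [← Finset.mul_sum, spinStep_sum h0, mul_one]
  · refine (Finset.sum_eq_zero fun σ' _ => ?_).le
    split_ifs with h2
    · have : ¬ Consistent G J σ' η := fun hc => h ⟨h2.1, σ', h2.2, hc⟩
      rw [spinStep_eq, if_neg this, mul_zero]
    · rfl

end EdwardsSokal

/-! ### Weights with a finite energy property: many closed edges are unlikely. -/

section FiniteEnergy

variable {E : Type*} [DecidableEq E]

/-- If opening an edge of `T` multiplies the weight by at least `r`, then all edges of `W ⊆ T` are
closed with probability at most `(1 + r)^{-|W|}`. -/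
theorem sum_powerset_sdiff_le {T : Finset E} {Y : Finset E → ℝ} {r : ℝ} (hr : 0 ≤ r)
    (hY : ∀ τ ⊆ T, ∀ e ∈ T, e ∉ τ → r * Y τ ≤ Y (insert e τ))
    (W : Finset E) (hW : W ⊆ T) :
    (1 + r) ^ W.card * ∑ τ ∈ (T \ W).powerset, Y τ ≤ ∑ τ ∈ T.powerset, Y τ := by
  induction W using Finset.induction_on with
  | empty => simp
  | insert e W he ih =>
    have heT : e ∈ T := hW (Finset.mem_insert_self e W)
    refine le_trans ?_ (ih ((Finset.subset_insert e W).trans hW))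
    rw [Finset.card_insert_of_notMem he, pow_succ, mul_assoc]
    refine mul_le_mul_of_nonneg_left ?_ (by positivity)
    have h1 : T \ W = insert e (T \ insert e W) := by
      ext x
      simp only [Finset.mem_sdiff, Finset.mem_insert, not_or]
      by_cases hx : x = e
      · subst hx; simp [heT, he]
      · simp [hx]
    have h2 : e ∉ T \ insert e W := by simp
    -- Subsets of `T \ W` come in pairs `τ`, `insert e τ`, and each pair weighs at least `(1 + r) *
    -- Y τ`.
    rw [h1, Finset.sum_powerset_insert h2, add_mul, one_mul, Finset.mul_sum]
    refine add_le_add_right (Finset.sum_le_sum fun τ hτ => ?_) _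
    rw [Finset.mem_powerset] at hτ
    exact hY τ (hτ.trans Finset.sdiff_subset) e heT fun h => h2 (hτ h)

/-- A union bound over a family of sets of closed edges. -/
theorem sum_bad_le {T : Finset E} {Y : Finset E → ℝ} {r : ℝ} (hr : 0 ≤ r)
    (hY0 : ∀ τ, 0 ≤ Y τ)
    (hY : ∀ τ ⊆ T, ∀ e ∈ T, e ∉ τ → r * Y τ ≤ Y (insert e τ))
    (F : Finset (Finset E)) (hF : ∀ W ∈ F, W ⊆ T) (Good : Finset E → Prop) [DecidablePred Good]
    (hGood : ∀ τ ⊆ T, (∀ W ∈ F, ∃ e ∈ W, e ∈ τ) → Good τ) :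
    ∑ τ ∈ T.powerset, (if Good τ then 0 else Y τ) ≤
      (∑ W ∈ F, ((1 + r)⁻¹) ^ W.card) * ∑ τ ∈ T.powerset, Y τ := by
  have h1 : ∀ τ ∈ T.powerset, (if Good τ then 0 else Y τ) ≤
      ∑ W ∈ F, if τ ⊆ T \ W then Y τ else 0 := by
    intro τ hτ
    have hnn : ∀ W ∈ F, 0 ≤ if τ ⊆ T \ W then Y τ else 0 := fun W _ => by
      split_ifs
      · exact hY0 τ
      · exact le_rfl
    split_ifs with hg
    · exact Finset.sum_nonneg hnn
    · rw [Finset.mem_powerset] at hτ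
      have : ∃ W ∈ F, ∀ e ∈ W, e ∉ τ := by
        by_contra hcon
        push Not at hcon
        exact hg (hGood τ hτ hcon)
      obtain ⟨W, hW, hWτ⟩ := this
      refine le_trans ?_ (Finset.single_le_sum hnn hW)
      rw [if_pos]
      intro e he
      exact Finset.mem_sdiff.mpr ⟨hτ he, fun h => hWτ e h he⟩
  refine (Finset.sum_le_sum h1).trans ?_
  rw [Finset.sum_comm, Finset.sum_mul]
  refine Finset.sum_le_sum fun W hW => ?_
  have h2 : ∑ τ ∈ T.powerset, (if τ ⊆ T \ W then Y τ else 0) = ∑ τ ∈ (T \ W).powerset, Y τ := by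
    rw [← Finset.sum_filter]
    congr 1
    ext τ
    simp only [Finset.mem_filter, Finset.mem_powerset]
    exact ⟨fun h => h.2, fun h => ⟨h.trans Finset.sdiff_subset, h⟩⟩
  rw [h2, inv_pow, inv_mul_eq_div, le_div_iff₀ (by positivity), mul_comm]
  exact sum_powerset_sdiff_le hr hY W (hF W hW)

end FiniteEnergy

theorem edgeSpin_eq_one_iff {V : Type*} {σ : Spins V} {x y : V} :
    edgeSpin σ s(x, y) = 1 ↔ σ x = σ y := by
  rw [edgeSpin_mk]
  rcases Int.units_eq_one_or (σ x) with h | h <;> rcases Int.units_eq_one_or (σ y) with h' | h' <;>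
    simp [h, h'] <;> norm_num

theorem reachable_closed {V : Type*} {H : SimpleGraph V} {p : V → Prop}
    (hp : ∀ a b, H.Adj a b → p a → p b) {x z : V} (h : H.Reachable x z) (hx : p x) : p z := by
  obtain ⟨w⟩ := h
  induction w with
  | nil => exact hx
  | cons hab _ ih => exact ih (hp _ _ hab hx)

/-! ### The frustrated double block and the weights obtained by resolving only its strong edges. -/

section Gadget

set_option linter.unusedSectionVars false

variable {V : Type*} [Fintype V] (G : SimpleGraph V) (J : G.edgeSet → ℝ) (β : ℝ)

/-- A frustrated double block: two strongly ferromagnetic regions, the second being `block`, joined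
by `N` weak edges whose couplings are close to `± h / β` with as many positive as negative signs,
and almost disconnected from the remaining vertices. -/
structure Gadget (N : ℕ) (h r : ℝ) where
  strong : Finset G.edgeSet
  weak : Finset G.edgeSet
  link : Fin N → G.edgeSet
  left : Fin N → V
  right : Fin N → V
  sign : Fin N → ℝ
  core : Set V
  block : Set V
  link_injective : Function.Injective link
  link_eq : ∀ i, (link i : Sym2 V) = s(left i, right i)
  disjoint_weak : ∀ e ∈ strong, e ∉ weak
  link_notMem_strong : ∀ i, link i ∉ strong
  link_notMem_weak : ∀ i, link i ∉ weak
  strong_core : ∀ e ∈ strong, ∀ x ∈ (e : Sym2 V), x ∈ core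
  strong_block : ∀ e ∈ strong, ∀ x ∈ (e : Sym2 V), ∀ y ∈ (e : Sym2 V), x ∈ block → y ∈ block
  strong_pos : ∀ e ∈ strong, 0 < J e
  -- Opening a strong edge gains the factor `exp (2 β J) - 1` on spins that agree along it. These
  -- carry at least half of the mass, which explains the factor `2`.
  strong_large : ∀ e ∈ strong, 2 * r ≤ Real.exp (2 * (β * J e)) - 1
  other_core : ∀ e, e ∉ strong → e ∉ weak → (∀ i, e ≠ link i) → ∀ x ∈ (e : Sym2 V), x ∉ core
  block_core : block ⊆ core
  left_notMem : ∀ i, left i ∉ block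
  right_mem : ∀ i, right i ∈ block
  sign_eq : ∀ i, sign i = 1 ∨ sign i = -1
  sign_sum : ∑ i, sign i = 0
  link_coupling : ∀ i, |β * J (link i) - sign i * h| ≤ h / 100
  weak_small : ∑ e ∈ weak, β * |J e| ≤ 1

variable {G J β} {N : ℕ} {h r : ℝ} (D : Gadget G J β N h r)

namespace Gadget

/-- The open strong edges pin most of the link ends on either side to a common spin. -/
def IsPinned (τ : Finset G.edgeSet) (I : Finset (Fin N)) : Prop :=
  -- The fraction 7/8 results from discarding at most 1/16 of the link ends on each side.
  7 * N ≤ 8 * I.card ∧ ∀ σ : Spins V, (∀ e ∈ τ, edgeSpin σ e = 1) →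
    (∀ i ∈ I, ∀ j ∈ I, σ (D.left i) = σ (D.left j)) ∧
    (∀ i ∈ I, ∀ j ∈ I, σ (D.right i) = σ (D.right j))

/-- The two regions are aligned, judged by the majorities of the link ends. -/
def Aligned (σ : Spins V) : Prop :=
  0 < (∑ i, ((σ (D.left i) : ℤ) : ℝ)) * ∑ i, ((σ (D.right i) : ℤ) : ℝ)

/-- The links as a set of edges. -/
def links : Finset G.edgeSet := Finset.univ.image D.link

/-- The edges away from the core. -/
def other : Finset G.edgeSet := Finset.univ \ (D.strong ∪ D.weak ∪ D.links)

theorem mem_links {e : G.edgeSet} : e ∈ D.links ↔ ∃ i, D.link i = e := by simp [links]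

theorem prod_edges (c : G.edgeSet → ℝ) :
    ∏ e, c e = (∏ e ∈ D.strong, c e) * (∏ e ∈ D.weak, c e) * (∏ i, c (D.link i))
      * ∏ e ∈ D.other, c e := by
  have h1 : ∏ i, c (D.link i) = ∏ e ∈ D.links, c e := by
    rw [links, Finset.prod_image fun i _ j _ hij => D.link_injective hij]
  have h2 : Disjoint D.strong D.weak := Finset.disjoint_left.mpr D.disjoint_weak
  have h3 : Disjoint (D.strong ∪ D.weak) D.links := by
    rw [Finset.disjoint_left]
    intro e he hl
    obtain ⟨i, rfl⟩ := D.mem_links.mp hl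
    rcases Finset.mem_union.mp he with h | h
    · exact D.link_notMem_strong i h
    · exact D.link_notMem_weak i h
  rw [h1, ← Finset.prod_union h2, ← Finset.prod_union h3, other, mul_comm,
    Finset.prod_sdiff (Finset.subset_univ _)]

theorem other_notMem {e : G.edgeSet} (he : e ∈ D.other) (x : V) (hx : x ∈ (e : Sym2 V)) :
    x ∉ D.core := by
  simp only [other, Finset.mem_sdiff, Finset.mem_univ, true_and, Finset.mem_union, not_or] at he
  exact D.other_core e he.1.1 he.1.2 (fun i hi => he.2 (D.mem_links.mpr ⟨i, hi.symm⟩)) x hx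

/-- Weight of the spins and the open strong edges when weak edges and links are ignored. -/
def weight (τ : Finset G.edgeSet) (σ : Spins V) : ℝ :=
  (∏ e ∈ D.strong, edgeWeight G J β σ e (decide (e ∈ τ)))
    * ∏ e ∈ D.other, Real.exp (β * (J e * edgeSpin σ e))

/-- Total weight of a set of open strong edges when weak edges and links are ignored. -/
def mass (τ : Finset G.edgeSet) : ℝ := ∑ σ, D.weight τ σ

theorem weight_nonneg (hβ : 0 ≤ β) (τ : Finset G.edgeSet) (σ : Spins V) : 0 ≤ D.weight τ σ :=
  mul_nonneg (Finset.prod_nonneg fun e _ => edgeWeight_nonneg hβ σ e _)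
    (Finset.prod_nonneg fun _ _ => (Real.exp_pos _).le)

theorem mass_nonneg (hβ : 0 ≤ β) (τ : Finset G.edgeSet) : 0 ≤ D.mass τ :=
  Finset.sum_nonneg fun σ _ => D.weight_nonneg hβ τ σ

theorem edgeSpin_eq_one_of_pos {σ : Spins V} {e : G.edgeSet} (he : 0 < J e)
    (h : 0 ≤ J e * edgeSpin σ e) : edgeSpin σ e = 1 := by
  have h1 := coupling_mul_spin h
  rw [abs_of_pos he] at h1
  exact mul_left_cancel₀ he.ne' (h1.trans (mul_one _).symm)

theorem edgeSpin_of_weight_ne_zero {τ : Finset G.edgeSet} (hτ : τ ⊆ D.strong) {σ : Spins V}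
    (hw : D.weight τ σ ≠ 0) : ∀ e ∈ τ, edgeSpin σ e = 1 := by
  intro e he
  have h1 := Finset.prod_ne_zero_iff.mp (left_ne_zero_of_mul hw) e (hτ he)
  apply edgeSpin_eq_one_of_pos (D.strong_pos e (hτ he))
  by_contra hcon
  exact h1 (by simp [edgeWeight, he, hcon])

end Gadget

/-- Reverse the spins in `C`. -/
def flipOn (C : Set V) (σ : Spins V) : Spins V := fun x => if x ∈ C then -σ x else σ x

theorem flipOn_involutive (C : Set V) : Function.Involutive (flipOn C) := by
  intro σ; ext x; unfold flipOn; split_ifs <;> simp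

theorem edgeSpin_flipOn {C : Set V} (σ : Spins V) {e : Sym2 V}
    (he : ∀ x ∈ e, ∀ y ∈ e, x ∈ C → y ∈ C) : edgeSpin (flipOn C σ) e = edgeSpin σ e := by
  induction e with
  | _ x y =>
    have h1 := he x (by simp) y (by simp)
    have h2 := he y (by simp) x (by simp)
    rw [edgeSpin_mk, edgeSpin_mk]
    unfold flipOn
    by_cases hx : x ∈ C
    · simp [hx, h1 hx]
    · simp [hx, mt h2 hx]

theorem edgeSpin_flipOn_of_cut {C : Set V} (σ : Spins V) {x y : V}
    (hx : x ∈ C) (hy : y ∉ C) : edgeSpin (flipOn C σ) s(x, y) = -edgeSpin σ s(x, y) := by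
  rw [edgeSpin_mk, edgeSpin_mk]
  simp [flipOn, hx, hy]

namespace Gadget

/-- No factor changes: edges of `τ` do not cross the boundary of `C`, closed strong edges have a
weight independent of the spins, and the edges in `other` avoid the core. -/
theorem weight_flipOn {τ : Finset G.edgeSet} {C : Set V} (hC : C ⊆ D.core)
    (hτC : ∀ e ∈ τ, ∀ x ∈ (e : Sym2 V), ∀ y ∈ (e : Sym2 V), x ∈ C → y ∈ C) (σ : Spins V) :
    D.weight τ (flipOn C σ) = D.weight τ σ := by
  unfold weight
  congr 1
  · refine Finset.prod_congr rfl fun e _ => ?_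
    unfold edgeWeight
    by_cases he : e ∈ τ
    · rw [edgeSpin_flipOn σ (hτC e he)]
    · simp [he]
  · refine Finset.prod_congr rfl fun e he => ?_
    rw [edgeSpin_flipOn σ fun x hx y _ hxC => absurd (hC hxC) (D.other_notMem he x hx)]

/-- At least half of the weight of `τ` agrees along any given strong edge. -/
theorem mass_le_two_mul (hβ : 0 ≤ β) {τ : Finset G.edgeSet} (hτ : τ ⊆ D.strong) {e : G.edgeSet}
    (he : e ∈ D.strong) :
    D.mass τ ≤ 2 * ∑ σ, if edgeSpin σ e = 1 then D.weight τ σ else 0 := by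
  obtain ⟨⟨x, y⟩, hxy⟩ : ∃ p : V × V, (e : Sym2 V) = s(p.1, p.2) := by
    obtain ⟨e, he'⟩ := e
    induction e with
    | _ x y => exact ⟨(x, y), rfl⟩
  simp only at hxy
  set H : SimpleGraph V := SimpleGraph.fromEdgeSet ((fun f : G.edgeSet => (f : Sym2 V)) '' τ) with hH
  -- The cluster of `x` under `τ`. If it contains `y`, positive weight forces agreement along `e`;
  -- otherwise reversing `C` preserves the weight and exchanges agreement with disagreement.
  set C : Set V := {z | H.Reachable x z} with hCdef
  have hadj : ∀ a b, H.Adj a b → ∃ f ∈ τ, (f : Sym2 V) = s(a, b) := by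
    intro a b hab
    rw [hH, SimpleGraph.fromEdgeSet_adj] at hab
    obtain ⟨⟨f, hf, hfe⟩, _⟩ := hab
    exact ⟨f, hf, hfe⟩
  have hxcore : x ∈ D.core := D.strong_core e he x (by rw [hxy]; simp)
  have hC : C ⊆ D.core := by
    intro z hz
    refine reachable_closed (p := (· ∈ D.core)) (fun a b hab _ => ?_) hz hxcore
    obtain ⟨f, hf, hfe⟩ := hadj a b hab
    exact D.strong_core f (hτ hf) b (by rw [hfe]; simp)
  have hτC : ∀ f ∈ τ, ∀ a ∈ (f : Sym2 V), ∀ b ∈ (f : Sym2 V), a ∈ C → b ∈ C := by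
    intro f hf a ha b hb haC
    by_cases hab : a = b
    · exact hab ▸ haC
    have : H.Adj a b := by
      rw [hH, SimpleGraph.fromEdgeSet_adj]
      exact ⟨⟨f, hf, (Sym2.mem_and_mem_iff hab).mp ⟨ha, hb⟩⟩, hab⟩
    exact SimpleGraph.Reachable.trans haC this.reachable
  have hsplit : D.mass τ = (∑ σ, if edgeSpin σ e = 1 then D.weight τ σ else 0)
      + ∑ σ, if edgeSpin σ e = 1 then 0 else D.weight τ σ := by
    rw [mass, ← Finset.sum_add_distrib]
    exact Finset.sum_congr rfl fun σ _ => by split_ifs <;> simp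
  have hle : (∑ σ, if edgeSpin σ e = 1 then 0 else D.weight τ σ)
      ≤ ∑ σ, if edgeSpin σ e = 1 then D.weight τ σ else 0 := by
    by_cases hy : y ∈ C
    · have hzero : ∀ σ, (if edgeSpin σ e = 1 then 0 else D.weight τ σ) = 0 := by
        intro σ
        by_contra hcon
        split_ifs at hcon with h1
        · exact hcon rfl
        apply h1
        have hall := D.edgeSpin_of_weight_ne_zero hτ hcon
        have hconst : ∀ z, H.Reachable x z → σ x = σ z := by
          intro z hz
          refine reachable_closed (p := fun z => σ x = σ z) (fun a b hab ha => ?_) hz rfl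
          obtain ⟨f, hf, hfe⟩ := hadj a b hab
          have h2 := hall f hf
          rw [hfe, edgeSpin_eq_one_iff] at h2
          exact ha.trans h2
        rw [hxy, edgeSpin_mk, hconst y hy]
        simp
      rw [Finset.sum_eq_zero fun σ _ => hzero σ]
      refine Finset.sum_nonneg fun σ _ => ?_
      split_ifs
      · exact D.weight_nonneg hβ τ σ
      · exact le_rfl
    · have hxC : x ∈ C := SimpleGraph.Reachable.refl x
      rw [← Equiv.sum_comp (flipOn_involutive C).toPerm]
      refine Finset.sum_le_sum fun σ _ => ?_
      simp only [Function.Involutive.coe_toPerm, D.weight_flipOn hC hτC]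
      rw [hxy, edgeSpin_flipOn_of_cut σ hxC hy]
      have hw := D.weight_nonneg hβ τ σ
      rcases edgeSpin_eq_one_or σ s(x, y) with h1 | h1 <;> rw [h1] <;> norm_num [hw]
  linarith

theorem weight_insert {τ : Finset G.edgeSet} {e : G.edgeSet} (he : e ∈ D.strong) (heτ : e ∉ τ)
    (σ : Spins V) : D.weight (insert e τ) σ
      = if edgeSpin σ e = 1 then (Real.exp (2 * (β * J e)) - 1) * D.weight τ σ else 0 := by
  have hJ := D.strong_pos e he
  unfold weight
  rw [← Finset.mul_prod_erase _ _ he, ← Finset.mul_prod_erase D.strong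
    (fun f => edgeWeight G J β σ f (decide (f ∈ τ))) he]
  have h1 : ∏ f ∈ D.strong.erase e, edgeWeight G J β σ f (decide (f ∈ insert e τ))
      = ∏ f ∈ D.strong.erase e, edgeWeight G J β σ f (decide (f ∈ τ)) := by
    refine Finset.prod_congr rfl fun f hf => ?_
    simp [Finset.ne_of_mem_erase hf]
  rw [h1]
  have h2 : edgeWeight G J β σ e (decide (e ∈ τ)) = Real.exp (-(β * J e)) := by
    simp [edgeWeight, heτ, abs_of_pos hJ]
  have h3 : Real.exp (β * J e) = Real.exp (2 * (β * J e)) * Real.exp (-(β * J e)) := by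
    rw [← Real.exp_add]; congr 1; ring
  rw [h2]
  split_ifs with hs
  · have h4 : edgeWeight G J β σ e (decide (e ∈ insert e τ))
        = (Real.exp (2 * (β * J e)) - 1) * Real.exp (-(β * J e)) := by
      simp [edgeWeight, hs, hJ.le, abs_of_pos hJ]
      rw [h3]; ring
    rw [h4]; ring
  · have h4 : edgeWeight G J β σ e (decide (e ∈ insert e τ)) = 0 := by
      have : edgeSpin σ e = -1 := (edgeSpin_eq_one_or σ e).resolve_left hs
      simp [edgeWeight, this, hJ.not_ge]
    rw [h4]; ring

/-- The finite energy property required by `sum_bad_le`, uniform in the surrounding couplings. -/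
theorem mass_insert (hβ : 0 ≤ β) {τ : Finset G.edgeSet} (hτ : τ ⊆ D.strong) {e : G.edgeSet}
    (he : e ∈ D.strong) (heτ : e ∉ τ) : r * D.mass τ ≤ D.mass (insert e τ) := by
  have h1 : D.mass (insert e τ) = (Real.exp (2 * (β * J e)) - 1)
      * ∑ σ, if edgeSpin σ e = 1 then D.weight τ σ else 0 := by
    rw [mass, Finset.mul_sum]
    exact Finset.sum_congr rfl fun σ _ => by rw [D.weight_insert he heτ]; split_ifs <;> simp
  have h2 := D.mass_le_two_mul hβ hτ he
  have h3 := D.strong_large e he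
  have h4 := D.mass_nonneg hβ τ
  have h5 : 0 ≤ Real.exp (2 * (β * J e)) - 1 := by
    have := Real.one_le_exp (x := 2 * (β * J e)) (by
      have := mul_nonneg hβ (D.strong_pos e he).le; linarith)
    linarith
  rw [h1]
  nlinarith

/-- Edge weights after fixing the open strong edges to be `τ` and closing the edges in `K`. -/
def fixedWeight (τ K : Finset G.edgeSet) (σ : Spins V) (e : G.edgeSet) : ℝ :=
  if e ∈ D.strong then edgeWeight G J β σ e (decide (e ∈ τ))
  else if e ∈ K then Real.exp (-(β * |J e|)) else Real.exp (β * (J e * edgeSpin σ e))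

/-- The open strong edges of a bond configuration. -/
def openStrong (η : G.edgeSet → Bool) : Finset G.edgeSet := D.strong.filter fun e => η e = true

/-- The constraints on `η` concern one edge at a time, so the sum over `η` factorizes; summing over
both states of an unconstrained edge restores its Boltzmann factor. -/
theorem sum_jointWeight_fixed {τ K : Finset G.edgeSet} (hτ : τ ⊆ D.strong)
    (hK : ∀ e ∈ K, e ∉ D.strong) (σ : Spins V) :
    ∑ η, (if D.openStrong η = τ ∧ ∀ e ∈ K, η e = false then jointWeight G J β σ η else 0)
      = ∏ e, D.fixedWeight τ K σ e := by
  set ψ : G.edgeSet → Bool → ℝ := fun e b =>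
    if e ∈ D.strong then (if b = decide (e ∈ τ) then edgeWeight G J β σ e b else 0)
    else if e ∈ K then (if b = false then edgeWeight G J β σ e b else 0)
    else edgeWeight G J β σ e b with hψ
  have h1 : ∀ e, D.fixedWeight τ K σ e = ∑ b, ψ e b := by
    intro e
    simp only [fixedWeight, hψ]
    split_ifs with ha hb
    · simp
    · simp [edgeWeight]
    · rw [edgeWeight_sum]
  simp only [h1]
  rw [Finset.prod_univ_sum, Fintype.piFinset_univ]
  refine Finset.sum_congr rfl fun η _ => ?_
  split_ifs with hη
  · refine Finset.prod_congr rfl fun e _ => ?_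
    simp only [hψ]
    split_ifs with ha hb hb hc
    · rfl
    · exfalso; apply hb
      rw [← hη.1]
      simp [openStrong, ha]
    · rfl
    · exact absurd (hη.2 e hb) hc
    · rfl
  · symm
    rw [not_and_or] at hη
    rcases hη with hη | hη
    · have : ∃ e ∈ D.strong, η e ≠ decide (e ∈ τ) := by
        by_contra hcon
        push Not at hcon
        apply hη
        ext e
        simp only [openStrong, Finset.mem_filter]
        constructor
        · rintro ⟨ha, hb⟩; rw [hcon e ha] at hb; simpa using hb
        · intro ha; exact ⟨hτ ha, by rw [hcon e (hτ ha)]; simpa using ha⟩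
      obtain ⟨e, he, hne⟩ := this
      exact Finset.prod_eq_zero (Finset.mem_univ e) (by simp [hψ, he, hne])
    · push Not at hη
      obtain ⟨e, he, hne⟩ := hη
      exact Finset.prod_eq_zero (Finset.mem_univ e) (by simp [hψ, hK e he, he, hne])

theorem sum_over_openStrong (F : (G.edgeSet → Bool) → ℝ) :
    ∑ η, F η = ∑ τ ∈ D.strong.powerset, ∑ η, if D.openStrong η = τ then F η else 0 := by
  rw [Finset.sum_comm]
  refine Finset.sum_congr rfl fun η _ => ?_
  rw [Finset.sum_ite_eq, if_pos]
  simp [openStrong]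

theorem boltzmann_eq_sum (σ : Spins V) :
    boltzmann G J β σ = ∑ τ ∈ D.strong.powerset, ∏ e, D.fixedWeight τ ∅ σ e := by
  rw [← jointWeight_sum, D.sum_over_openStrong]
  refine Finset.sum_congr rfl fun τ hτ => ?_
  rw [← D.sum_jointWeight_fixed (Finset.mem_powerset.mp hτ) (by simp)]
  simp

theorem prod_fixedWeight {τ K : Finset G.edgeSet} (hK : ∀ e ∈ K, e ∈ D.links) (σ : Spins V) :
    ∏ e, D.fixedWeight τ K σ e = D.weight τ σ
      * (∏ e ∈ D.weak, Real.exp (β * (J e * edgeSpin σ e)))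
      * ∏ i, if D.link i ∈ K then Real.exp (-(β * |J (D.link i)|))
          else Real.exp (β * (J (D.link i) * edgeSpin σ (D.link i))) := by
  rw [D.prod_edges, weight]
  have h1 : ∏ e ∈ D.strong, D.fixedWeight τ K σ e
      = ∏ e ∈ D.strong, edgeWeight G J β σ e (decide (e ∈ τ)) :=
    Finset.prod_congr rfl fun e he => by simp [fixedWeight, he]
  have h2 : ∏ e ∈ D.weak, D.fixedWeight τ K σ e
      = ∏ e ∈ D.weak, Real.exp (β * (J e * edgeSpin σ e)) :=
    Finset.prod_congr rfl fun e he => by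
      have ha : e ∉ D.strong := fun hs => D.disjoint_weak e hs he
      have hb : e ∉ K := fun hk => by
        obtain ⟨i, rfl⟩ := D.mem_links.mp (hK e hk)
        exact D.link_notMem_weak i he
      simp [fixedWeight, ha, hb]
  have h3 : ∏ e ∈ D.other, D.fixedWeight τ K σ e
      = ∏ e ∈ D.other, Real.exp (β * (J e * edgeSpin σ e)) :=
    Finset.prod_congr rfl fun e he => by
      simp only [other, Finset.mem_sdiff, Finset.mem_univ, true_and, Finset.mem_union, not_or] at he
      simp [fixedWeight, he.1.1, mt (hK e) he.2]
  have h4 : ∏ i, D.fixedWeight τ K σ (D.link i)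
      = ∏ i, if D.link i ∈ K then Real.exp (-(β * |J (D.link i)|))
          else Real.exp (β * (J (D.link i) * edgeSpin σ (D.link i))) :=
    Finset.prod_congr rfl fun i _ => by simp [fixedWeight, D.link_notMem_strong i]
  rw [h1, h2, h3, h4]
  ring

theorem abs_mul_edgeSpin (hβ : 0 ≤ β) (σ : Spins V) (e : G.edgeSet) :
    |β * (J e * edgeSpin σ e)| = β * |J e| := by
  rw [abs_mul, abs_mul, abs_edgeSpin, mul_one, abs_of_nonneg hβ]

theorem weak_le (hβ : 0 ≤ β) (σ : Spins V) :
    ∏ e ∈ D.weak, Real.exp (β * (J e * edgeSpin σ e)) ≤ Real.exp 1 := by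
  rw [← Real.exp_sum, Real.exp_le_exp]
  refine le_trans (Finset.sum_le_sum fun e _ => ?_) D.weak_small
  exact (le_abs_self _).trans (abs_mul_edgeSpin hβ σ e).le

theorem le_weak (hβ : 0 ≤ β) (σ : Spins V) :
    Real.exp (-1) ≤ ∏ e ∈ D.weak, Real.exp (β * (J e * edgeSpin σ e)) := by
  rw [← Real.exp_sum, Real.exp_le_exp]
  have h1 : -∑ e ∈ D.weak, β * |J e| ≤ ∑ e ∈ D.weak, β * (J e * edgeSpin σ e) := by
    rw [← Finset.sum_neg_distrib]
    refine Finset.sum_le_sum fun e _ => ?_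
    rw [← abs_mul_edgeSpin hβ σ e]
    exact neg_abs_le _
  have := D.weak_small
  linarith

theorem link_abs_bounds (hβ : 0 ≤ β) (hh : 0 < h) (i : Fin N) :
    99 / 100 * h ≤ β * |J (D.link i)| ∧ β * |J (D.link i)| ≤ 101 / 100 * h := by
  have h1 := D.link_coupling i
  have h2 : β * |J (D.link i)| = |β * J (D.link i)| := by rw [abs_mul, abs_of_nonneg hβ]
  have h3 : |D.sign i * h| = h := by
    rw [abs_mul, abs_of_pos hh]; rcases D.sign_eq i with hs | hs <;> simp [hs]
  have h4 := abs_sub_abs_le_abs_sub (β * J (D.link i)) (D.sign i * h)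
  have h5 := abs_sub_abs_le_abs_sub (D.sign i * h) (β * J (D.link i))
  rw [abs_sub_comm] at h5
  rw [h2]
  constructor <;> linarith

end Gadget

end Gadget

/-! ### Equilibrium weights of the two alignments and the flow between them. -/

section GadgetBounds

set_option linter.unusedSectionVars false

variable {V : Type*} [Fintype V] {G : SimpleGraph V} {J : G.edgeSet → ℝ} {β : ℝ}
  {N : ℕ} {h r : ℝ} (D : Gadget G J β N h r)

/-- At least 7/8 of the signs equal `c`, so `c` wins the majority by at least `3 N / 4`. -/
theorem sign_mul_sum_pos {a : Fin N → ℝ} (ha : ∀ i, a i = 1 ∨ a i = -1) {I : Finset (Fin N)}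
    (hI : 7 * N ≤ 8 * I.card) (hN : 0 < N) {c : ℝ} (hc : c = 1 ∨ c = -1)
    (hac : ∀ i ∈ I, a i = c) : 0 < c * ∑ i, a i := by
  have h1 : ∀ i, (if i ∈ I then (2 : ℝ) else 0) - 1 ≤ c * a i := by
    intro i
    split_ifs with hi
    · rw [hac i hi]; rcases hc with rfl | rfl <;> norm_num
    · rcases hc with rfl | rfl <;> rcases ha i with h | h <;> rw [h] <;> norm_num
  rw [Finset.mul_sum]
  refine lt_of_lt_of_le ?_ (Finset.sum_le_sum fun i _ => h1 i)
  rw [Finset.sum_sub_distrib, Finset.sum_ite_mem, Finset.univ_inter, Finset.sum_const,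
    Finset.sum_const, nsmul_eq_mul, nsmul_eq_mul, Finset.card_univ, Fintype.card_fin]
  have h2 : (7 : ℝ) * N ≤ 8 * I.card := by exact_mod_cast hI
  have h3 : (0 : ℝ) < N := by exact_mod_cast hN
  linarith

namespace Gadget

theorem unit_cast (u : ℤˣ) : (((u : ℤˣ) : ℤ) : ℝ) = 1 ∨ (((u : ℤˣ) : ℤ) : ℝ) = -1 := by
  rcases Int.units_eq_one_or u with h | h <;> simp [h]

/-- Under pinning, the majority on each side is the common spin of the pinned ends. Hence any single
pinned link reveals the alignment. -/
theorem aligned_iff {D : Gadget G J β N h r} {τ : Finset G.edgeSet} {I : Finset (Fin N)}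
    (hI : D.IsPinned τ I) (hN : 0 < N)
    {σ : Spins V} (hσ : ∀ e ∈ τ, edgeSpin σ e = 1) {i : Fin N} (hi : i ∈ I) :
    D.Aligned σ ↔ edgeSpin σ (D.link i) = 1 := by
  obtain ⟨hcard, hpin⟩ := hI
  obtain ⟨hL, hR⟩ := hpin σ hσ
  have h1 := sign_mul_sum_pos (a := fun j => ((σ (D.left j) : ℤ) : ℝ)) (fun j => unit_cast _) hcard
    hN (unit_cast (σ (D.left i))) (fun j hj => by simp only [hL j hj i hi])
  have h2 := sign_mul_sum_pos (a := fun j => ((σ (D.right j) : ℤ) : ℝ)) (fun j => unit_cast _) hcard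
    hN (unit_cast (σ (D.right i))) (fun j hj => by simp only [hR j hj i hi])
  have h3 := mul_pos h1 h2
  rw [D.link_eq, edgeSpin_mk, Aligned]
  push_cast
  set u : ℝ := ((σ (D.left i) : ℤ) : ℝ)
  set v : ℝ := ((σ (D.right i) : ℤ) : ℝ)
  set A := ∑ i, ((σ (D.left i) : ℤ) : ℝ)
  set B := ∑ i, ((σ (D.right i) : ℤ) : ℝ)
  have hu : u = 1 ∨ u = -1 := unit_cast _
  have hv : v = 1 ∨ v = -1 := unit_cast _
  rcases hu with hu | hu <;> rcases hv with hv | hv <;> simp only [hu, hv] at h3 ⊢ <;>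
    norm_num at h3 ⊢ <;> linarith

theorem IsPinned.nonempty {D : Gadget G J β N h r} {τ : Finset G.edgeSet} {I : Finset (Fin N)}
    (hI : D.IsPinned τ I) (hN : 0 < N) : I.Nonempty := by
  rw [← Finset.card_pos]; have := hI.1; omega

/-- Exactly half of the weight of a pinning set of strong edges is carried by aligned spins. -/
theorem sum_aligned {D : Gadget G J β N h r} {τ : Finset G.edgeSet} (hτ : τ ⊆ D.strong)
    {I : Finset (Fin N)} (hI : D.IsPinned τ I) (hN : 0 < N) :
    (∑ σ, if D.Aligned σ then D.weight τ σ else 0) = D.mass τ / 2 ∧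
      (∑ σ, if D.Aligned σ then 0 else D.weight τ σ) = D.mass τ / 2 := by
  obtain ⟨i, hi⟩ := hI.nonempty hN
  have hadd : (∑ σ, if D.Aligned σ then D.weight τ σ else 0)
      + (∑ σ, if D.Aligned σ then 0 else D.weight τ σ) = D.mass τ := by
    rw [mass, ← Finset.sum_add_distrib]
    exact Finset.sum_congr rfl fun σ _ => by split_ifs <;> simp
  -- Reversing `D.block` keeps the weight, as no strong edge leaves the block, and changes the
  -- agreement across every link.
  have hswap : (∑ σ, if D.Aligned σ then D.weight τ σ else 0)
      = ∑ σ, if D.Aligned σ then 0 else D.weight τ σ := by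
    rw [← Equiv.sum_comp (flipOn_involutive D.block).toPerm]
    refine Finset.sum_congr rfl fun σ _ => ?_
    change (if D.Aligned (flipOn D.block σ) then D.weight τ (flipOn D.block σ) else 0) = _
    have hblock : ∀ e ∈ τ, ∀ x ∈ (e : Sym2 V), ∀ y ∈ (e : Sym2 V), x ∈ D.block → y ∈ D.block :=
      fun e he => D.strong_block e (hτ he)
    rw [D.weight_flipOn D.block_core hblock]
    by_cases hw : D.weight τ σ = 0
    · simp [hw]
    have hσ := D.edgeSpin_of_weight_ne_zero hτ hw
    have hσ' : ∀ e ∈ τ, edgeSpin (flipOn D.block σ) e = 1 := fun e he => by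
      rw [edgeSpin_flipOn σ (hblock e he), hσ e he]
    have hiff : D.Aligned (flipOn D.block σ) ↔ ¬ D.Aligned σ := by
      rw [aligned_iff hI hN hσ hi, aligned_iff hI hN hσ' hi, D.link_eq, Sym2.eq_swap,
        edgeSpin_flipOn_of_cut σ (D.right_mem i) (D.left_notMem i)]
      rcases edgeSpin_eq_one_or σ s(D.right i, D.left i) with h1 | h1 <;> rw [h1] <;> norm_num
    by_cases hA : D.Aligned σ
    · rw [if_pos hA, if_neg fun h => hiff.mp h hA]
    · rw [if_neg hA, if_pos (hiff.mpr hA)]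
  constructor <;> linarith

/-- A closed link contributes at most `exp (-0.99 h)`, any other link at most `exp (1.01 h)`: each
closed link costs `2 h`. -/
theorem links_le (hβ : 0 ≤ β) (hh : 0 < h) (I : Finset (Fin N)) (σ : Spins V) :
    (∏ i, if D.link i ∈ I.image D.link then Real.exp (-(β * |J (D.link i)|))
          else Real.exp (β * (J (D.link i) * edgeSpin σ (D.link i))))
      ≤ Real.exp (101 / 100 * (h * N) - 2 * h * I.card) := by
  have h1 : ∀ i, (if D.link i ∈ I.image D.link then Real.exp (-(β * |J (D.link i)|))
          else Real.exp (β * (J (D.link i) * edgeSpin σ (D.link i))))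
        ≤ Real.exp (101 / 100 * h - if i ∈ I then 2 * h else 0) := by
    intro i
    have hb := D.link_abs_bounds hβ hh i
    have hmem : D.link i ∈ I.image D.link ↔ i ∈ I := by
      simp only [Finset.mem_image]
      exact ⟨fun ⟨j, hj, hji⟩ => D.link_injective hji ▸ hj, fun hi => ⟨i, hi, rfl⟩⟩
    simp only [hmem]
    split_ifs with hi
    · rw [Real.exp_le_exp]; linarith
    · rw [Real.exp_le_exp]
      have := (le_abs_self _).trans (abs_mul_edgeSpin (J := J) hβ σ (D.link i)).le
      linarith
  refine (Finset.prod_le_prod (fun i _ => ?_) fun i _ => h1 i).trans ?_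
  · split_ifs <;> exact (Real.exp_pos _).le
  · rw [← Real.exp_sum, Real.exp_le_exp, Finset.sum_sub_distrib, Finset.sum_ite_mem,
      Finset.univ_inter]
    simp only [Finset.sum_const, Finset.card_univ, Fintype.card_fin, nsmul_eq_mul]
    linarith

/-- This is where frustration enters. If all links had the spin product of the pinned ones, their
nominal energies would cancel because `sign` sums to zero. The at most `N / 8` unpinned links change
this by at most `2 h` each and the coupling errors by `h / 100` each, in total `0.26 h N`. -/
theorem le_links (hh : 0 < h) {τ : Finset G.edgeSet} {I : Finset (Fin N)}
    (hI : D.IsPinned τ I) (hN : 0 < N) {σ : Spins V} (hσ : ∀ e ∈ τ, edgeSpin σ e = 1) :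
    Real.exp (-(26 / 100) * (h * N))
      ≤ ∏ i, Real.exp (β * (J (D.link i) * edgeSpin σ (D.link i))) := by
  obtain ⟨i₀, hi₀⟩ := hI.nonempty hN
  obtain ⟨hcard, hpin⟩ := hI
  obtain ⟨hL, hR⟩ := hpin σ hσ
  set u : Fin N → ℝ := fun i => edgeSpin σ (D.link i) with hu
  have hu1 : ∀ i, u i = 1 ∨ u i = -1 := fun i => edgeSpin_eq_one_or _ _
  have hconst : ∀ i ∈ I, u i = u i₀ := fun i hi => by
    simp only [hu, D.link_eq, edgeSpin_mk, hL i hi i₀ hi₀, hR i hi i₀ hi₀]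
  rw [← Real.exp_sum, Real.exp_le_exp]
  have h1 : ∀ i, h * (D.sign i * u i₀) - (if i ∈ I then 0 else 2 * h) - h / 100
      ≤ β * (J (D.link i) * u i) := by
    intro i
    have hc := abs_le.mp (D.link_coupling i)
    have h2 : D.sign i * h * u i - h / 100 ≤ β * (J (D.link i) * u i) := by
      rcases hu1 i with h3 | h3 <;> rw [h3] <;> linarith
    refine le_trans ?_ h2
    split_ifs with hi
    · rw [hconst i hi]; linarith
    · rcases hu1 i with h3 | h3 <;> rcases hu1 i₀ with h4 | h4 <;>
        rcases D.sign_eq i with h5 | h5 <;> rw [h3, h4, h5] <;> linarith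
  refine le_trans ?_ (Finset.sum_le_sum fun i _ => h1 i)
  rw [Finset.sum_sub_distrib, Finset.sum_sub_distrib, ← Finset.mul_sum, ← Finset.sum_mul,
    D.sign_sum]
  have h6 : (∑ i, if i ∈ I then (0 : ℝ) else 2 * h) = 2 * h * (N - I.card) := by
    have : ∀ i, (if i ∈ I then (0 : ℝ) else 2 * h) = 2 * h - if i ∈ I then 2 * h else 0 :=
      fun i => by split_ifs <;> ring
    simp only [this]
    rw [Finset.sum_sub_distrib, Finset.sum_ite_mem, Finset.univ_inter]
    simp only [Finset.sum_const, Finset.card_univ, Fintype.card_fin, nsmul_eq_mul]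
    ring
  rw [h6]
  simp only [Finset.sum_const, Finset.card_univ, Fintype.card_fin, nsmul_eq_mul]
  have h7 : (7 : ℝ) * N ≤ 8 * I.card := by exact_mod_cast hcard
  nlinarith

/-- Total weight when weak edges and links are ignored. -/
def total : ℝ := ∑ τ ∈ D.strong.powerset, D.mass τ

theorem mass_le_total (hβ : 0 ≤ β) {τ : Finset G.edgeSet} (hτ : τ ⊆ D.strong) :
    D.mass τ ≤ D.total :=
  Finset.single_le_sum (f := D.mass) (fun τ _ => D.mass_nonneg hβ τ) (Finset.mem_powerset.mpr hτ)

theorem total_pos (hβ : 0 ≤ β) : 0 < D.total := by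
  refine lt_of_lt_of_le ?_ (D.mass_le_total hβ (Finset.empty_subset _))
  refine Finset.sum_pos (fun σ _ => mul_pos ?_ ?_) Finset.univ_nonempty
  · exact Finset.prod_pos fun e _ => by simp [edgeWeight, Real.exp_pos]
  · exact Finset.prod_pos fun e _ => Real.exp_pos _

/-- Lower bound for the weight of an event `A` that carries half of each pinning set. -/
theorem le_sum_boltzmann (hβ : 0 ≤ β) (hh : 0 < h) (hN : 0 < N) (A : Spins V → Prop)
    [DecidablePred A]
    (hA : ∀ τ ⊆ D.strong, ∀ I, D.IsPinned τ I →
      (∑ σ, if A σ then D.weight τ σ else 0) = D.mass τ / 2)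
    {p : ℝ} (hp : ∑ τ ∈ D.strong.powerset, (if ∃ I, D.IsPinned τ I then 0 else D.mass τ)
      ≤ p * D.total) :
    (1 - p) / 2 * Real.exp (-1 - 26 / 100 * (h * N)) * D.total
      ≤ ∑ σ, if A σ then boltzmann G J β σ else 0 := by
  have hsplit : (1 - p) * D.total ≤
      ∑ τ ∈ D.strong.powerset, if ∃ I, D.IsPinned τ I then D.mass τ else 0 := by
    have : D.total = (∑ τ ∈ D.strong.powerset, if ∃ I, D.IsPinned τ I then D.mass τ else 0)
        + ∑ τ ∈ D.strong.powerset, (if ∃ I, D.IsPinned τ I then 0 else D.mass τ) := by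
      rw [total, ← Finset.sum_add_distrib]
      exact Finset.sum_congr rfl fun τ _ => by split_ifs <;> simp
    linarith
  -- Worst-case factor of the weak edges, `exp (-1)`, times that of the links from `le_links`.
  set κ := Real.exp (-1 - 26 / 100 * (h * N)) with hκ
  have hκ' : κ = Real.exp (-1) * Real.exp (-(26 / 100) * (h * N)) := by
    rw [hκ, ← Real.exp_add]; congr 1; ring
  have hκ0 : 0 < κ := Real.exp_pos _
  have hnn : ∀ τ σ, 0 ≤ ∏ e, D.fixedWeight τ ∅ σ e := fun τ σ => Finset.prod_nonneg fun e _ => by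
    unfold fixedWeight
    split_ifs
    · exact edgeWeight_nonneg hβ _ _ _
    · exact (Real.exp_pos _).le
    · exact (Real.exp_pos _).le
  have hcalc : ∑ σ, (if A σ then boltzmann G J β σ else 0)
      = ∑ τ ∈ D.strong.powerset, ∑ σ, if A σ then ∏ e, D.fixedWeight τ ∅ σ e else 0 := by
    rw [Finset.sum_comm]
    refine Finset.sum_congr rfl fun σ _ => ?_
    split_ifs
    · rw [D.boltzmann_eq_sum]
    · simp
  rw [hcalc]
  have hterm : ∀ τ ∈ D.strong.powerset,
      κ / 2 * (if ∃ I, D.IsPinned τ I then D.mass τ else 0)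
        ≤ ∑ σ, if A σ then ∏ e, D.fixedWeight τ ∅ σ e else 0 := by
    intro τ hτ
    rw [Finset.mem_powerset] at hτ
    split_ifs with hI
    · obtain ⟨I, hI⟩ := hI
      have : κ / 2 * D.mass τ = ∑ σ, if A σ then κ * D.weight τ σ else 0 := by
        have h1 := hA τ hτ I hI
        calc κ / 2 * D.mass τ = κ * (D.mass τ / 2) := by ring
          _ = _ := by
            rw [← h1, Finset.mul_sum]
            exact Finset.sum_congr rfl fun σ _ => by split_ifs <;> simp
      rw [this]
      refine Finset.sum_le_sum fun σ _ => ?_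
      split_ifs
      · by_cases hw : D.weight τ σ = 0
        · rw [hw, mul_zero]; exact hnn τ σ
        have hw0 := D.weight_nonneg hβ τ σ
        have h2 := D.le_weak hβ σ
        have h3 := D.le_links hh hI hN (D.edgeSpin_of_weight_ne_zero hτ hw)
        rw [D.prod_fixedWeight (by simp)]
        simp only [Finset.notMem_empty, if_false]
        rw [hκ', mul_comm, mul_assoc (D.weight τ σ)]
        refine mul_le_mul_of_nonneg_left ?_ hw0
        exact mul_le_mul h2 h3 (Real.exp_pos _).le ((Real.exp_pos _).le.trans h2)
      · exact le_rfl
    · rw [mul_zero]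
      refine Finset.sum_nonneg fun σ _ => ?_
      split_ifs
      · exact hnn τ σ
      · exact le_rfl
  refine le_trans ?_ (Finset.sum_le_sum hterm)
  rw [← Finset.mul_sum]
  nlinarith

/-- The bond configuration determines the alignment as soon as the open strong edges pin the link
ends and one of the pinned links is open. -/
theorem links_closed (hβ : 0 ≤ β) (hh : 0 < h) (hN : 0 < N) {η : G.edgeSet → Bool}
    {I : Finset (Fin N)} (hI : D.IsPinned (D.openStrong η) I) {σ σ' : Spins V}
    (hσ : Consistent G J σ η) (hσ' : Consistent G J σ' η) (hA : D.Aligned σ) (hA' : ¬ D.Aligned σ')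
    {i : Fin N} (hi : i ∈ I) : η (D.link i) = false := by
  by_contra hcon
  rw [Bool.not_eq_false] at hcon
  have hspin : ∀ σ : Spins V, Consistent G J σ η → ∀ e ∈ D.openStrong η, edgeSpin σ e = 1 := by
    intro σ hσ e he
    simp only [openStrong, Finset.mem_filter] at he
    exact edgeSpin_eq_one_of_pos (D.strong_pos e he.1) (hσ e he.2)
  have hJ : J (D.link i) ≠ 0 := by
    intro h0
    have := (D.link_abs_bounds hβ hh i).1
    rw [h0, abs_zero, mul_zero] at this
    linarith
  rw [aligned_iff hI hN (hspin σ hσ) hi] at hA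
  rw [aligned_iff hI hN (hspin σ' hσ') hi] at hA'
  have h1 := coupling_mul_spin (hσ _ hcon)
  have h2 := coupling_mul_spin (hσ' _ hcon)
  exact hA' ((mul_left_cancel₀ hJ (h2.trans h1.symm)).trans hA)

/-- Upper bound for the weight of the bond configurations that do not determine the alignment. -/
theorem undetermined_le (hβ : 0 ≤ β) (hh : 0 < h) (hN : 0 < N)
    {p : ℝ} (hp : ∑ τ ∈ D.strong.powerset, (if ∃ I, D.IsPinned τ I then 0 else D.mass τ)
      ≤ p * D.total) :
    (∑ σ, ∑ η, if D.Aligned σ ∧ ∃ σ', ¬ D.Aligned σ' ∧ Consistent G J σ' η then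
        jointWeight G J β σ η else 0) ≤
      (p * Real.exp (1 + 101 / 100 * (h * N)) + Real.exp (1 - 74 / 100 * (h * N))) * D.total := by
  -- A chosen set of links pinned by `τ`, empty if `τ` does not pin. By `links_closed` all of these
  -- links are closed whenever the bonds leave the alignment undetermined.
  set K : Finset G.edgeSet → Finset (Fin N) := fun τ =>
    if hI : ∃ I, D.IsPinned τ I then hI.choose else ∅ with hK
  have hstep : ∀ σ, (∑ η, if D.Aligned σ ∧ ∃ σ', ¬ D.Aligned σ' ∧ Consistent G J σ' η then
        jointWeight G J β σ η else 0) ≤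
      ∑ τ ∈ D.strong.powerset, ∏ e, D.fixedWeight τ ((K τ).image D.link) σ e := by
    intro σ
    rw [D.sum_over_openStrong]
    refine Finset.sum_le_sum fun τ hτ => ?_
    rw [← D.sum_jointWeight_fixed (Finset.mem_powerset.mp hτ)]
    · refine Finset.sum_le_sum fun η _ => ?_
      have hw := jointWeight_nonneg (G := G) (J := J) hβ σ η
      by_cases hη : D.openStrong η = τ
      swap
      · simp [hη]
      by_cases h0 : jointWeight G J β σ η = 0
      · simp [h0]
      have hσ : Consistent G J σ η := by
        by_contra hc
        rw [jointWeight_eq, if_neg hc] at h0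
        exact h0 rfl
      rw [if_pos hη]
      by_cases hdet : D.Aligned σ ∧ ∃ σ', ¬ D.Aligned σ' ∧ Consistent G J σ' η
      · rw [if_pos hdet, if_pos]
        refine ⟨hη, ?_⟩
        intro e he
        obtain ⟨i, hi, rfl⟩ := Finset.mem_image.mp he
        obtain ⟨hA, σ', hA', hσ'⟩ := hdet
        by_cases hI : ∃ I, D.IsPinned τ I
        · have hKτ : K τ = hI.choose := by simp only [hK, dif_pos hI]
          rw [hKτ] at hi
          exact D.links_closed hβ hh hN (hη ▸ hI.choose_spec) hσ hσ' hA hA' hi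
        · have hKτ : K τ = ∅ := by simp only [hK, dif_neg hI]
          rw [hKτ] at hi
          simp at hi
      · rw [if_neg hdet]
        split_ifs
        · exact hw
        · exact le_rfl
    · intro e he
      obtain ⟨i, _, rfl⟩ := Finset.mem_image.mp he
      exact D.link_notMem_strong i
  refine (Finset.sum_le_sum fun σ _ => hstep σ).trans ?_
  rw [Finset.sum_comm]
  have hM : 0 ≤ h * N := by positivity
  -- With at least `7 N / 8` pinned links closed, the exponent is at most `1.01 M - 1.75 M = -0.74
  -- M`, where `M = h N`. Without pinning only the crude bound `1.01 M` is left, to be compensated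
  -- by the small `p`. The additional `1` comes from the weak edges.
  have hterm : ∀ τ ∈ D.strong.powerset,
      ∑ σ, ∏ e, D.fixedWeight τ ((K τ).image D.link) σ e ≤
        Real.exp (1 + 101 / 100 * (h * N)) * (if ∃ I, D.IsPinned τ I then 0 else D.mass τ)
        + Real.exp (1 - 74 / 100 * (h * N)) * D.mass τ := by
    intro τ _
    have hm := D.mass_nonneg hβ τ
    have hbound : ∑ σ, ∏ e, D.fixedWeight τ ((K τ).image D.link) σ e ≤
        Real.exp (1 + (101 / 100 * (h * N) - 2 * h * (K τ).card)) * D.mass τ := by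
      rw [mass, Finset.mul_sum]
      refine Finset.sum_le_sum fun σ _ => ?_
      rw [D.prod_fixedWeight (fun e he => by
        obtain ⟨i, _, rfl⟩ := Finset.mem_image.mp he
        exact D.mem_links.mpr ⟨i, rfl⟩), Real.exp_add, mul_comm _ (D.weight τ σ), mul_assoc]
      refine mul_le_mul_of_nonneg_left ?_ (D.weight_nonneg hβ τ σ)
      refine mul_le_mul (D.weak_le hβ σ) (D.links_le hβ hh (K τ) σ) ?_ (Real.exp_pos _).le
      exact Finset.prod_nonneg fun i _ => by split_ifs <;> exact (Real.exp_pos _).le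
    refine hbound.trans ?_
    by_cases hI : ∃ I, D.IsPinned τ I
    · have hKτ : K τ = hI.choose := by simp only [hK, dif_pos hI]
      rw [if_pos hI, mul_zero, zero_add]
      refine mul_le_mul_of_nonneg_right ?_ hm
      rw [Real.exp_le_exp]
      have h1 : (7 : ℝ) * N ≤ 8 * (K τ).card := by
        rw [hKτ]; exact_mod_cast hI.choose_spec.1
      nlinarith
    · have hKτ : K τ = ∅ := by simp only [hK, dif_neg hI]
      rw [if_neg hI, hKτ]
      have := mul_nonneg (Real.exp_pos (1 - 74 / 100 * (h * N))).le hm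
      simp only [Finset.card_empty, Nat.cast_zero, mul_zero, sub_zero]
      linarith
  refine (Finset.sum_le_sum hterm).trans ?_
  rw [Finset.sum_add_distrib, ← Finset.mul_sum, ← Finset.mul_sum, ← total]
  have := mul_le_mul_of_nonneg_left hp (Real.exp_pos (1 + 101 / 100 * (h * N))).le
  linarith

/-- A frustrated double block slows the Swendsen–Wang chain down. -/
theorem slow (hβ : 0 ≤ β) (hh : 0 < h) (hN : 0 < N) (hr : 0 ≤ r)
    (F : Finset (Finset G.edgeSet)) (hF : ∀ W ∈ F, W ⊆ D.strong)
    (hpin : ∀ τ ⊆ D.strong, (∀ W ∈ F, ∃ e ∈ W, e ∈ τ) → ∃ I, D.IsPinned τ I)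
    {p : ℝ} (hp : ∑ W ∈ F, ((1 + r)⁻¹) ^ W.card ≤ p) (hp2 : p ≤ 1 / 2)
    (hpM : p ≤ Real.exp (-3 * (h * N))) (hη : 16 * Real.exp (2 - 4 / 10 * (h * N)) < 1) :
    1 - 16 * Real.exp (2 - 4 / 10 * (h * N)) ≤ secondSpectralRadius (swMatrix G J β) ∧
      (ENNReal.ofReal (-Real.log (1 - 16 * Real.exp (2 - 4 / 10 * (h * N)))))⁻¹
        ≤ expTime (swMatrix G J β) (gibbs G J β) := by
  have hM : 0 ≤ h * N := by positivity
  set M := h * N with hMdef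
  have hbad : ∑ τ ∈ D.strong.powerset, (if ∃ I, D.IsPinned τ I then 0 else D.mass τ)
      ≤ p * D.total := by
    refine (sum_bad_le hr (D.mass_nonneg hβ) (fun τ hτ e he heτ => D.mass_insert hβ hτ he heτ) F hF
      (fun τ => ∃ I, D.IsPinned τ I) hpin).trans ?_
    exact mul_le_mul_of_nonneg_right hp (D.total_pos hβ).le
  have hlow := D.le_sum_boltzmann hβ hh hN D.Aligned
    (fun τ hτ I hI => (sum_aligned hτ hI hN).1) hbad
  have hlow' := D.le_sum_boltzmann hβ hh hN (fun σ => ¬ D.Aligned σ)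
    (fun τ hτ I hI => by simpa only [ite_not] using (sum_aligned hτ hI hN).2) hbad
  simp only [ite_not] at hlow'
  have hup := (flow_swMatrix_le (G := G) (J := J) hβ D.Aligned).trans
    (D.undetermined_le hβ hh hN hbad)
  rw [← hMdef] at hlow hlow' hup
  set Z := ∑ ω, boltzmann G J β ω with hZ
  have hZ0 : 0 < Z := sum_boltzmann_pos
  set a := ∑ σ, if D.Aligned σ then boltzmann G J β σ else 0 with ha
  set b := ∑ σ, if D.Aligned σ then 0 else boltzmann G J β σ with hb
  have hab : a + b = Z := by
    rw [ha, hb, ← Finset.sum_add_distrib]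
    exact Finset.sum_congr rfl fun σ _ => by split_ifs <;> simp
  have hT := D.total_pos hβ
  set κ := Real.exp (-1 - 26 / 100 * M) with hκ
  have hκ0 : 0 < κ := Real.exp_pos _
  have hc : κ / 4 * D.total ≤ (1 - p) / 2 * κ * D.total := by
    have : κ / 4 ≤ (1 - p) / 2 * κ := by nlinarith
    exact mul_le_mul_of_nonneg_right this hT.le
  have ha0 : κ / 4 * D.total ≤ a := hc.trans hlow
  have hb0 : κ / 4 * D.total ≤ b := hc.trans hlow'
  have hm0 : 0 < κ / 4 * D.total := by positivity
  have hga : (∑ σ, if D.Aligned σ then gibbs G J β σ else 0) = a / Z := by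
    rw [ha, Finset.sum_div]
    exact Finset.sum_congr rfl fun σ _ => by rw [gibbs_eq]; split_ifs <;> simp [hZ]
  have hgb : (∑ σ, if D.Aligned σ then 0 else gibbs G J β σ) = b / Z := by
    rw [hb, Finset.sum_div]
    exact Finset.sum_congr rfl fun σ _ => by rw [gibbs_eq]; split_ifs <;> simp [hZ]
  set f := flow (swMatrix G J β) (gibbs G J β) D.Aligned with hf
  -- Both terms are at most `exp (1 - 0.66 M) = ε κ` with `ε = exp (2 - 0.4 M)`; for the first one,
  -- `p ≤ exp (-3 M)` is more than enough.
  have hpe : p * Real.exp (1 + 101 / 100 * M) + Real.exp (1 - 74 / 100 * M)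
      ≤ 2 * Real.exp (2 - 4 / 10 * M) * κ := by
    have h1 : Real.exp (2 - 4 / 10 * M) * κ = Real.exp (1 - 66 / 100 * M) := by
      rw [hκ, ← Real.exp_add]; congr 1; ring
    have h2 : p * Real.exp (1 + 101 / 100 * M) ≤ Real.exp (1 - 66 / 100 * M) := by
      refine (mul_le_mul_of_nonneg_right hpM (Real.exp_pos _).le).trans ?_
      rw [← Real.exp_add, Real.exp_le_exp]; linarith
    have h3 : Real.exp (1 - 74 / 100 * M) ≤ Real.exp (1 - 66 / 100 * M) := by
      rw [Real.exp_le_exp]; linarith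
    rw [mul_assoc, h1]; linarith
  set ε := Real.exp (2 - 4 / 10 * M) with hε
  have hε0 : 0 < ε := Real.exp_pos _
  have hfz : f * Z ≤ 8 * ε * (κ / 4 * D.total) := by
    refine hup.trans ((mul_le_mul_of_nonneg_right hpe hT.le).trans (le_of_eq (by ring)))
  refine bottleneck (isReversibleChain_swMatrix hβ) D.Aligned hη ?_ ?_ ?_
  · rw [hga]; exact div_pos (hm0.trans_le ha0) hZ0
  · rw [hgb]; exact div_pos (hm0.trans_le hb0) hZ0
  · rw [hga, hgb]
    -- As `a` and `b` both exceed `κ / 4 * D.total` and sum to `Z`. This doubles the factor `8` of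
    -- `hfz` to `16`.
    have h1 : (κ / 4 * D.total) * Z ≤ 2 * (a * b) := by
      rw [← hab]; nlinarith
    have h2 : f * Z * Z ≤ 16 * ε * (a * b) := by
      have := mul_le_mul_of_nonneg_right hfz hZ0.le
      nlinarith
    rw [div_mul_div_comm, ← mul_div_assoc, le_div_iff₀ (by positivity)]
    linarith

end Gadget

end GadgetBounds

/-! ### Union bounds over closed edge sets, recorded combinatorially without a measure. -/

section Covers

variable {E : Type*}

/-- The event `Bad` is covered by events that all edges of `W` are closed, with `W` inside `S` and
`∑ q^|W| ≤ p`. -/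
def Cover (q : ℝ) (S : E → Prop) (Bad : Set E → Prop) (p : ℝ) : Prop :=
  ∃ F : Finset (Finset E), (∀ W ∈ F, ∀ e ∈ W, S e) ∧ ∑ W ∈ F, q ^ W.card ≤ p ∧
    ∀ η, Bad η → ∃ W ∈ F, ∀ e ∈ W, e ∉ η

variable {q : ℝ} {S S' : E → Prop} {Bad Bad' : Set E → Prop} {p p' : ℝ}

theorem Cover.mono (h : Cover q S Bad p) (hS : ∀ e, S e → S' e) (hB : ∀ η, Bad' η → Bad η)
    (hp : p ≤ p') : Cover q S' Bad' p' := by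
  obtain ⟨F, h1, h2, h3⟩ := h
  exact ⟨F, fun W hW e he => hS e (h1 W hW e he), h2.trans hp, fun η hη => h3 η (hB η hη)⟩

theorem Cover.of_false (hB : ∀ η, ¬ Bad η) : Cover q S Bad 0 :=
  ⟨∅, by simp, by simp, fun η hη => absurd hη (hB η)⟩

theorem Cover.closed (W : Finset E) (hW : ∀ e ∈ W, S e) :
    Cover q S (fun η => ∀ e ∈ W, e ∉ η) (q ^ W.card) :=
  ⟨{W}, by simpa using hW, by simp, fun η hη => ⟨W, by simp, hη⟩⟩

theorem Cover.or (hq : 0 ≤ q) (h : Cover q S Bad p) (h' : Cover q S Bad' p') :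
    Cover q S (fun η => Bad η ∨ Bad' η) (p + p') := by
  obtain ⟨F, h1, h2, h3⟩ := h
  obtain ⟨F', h1', h2', h3'⟩ := h'
  refine ⟨F ∪ F', ?_, ?_, ?_⟩
  · intro W hW
    rcases Finset.mem_union.mp hW with hW | hW
    · exact h1 W hW
    · exact h1' W hW
  · have := Finset.sum_union_inter (s₁ := F) (s₂ := F') (f := fun W => q ^ W.card)
    have h4 : 0 ≤ ∑ W ∈ F ∩ F', q ^ W.card := Finset.sum_nonneg fun W _ => pow_nonneg hq _
    linarith
  · rintro η (hη | hη)
    · obtain ⟨W, hW, h⟩ := h3 η hη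
      exact ⟨W, Finset.mem_union_left _ hW, h⟩
    · obtain ⟨W, hW, h⟩ := h3' η hη
      exact ⟨W, Finset.mem_union_right _ hW, h⟩

theorem Cover.exists {ι : Type*} (hq : 0 ≤ q) (T : Finset ι) {Bad : ι → Set E → Prop} {p : ι → ℝ}
    (h : ∀ i ∈ T, Cover q S (Bad i) (p i)) :
    Cover q S (fun η => ∃ i ∈ T, Bad i η) (∑ i ∈ T, p i) := by
  induction T using Finset.induction_on with
  | empty => exact Cover.of_false (by simp)
  | insert i T hi ih =>
    rw [Finset.sum_insert hi]
    refine (Cover.or hq (h i (Finset.mem_insert_self i T))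
      (ih fun j hj => h j (Finset.mem_insert_of_mem hj))).mono (fun e he => he) ?_ le_rfl
    rintro η ⟨j, hj, hB⟩
    rcases Finset.mem_insert.mp hj with rfl | hj
    · exact Or.inl hB
    · exact Or.inr ⟨j, hj, hB⟩

/-- Covers of two events on disjoint sets of edges multiply. -/
theorem Cover.and (hq : 0 ≤ q) (hp : 0 ≤ p) (hSS : ∀ e, S e → ¬ S' e) (h : Cover q S Bad p)
    (h' : Cover q S' Bad' p') :
    Cover q (fun e => S e ∨ S' e) (fun η => Bad η ∧ Bad' η) (p * p') := by
  obtain ⟨F, h1, h2, h3⟩ := h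
  obtain ⟨F', h1', h2', h3'⟩ := h'
  refine ⟨(F ×ˢ F').image fun w => w.1 ∪ w.2, ?_, ?_, ?_⟩
  · intro W hW e he
    obtain ⟨w, hw, rfl⟩ := Finset.mem_image.mp hW
    rw [Finset.mem_product] at hw
    rcases Finset.mem_union.mp he with he | he
    · exact Or.inl (h1 _ hw.1 e he)
    · exact Or.inr (h1' _ hw.2 e he)
  · calc ∑ W ∈ (F ×ˢ F').image fun w => w.1 ∪ w.2, q ^ W.card
        ≤ ∑ w ∈ F ×ˢ F', q ^ (w.1 ∪ w.2).card :=
          Finset.sum_image_le_of_nonneg (f := fun W : Finset E => q ^ W.card)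
            fun w _ => pow_nonneg hq _
      _ = ∑ w ∈ F ×ˢ F', q ^ w.1.card * q ^ w.2.card := by
          refine Finset.sum_congr rfl fun w hw => ?_
          rw [Finset.mem_product] at hw
          rw [Finset.card_union_of_disjoint, pow_add]
          rw [Finset.disjoint_left]
          exact fun e he he' => hSS e (h1 _ hw.1 e he) (h1' _ hw.2 e he')
      _ = (∑ W ∈ F, q ^ W.card) * ∑ W ∈ F', q ^ W.card := by
          rw [Finset.sum_mul_sum, Finset.sum_product]
      _ ≤ p * p' := mul_le_mul h2 h2' (Finset.sum_nonneg fun W _ => pow_nonneg hq _) hp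
  · rintro η ⟨hB, hB'⟩
    obtain ⟨W, hW, h⟩ := h3 η hB
    obtain ⟨W', hW', h'⟩ := h3' η hB'
    refine ⟨W ∪ W', Finset.mem_image.mpr ⟨(W, W'), Finset.mem_product.mpr ⟨hW, hW'⟩, rfl⟩, ?_⟩
    intro e he
    rcases Finset.mem_union.mp he with he | he
    · exact h e he
    · exact h' e he

end Covers

/-! ### Deterministic percolation geometry: assembling good squares into a larger good square. -/

section Percolation

/-- Edges of the quadrant: `((x, y), false)` joins `(x, y)` to `(x + 1, y)` and `((x, y), true)`
joins `(x, y)` to `(x, y + 1)`. -/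
abbrev GridEdge : Type := (ℕ × ℕ) × Bool

/-- The neighbour of `a` in direction `d`. -/
def step (a : ℕ × ℕ) (d : Bool) : ℕ × ℕ := if d then (a.1, a.2 + 1) else (a.1 + 1, a.2)

/-- Every spin configuration that is constant along the edges in `η` is constant on `C`. -/
def Linked (η : Set GridEdge) (C : Finset (ℕ × ℕ)) : Prop :=
  ∀ σ : ℕ × ℕ → ℤˣ, (∀ e ∈ η, σ e.1 = σ (step e.1 e.2)) → ∀ a ∈ C, ∀ b ∈ C, σ a = σ b

/-- The square of side `n` with index `u`. -/
def InBlock (n : ℕ) (u a : ℕ × ℕ) : Prop := a.1 / n = u.1 ∧ a.2 / n = u.2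

/-- The edge lies inside the square of side `n` with index `u`. -/
def EdgeIn (n : ℕ) (u : ℕ × ℕ) (e : GridEdge) : Prop := InBlock n u e.1 ∧ InBlock n u (step e.1 e.2)

/-- The open edges link a set which meets every row and every column of the square in at least `R`
points. -/
def GoodBlock (n R : ℕ) (u : ℕ × ℕ) (η : Set GridEdge) : Prop :=
  ∃ C : Finset (ℕ × ℕ), (∀ a ∈ C, InBlock n u a) ∧
    (∀ j, j / n = u.2 → R ≤ (C.filter fun a => a.2 = j).card) ∧
    (∀ i, i / n = u.1 → R ≤ (C.filter fun a => a.1 = i).card) ∧ Linked η C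

/-- The `t`-th edge joining the square `v` of side `n` to the next one in direction `d`. -/
def face (n : ℕ) (v : ℕ × ℕ) (d : Bool) (t : ℕ) : GridEdge :=
  if d then ((v.1 * n + t, v.2 * n + (n - 1)), true) else ((v.1 * n + (n - 1), v.2 * n + t), false)

theorem inBlock_mul {n m : ℕ} {u a : ℕ × ℕ} :
    InBlock (m * n) u a ↔ InBlock m u (a.1 / n, a.2 / n) := by
  simp only [InBlock, Nat.div_div_eq_div_mul, mul_comm m n]

theorem mul_add_div_self {n v t : ℕ} (ht : t < n) : (v * n + t) / n = v := by
  rw [mul_comm, Nat.mul_add_div (by omega), Nat.div_eq_of_lt ht, add_zero]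

theorem face_fst {n : ℕ} (hn : 0 < n) (v : ℕ × ℕ) (d : Bool) {t : ℕ} (ht : t < n) :
    InBlock n v (face n v d t).1 := by
  cases d <;> simp [face, InBlock, mul_add_div_self ht, mul_add_div_self (Nat.sub_lt hn one_pos)]

theorem face_snd {n : ℕ} (hn : 0 < n) (v : ℕ × ℕ) (d : Bool) {t : ℕ} (ht : t < n) :
    InBlock n (step v d) (step (face n v d t).1 (face n v d t).2) := by
  have h1 : ∀ w, w * n + (n - 1) + 1 = (w + 1) * n := fun w => by
    rw [add_mul, one_mul]; omega
  cases d <;> simp [face, InBlock, step, mul_add_div_self ht, h1, Nat.mul_div_cancel _ hn]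

theorem face_injective {n : ℕ} (v : ℕ × ℕ) (d : Bool) : Function.Injective (face n v d) := by
  intro s t h
  cases d <;> simpa [face] using h

/-- A square grid with one point removed is connected. -/
theorem grid_constant {α : Type*} (g : ℕ × ℕ → α) {m : ℕ} (hm : 2 ≤ m) (u v₀ : ℕ × ℕ)
    (hg : ∀ v d, InBlock m u v → InBlock m u (step v d) → v ≠ v₀ → step v d ≠ v₀ →
      g v = g (step v d)) {v w : ℕ × ℕ} (hv : InBlock m u v) (hw : InBlock m u w)
    (hv0 : v ≠ v₀) (hw0 : w ≠ v₀) : g v = g w := by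
  have hdiv : ∀ x w, x / m = w ↔ w * m ≤ x ∧ x < w * m + m := by
    intro x w
    rw [Nat.div_eq_iff (by omega)]
    constructor <;> intro h <;> constructor <;> omega
  simp only [InBlock, hdiv] at *
  have hrow : ∀ y, u.2 * m ≤ y → y < u.2 * m + m → y ≠ v₀.2 → ∀ t, t < m →
      g (u.1 * m + t, y) = g (u.1 * m, y) := by
    intro y h1 h2 h3 t
    induction t with
    | zero => intro _; rfl
    | succ t ih =>
      intro ht
      rw [← ih (by omega)]
      have := hg (u.1 * m + t, y) false (by simp; omega) (by simp [step]; omega)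
        (fun h => h3 (by rw [← h])) (fun h => h3 (by rw [← h]; simp [step]))
      rw [this]; simp [step, add_assoc]
  have hcol : ∀ x, u.1 * m ≤ x → x < u.1 * m + m → x ≠ v₀.1 → ∀ t, t < m →
      g (x, u.2 * m + t) = g (x, u.2 * m) := by
    intro x h1 h2 h3 t
    induction t with
    | zero => intro _; rfl
    | succ t ih =>
      intro ht
      rw [← ih (by omega)]
      have := hg (x, u.2 * m + t) true (by simp; omega) (by simp [step]; omega)
        (fun h => h3 (by rw [← h])) (fun h => h3 (by rw [← h]; simp [step]))
      rw [this]; simp [step, add_assoc]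
  have hrow' : ∀ y, u.2 * m ≤ y → y < u.2 * m + m → y ≠ v₀.2 → ∀ x x', u.1 * m ≤ x →
      x < u.1 * m + m → u.1 * m ≤ x' → x' < u.1 * m + m → g (x, y) = g (x', y) := by
    intro y h1 h2 h3 x x' a b c d
    have e1 := hrow y h1 h2 h3 (x - u.1 * m) (by omega)
    have e2 := hrow y h1 h2 h3 (x' - u.1 * m) (by omega)
    rw [Nat.add_sub_cancel' a] at e1
    rw [Nat.add_sub_cancel' c] at e2
    rw [e1, e2]
  have hcol' : ∀ x, u.1 * m ≤ x → x < u.1 * m + m → x ≠ v₀.1 → ∀ y y', u.2 * m ≤ y →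
      y < u.2 * m + m → u.2 * m ≤ y' → y' < u.2 * m + m → g (x, y) = g (x, y') := by
    intro x h1 h2 h3 y y' a b c d
    have e1 := hcol x h1 h2 h3 (y - u.2 * m) (by omega)
    have e2 := hcol x h1 h2 h3 (y' - u.2 * m) (by omega)
    rw [Nat.add_sub_cancel' a] at e1
    rw [Nat.add_sub_cancel' c] at e2
    rw [e1, e2]
  have hpick : ∀ a b : ℕ, ∃ x, a * m ≤ x ∧ x < a * m + m ∧ x ≠ b := by
    intro a b
    by_cases h : a * m = b
    · exact ⟨a * m + 1, by omega, by omega, by omega⟩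
    · exact ⟨a * m, le_rfl, by omega, h⟩
  obtain ⟨x₀, hx1, hx2, hx3⟩ := hpick u.1 v₀.1
  obtain ⟨y₀, hy1, hy2, hy3⟩ := hpick u.2 v₀.2
  -- Every point other than `v₀` lies on a row or a column that avoids `v₀`, and from there reaches
  -- the fixed row `y₀` and column `x₀`, which avoid it as well.
  have key : ∀ z : ℕ × ℕ, ((u.1 * m ≤ z.1 ∧ z.1 < u.1 * m + m) ∧ u.2 * m ≤ z.2 ∧
      z.2 < u.2 * m + m) → z ≠ v₀ → g z = g (x₀, y₀) := by
    rintro ⟨x, y⟩ ⟨⟨a, b⟩, c, d⟩ hz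
    by_cases hy : y = v₀.2
    · have hx : x ≠ v₀.1 := fun hx => hz (Prod.ext hx hy)
      exact (hcol' x a b hx y y₀ c d hy1 hy2).trans (hrow' y₀ hy1 hy2 hy3 x x₀ a b hx1 hx2)
    · exact (hrow' y c d hy x x₀ a b hx1 hx2).trans (hcol' x₀ hx1 hx2 hx3 y y₀ c d hy1 hy2)
  rw [key v hv hv0, key w hw hw0]

/-- Two subsets of `range n` with at least `R` elements each, `4 R ≥ 3 n`, share at least half of
the points. -/
theorem card_inter_range {n R : ℕ} (hR : 3 * n ≤ 4 * R) {A B : Finset ℕ} (hA : A ⊆ Finset.range n)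
    (hB : B ⊆ Finset.range n) (hAR : R ≤ A.card) (hBR : R ≤ B.card) : n ≤ 2 * (A ∩ B).card := by
  have h1 := Finset.card_union_add_card_inter A B
  have h2 := Finset.card_le_card (Finset.union_subset hA hB)
  rw [Finset.card_range] at h2
  omega

/-- Number of points of a linked set on the facing side of a square. -/
theorem le_card_face_fst {n R : ℕ} (hn : 0 < n) {v : ℕ × ℕ} {C : Finset (ℕ × ℕ)}
    (hC : ∀ a ∈ C, InBlock n v a)
    (hrow : ∀ j, j / n = v.2 → R ≤ (C.filter fun a => a.2 = j).card)
    (hcol : ∀ i, i / n = v.1 → R ≤ (C.filter fun a => a.1 = i).card) (d : Bool) :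
    R ≤ ((Finset.range n).filter fun t => (face n v d t).1 ∈ C).card := by
  have hmod : ∀ a w : ℕ, a / n = w → w * n + a % n = a := fun a w h => by
    rw [← h]; exact Nat.div_add_mod' a n
  cases d with
  | false =>
    refine (hcol (v.1 * n + (n - 1)) (mul_add_div_self (Nat.sub_lt hn one_pos))).trans ?_
    refine Finset.card_le_card_of_injOn (fun a => a.2 % n) ?_ ?_
    · intro a ha
      simp only [Finset.coe_filter, Set.mem_ofPred_eq, Finset.mem_range] at ha ⊢
      refine ⟨Nat.mod_lt _ hn, ?_⟩
      have : (face n v false (a.2 % n)).1 = a := by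
        simp only [face, Bool.false_eq_true, if_false]
        rw [hmod _ _ (hC a ha.1).2, ← ha.2]
      rw [this]; exact ha.1
    · intro a ha b hb hab
      simp only [Finset.coe_filter, Set.mem_ofPred_eq] at ha hb
      simp only at hab
      ext
      · rw [ha.2, hb.2]
      · rw [← hmod _ _ (hC a ha.1).2, ← hmod _ _ (hC b hb.1).2, hab]
  | true =>
    refine (hrow (v.2 * n + (n - 1)) (mul_add_div_self (Nat.sub_lt hn one_pos))).trans ?_
    refine Finset.card_le_card_of_injOn (fun a => a.1 % n) ?_ ?_
    · intro a ha
      simp only [Finset.coe_filter, Set.mem_ofPred_eq, Finset.mem_range] at ha ⊢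
      refine ⟨Nat.mod_lt _ hn, ?_⟩
      have : (face n v true (a.1 % n)).1 = a := by
        simp only [face, if_true]
        rw [hmod _ _ (hC a ha.1).1, ← ha.2]
      rw [this]; exact ha.1
    · intro a ha b hb hab
      simp only [Finset.coe_filter, Set.mem_ofPred_eq] at ha hb
      simp only at hab
      ext
      · rw [← hmod _ _ (hC a ha.1).1, ← hmod _ _ (hC b hb.1).1, hab]
      · rw [ha.2, hb.2]

/-- Counterpart of `le_card_face_fst`: the far ends of the face edges form the first column or row
of the next square. -/
theorem le_card_face_snd {n R : ℕ} (hn : 0 < n) {v : ℕ × ℕ} {d : Bool} {C : Finset (ℕ × ℕ)}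
    (hC : ∀ a ∈ C, InBlock n (step v d) a)
    (hrow : ∀ j, j / n = (step v d).2 → R ≤ (C.filter fun a => a.2 = j).card)
    (hcol : ∀ i, i / n = (step v d).1 → R ≤ (C.filter fun a => a.1 = i).card) :
    R ≤ ((Finset.range n).filter
      fun t => step (face n v d t).1 (face n v d t).2 ∈ C).card := by
  have hmod : ∀ a w : ℕ, a / n = w → w * n + a % n = a := fun a w h => by
    rw [← h]; exact Nat.div_add_mod' a n
  have h1 : ∀ w, w * n + (n - 1) + 1 = (w + 1) * n := fun w => by
    rw [add_mul, one_mul]; omega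
  cases d with
  | false =>
    simp only [step, Bool.false_eq_true, if_false] at hC hcol
    refine (hcol ((v.1 + 1) * n) (Nat.mul_div_cancel _ hn)).trans ?_
    refine Finset.card_le_card_of_injOn (fun a => a.2 % n) ?_ ?_
    · intro a ha
      simp only [Finset.coe_filter, Set.mem_ofPred_eq, Finset.mem_range] at ha ⊢
      refine ⟨Nat.mod_lt _ hn, ?_⟩
      have : step (face n v false (a.2 % n)).1 (face n v false (a.2 % n)).2 = a := by
        simp only [face, step, Bool.false_eq_true, if_false]
        rw [hmod _ _ (hC a ha.1).2, h1, ← ha.2]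
      rw [this]; exact ha.1
    · intro a ha b hb hab
      simp only [Finset.coe_filter, Set.mem_ofPred_eq] at ha hb
      simp only at hab
      ext
      · rw [ha.2, hb.2]
      · rw [← hmod _ _ (hC a ha.1).2, ← hmod _ _ (hC b hb.1).2, hab]
  | true =>
    simp only [step, if_true] at hC hrow
    refine (hrow ((v.2 + 1) * n) (Nat.mul_div_cancel _ hn)).trans ?_
    refine Finset.card_le_card_of_injOn (fun a => a.1 % n) ?_ ?_
    · intro a ha
      simp only [Finset.coe_filter, Set.mem_ofPred_eq, Finset.mem_range] at ha ⊢
      refine ⟨Nat.mod_lt _ hn, ?_⟩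
      have : step (face n v true (a.1 % n)).1 (face n v true (a.1 % n)).2 = a := by
        simp only [face, step, if_true]
        rw [hmod _ _ (hC a ha.1).1, h1, ← ha.2]
      rw [this]; exact ha.1
    · intro a ha b hb hab
      simp only [Finset.coe_filter, Set.mem_ofPred_eq] at ha hb
      simp only at hab
      ext
      · rw [← hmod _ _ (hC a ha.1).1, ← hmod _ _ (hC b hb.1).1, hab]
      · rw [ha.2, hb.2]

/-- A line of `m` squares, at least `m - 1` of which meet a given line in `R` points. -/
theorem le_card_line {m R w : ℕ} {S : ℕ → Finset (ℕ × ℕ)} {C : Finset (ℕ × ℕ)} (x₀ : ℕ)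
    (hS : ∀ x ∈ (Finset.Ico (w * m) (w * m + m)).erase x₀, S x ⊆ C ∧ R ≤ (S x).card)
    (hdisj : ∀ x y, x ≠ y → Disjoint (S x) (S y)) : (m - 1) * R ≤ C.card := by
  calc (m - 1) * R ≤ ((Finset.Ico (w * m) (w * m + m)).erase x₀).card * R := by
        refine Nat.mul_le_mul_right _ ?_
        have := Finset.pred_card_le_card_erase (s := Finset.Ico (w * m) (w * m + m)) (a := x₀)
        simpa using this
    _ ≤ ∑ x ∈ (Finset.Ico (w * m) (w * m + m)).erase x₀, (S x).card := by
        rw [← smul_eq_mul]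
        exact Finset.card_nsmul_le_sum _ _ _ fun x hx => (hS x hx).2
    _ = (((Finset.Ico (w * m) (w * m + m)).erase x₀).biUnion S).card :=
        (Finset.card_biUnion fun x _ y _ hxy => hdisj x y hxy).symm
    _ ≤ C.card := Finset.card_le_card (Finset.biUnion_subset.mpr fun x hx => (hS x hx).1)

/-- The renormalization step: a square of `m × m` squares is good if at most one of them is bad and
no face has half of its edges closed. -/
theorem goodBlock_mul {n R m : ℕ} (hn : 0 < n) (hR : 3 * n ≤ 4 * R) (hm : 2 ≤ m) (u : ℕ × ℕ)
    (η : Set GridEdge) (v₀ : ℕ × ℕ)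
    (hgood : ∀ v, InBlock m u v → v ≠ v₀ → GoodBlock n R v η)
    (hface : ∀ v d, InBlock m u v → InBlock m u (step v d) → ∀ T ⊆ Finset.range n,
      n ≤ 2 * T.card → ∃ t ∈ T, face n v d t ∈ η) :
    GoodBlock (m * n) ((m - 1) * R) u η := by
  have hex : ∀ v, ∃ C : Finset (ℕ × ℕ), (∀ a ∈ C, InBlock n v a) ∧ (InBlock m u v → v ≠ v₀ →
      (∀ j, j / n = v.2 → R ≤ (C.filter fun a => a.2 = j).card) ∧
      (∀ i, i / n = v.1 → R ≤ (C.filter fun a => a.1 = i).card) ∧ Linked η C) := by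
    intro v
    by_cases h : InBlock m u v ∧ v ≠ v₀
    · obtain ⟨C, h1, h2, h3, h4⟩ := hgood v h.1 h.2
      exact ⟨C, h1, fun _ _ => ⟨h2, h3, h4⟩⟩
    · exact ⟨∅, by simp, fun h1 h2 => absurd ⟨h1, h2⟩ h⟩
  choose C hCin hC using hex
  set B : Finset (ℕ × ℕ) := ((Finset.Ico (u.1 * m) (u.1 * m + m)) ×ˢ
    (Finset.Ico (u.2 * m) (u.2 * m + m))).erase v₀ with hB
  have hdiv : ∀ x w, x / m = w ↔ w * m ≤ x ∧ x < w * m + m := by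
    intro x w
    rw [Nat.div_eq_iff (by omega)]
    constructor <;> intro h <;> constructor <;> omega
  have hBmem : ∀ v, v ∈ B ↔ v ≠ v₀ ∧ InBlock m u v := by
    intro v
    simp only [hB, Finset.mem_erase, Finset.mem_product, Finset.mem_Ico, InBlock, hdiv]
  have hRpos : 0 < R := by omega
  have hne : ∀ v ∈ B, (C v).Nonempty := by
    intro v hv
    rw [hBmem] at hv
    have h1 := (hC v hv.2 hv.1).1 (v.2 * n) (Nat.mul_div_cancel _ hn)
    have h2 : 0 < ((C v).filter fun a => a.2 = v.2 * n).card := by omega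
    obtain ⟨a, ha⟩ := Finset.card_pos.mp h2
    exact ⟨a, (Finset.mem_filter.mp ha).1⟩
  have hdisj : ∀ v w, v ≠ w → Disjoint (C v) (C w) := by
    intro v w hvw
    rw [Finset.disjoint_left]
    intro a ha hb
    have h1 := hCin v a ha
    have h2 := hCin w a hb
    exact hvw (Prod.ext (h1.1.symm.trans h2.1) (h1.2.symm.trans h2.2))
  refine ⟨B.biUnion C, ?_, ?_, ?_, ?_⟩
  · intro a ha
    obtain ⟨v, hv, hav⟩ := Finset.mem_biUnion.mp ha
    rw [inBlock_mul]
    have h1 := hCin v a hav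
    have h2 := ((hBmem v).mp hv).2
    rw [h1.1, h1.2]; exact h2
  · intro j hj
    have hj' : j / n / m = u.2 := by rw [Nat.div_div_eq_div_mul, mul_comm n m]; exact hj
    refine le_card_line (w := u.1) (S := fun x => (C (x, j / n)).filter fun a => a.2 = j)
      -- The index of the exceptional square on this line; if the line misses it, the value lies
      -- just outside the range and the erasure has no effect.
      (if j / n = v₀.2 then v₀.1 else u.1 * m + m) ?_ ?_
    · intro x hx
      rw [Finset.mem_erase, Finset.mem_Ico] at hx
      have hxB : (x, j / n) ∈ B := by
        rw [hBmem]
        refine ⟨fun h => ?_, ⟨(hdiv x u.1).mpr hx.2, hj'⟩⟩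
        apply hx.1
        rw [← h]; simp
      have hx' := (hBmem _).mp hxB
      refine ⟨?_, (hC _ hx'.2 hx'.1).1 j rfl⟩
      intro a ha
      rw [Finset.mem_filter] at ha ⊢
      exact ⟨Finset.mem_biUnion.mpr ⟨_, hxB, ha.1⟩, ha.2⟩
    · intro x y hxy
      exact (hdisj _ _ (by simpa using hxy)).mono (Finset.filter_subset _ _)
        (Finset.filter_subset _ _)
  · intro i hi
    have hi' : i / n / m = u.1 := by rw [Nat.div_div_eq_div_mul, mul_comm n m]; exact hi
    refine le_card_line (w := u.2) (S := fun y => (C (i / n, y)).filter fun a => a.1 = i)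
      (if i / n = v₀.1 then v₀.2 else u.2 * m + m) ?_ ?_
    · intro y hy
      rw [Finset.mem_erase, Finset.mem_Ico] at hy
      have hyB : (i / n, y) ∈ B := by
        rw [hBmem]
        refine ⟨fun h => ?_, ⟨hi', (hdiv y u.2).mpr hy.2⟩⟩
        apply hy.1
        rw [← h]; simp
      have hy' := (hBmem _).mp hyB
      refine ⟨?_, (hC _ hy'.2 hy'.1).2.1 i rfl⟩
      intro a ha
      rw [Finset.mem_filter] at ha ⊢
      exact ⟨Finset.mem_biUnion.mpr ⟨_, hyB, ha.1⟩, ha.2⟩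
    · intro x y hxy
      exact (hdisj _ _ (by simpa using hxy)).mono (Finset.filter_subset _ _)
        (Finset.filter_subset _ _)
  · intro σ hσ
    -- The common spin of the linked set in the square `v`. Constancy of `g` on the coarse grid
    -- without `v₀` is then `grid_constant`.
    set g : ℕ × ℕ → ℤˣ := fun v => if h : (C v).Nonempty then σ h.choose else 1 with hg
    have hgC : ∀ v ∈ B, ∀ a ∈ C v, σ a = g v := by
      intro v hv a ha
      have hv' := (hBmem v).mp hv
      have h1 := hne v hv
      simp only [hg, dif_pos h1]
      exact (hC v hv'.2 hv'.1).2.2 σ hσ a ha _ h1.choose_spec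
    have hstep : ∀ v d, InBlock m u v → InBlock m u (step v d) → v ≠ v₀ → step v d ≠ v₀ →
        g v = g (step v d) := by
      intro v d hv hvd hv0 hvd0
      have h1 := le_card_face_fst hn (hCin v) (hC v hv hv0).1 (hC v hv hv0).2.1 d
      have h2 := le_card_face_snd hn (hCin (step v d)) (hC _ hvd hvd0).1 (hC _ hvd hvd0).2.1
      -- Both linked sets occupy at least 3/4 of their side of the face, so at least half of the
      -- face edges join one to the other, and one of these is open.
      have h3 := card_inter_range hR (Finset.filter_subset _ _) (Finset.filter_subset _ _) h1 h2
      obtain ⟨t, ht, htη⟩ := hface v d hv hvd _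
        (Finset.inter_subset_left.trans (Finset.filter_subset _ _)) h3
      rw [Finset.mem_inter, Finset.mem_filter, Finset.mem_filter] at ht
      rw [← hgC v ((hBmem v).mpr ⟨hv0, hv⟩) _ ht.1.2,
        ← hgC (step v d) ((hBmem _).mpr ⟨hvd0, hvd⟩) _ ht.2.2]
      exact hσ _ htη
    intro a ha b hb
    obtain ⟨v, hv, hav⟩ := Finset.mem_biUnion.mp ha
    obtain ⟨w, hw, hbw⟩ := Finset.mem_biUnion.mp hb
    rw [hgC v hv a hav, hgC w hw b hbw]
    have hv' := (hBmem v).mp hv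
    have hw' := (hBmem w).mp hw
    exact grid_constant g hm u v₀ hstep hv'.2 hw'.2 hv'.1 hw'.1

end Percolation

/-! ### Multiscale estimate for bad squares. -/

section Renormalization

theorem EdgeIn.of_block {n m : ℕ} {u v : ℕ × ℕ} (hv : InBlock m u v) {e : GridEdge}
    (he : EdgeIn n v e) : EdgeIn (m * n) u e := by
  obtain ⟨h1, h2⟩ := he
  constructor
  · rw [inBlock_mul, h1.1, h1.2]; exact hv
  · rw [inBlock_mul, h2.1, h2.2]; exact hv

theorem edgeIn_face {n m : ℕ} (hn : 0 < n) {u v : ℕ × ℕ} {d : Bool} (hv : InBlock m u v)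
    (hvd : InBlock m u (step v d)) {t : ℕ} (ht : t < n) : EdgeIn (m * n) u (face n v d t) := by
  have h1 := face_fst hn v d ht
  have h2 := face_snd hn v d ht
  constructor
  · rw [inBlock_mul, h1.1, h1.2]; exact hv
  · rw [inBlock_mul, h2.1, h2.2]; exact hvd

/-- One step of the renormalization, in terms of covers of the bad events. -/
theorem cover_block_mul {n R m : ℕ} {ρ p : ℝ} (hn : 0 < n) (hR : 3 * n ≤ 4 * R) (hm : 2 ≤ m)
    (hρ : 0 ≤ ρ) (hρ1 : ρ ≤ 1) (hp : 0 ≤ p)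
    (h : ∀ v, Cover (ρ ^ 2) (EdgeIn n v) (fun η => ¬ GoodBlock n R v η) p) (u : ℕ × ℕ) :
    Cover (ρ ^ 2) (EdgeIn (m * n) u) (fun η => ¬ GoodBlock (m * n) ((m - 1) * R) u η)
      (m ^ 4 * p ^ 2 + 2 * m ^ 2 * (2 * ρ) ^ n) := by
  have hq : 0 ≤ ρ ^ 2 := sq_nonneg ρ
  set B : Finset (ℕ × ℕ) := (Finset.Ico (u.1 * m) (u.1 * m + m)) ×ˢ
    (Finset.Ico (u.2 * m) (u.2 * m + m)) with hB
  have hBmem : ∀ v, v ∈ B ↔ InBlock m u v := by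
    intro v
    simp only [hB, Finset.mem_product, Finset.mem_Ico, InBlock]
    rw [Nat.div_eq_iff (by omega), Nat.div_eq_iff (by omega)]
    constructor <;> intro h <;> refine ⟨⟨?_, ?_⟩, ?_, ?_⟩ <;> omega
  have hBcard : B.card = m ^ 2 := by simp [hB, sq]
  -- Two distinct bad subsquares: they use disjoint edge sets, so their bounds multiply.
  have h1 : Cover (ρ ^ 2) (EdgeIn (m * n) u) (fun η => ∃ w ∈ B.offDiag,
      ¬ GoodBlock n R w.1 η ∧ ¬ GoodBlock n R w.2 η) (∑ w ∈ B.offDiag, p * p) := by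
    refine Cover.exists hq _ fun w hw => ?_
    rw [Finset.mem_offDiag] at hw
    refine (Cover.and hq hp ?_ (h w.1) (h w.2)).mono ?_ (fun _ h => h) le_rfl
    · intro e he he'
      exact hw.2.2 (Prod.ext (he.1.1.symm.trans he'.1.1) (he.1.2.symm.trans he'.1.2))
    · rintro e (he | he)
      · exact he.of_block ((hBmem _).mp hw.1)
      · exact he.of_block ((hBmem _).mp hw.2.1)
  set A : Finset ((ℕ × ℕ) × Bool) := (B ×ˢ Finset.univ).filter fun w => step w.1 w.2 ∈ B with hA
  set Ts : Finset (Finset ℕ) := (Finset.range n).powerset.filter fun T => n ≤ 2 * T.card with hTs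
  -- A face with at least half of its edges closed. Writing the edge parameter as `ρ ^ 2` turns `n /
  -- 2` closed edges into `ρ ^ n`; the choice of `T` costs `2 ^ n`.
  have h2 : Cover (ρ ^ 2) (EdgeIn (m * n) u) (fun η => ∃ w ∈ A, ∃ T ∈ Ts,
      ∀ e ∈ T.image (face n w.1 w.2), e ∉ η) (∑ w ∈ A, ∑ T ∈ Ts, ρ ^ n) := by
    refine Cover.exists hq _ fun w hw => Cover.exists hq _ fun T hT => ?_
    rw [hA, Finset.mem_filter, Finset.mem_product] at hw
    rw [hTs, Finset.mem_filter, Finset.mem_powerset] at hT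
    refine (Cover.closed (T.image (face n w.1 w.2)) ?_).mono (fun _ h => h) (fun _ h => h) ?_
    · intro e he
      obtain ⟨t, ht, rfl⟩ := Finset.mem_image.mp he
      exact edgeIn_face hn ((hBmem _).mp hw.1.1) ((hBmem _).mp hw.2) (Finset.mem_range.mp (hT.1 ht))
    · rw [Finset.card_image_of_injective _ (face_injective _ _), ← pow_mul]
      exact pow_le_pow_of_le_one hρ hρ1 hT.2
  refine (Cover.or hq h1 h2).mono (fun _ h => h) ?_ ?_
  · intro η hη
    by_contra hcon
    rw [not_or] at hcon
    obtain ⟨hc1, hc2⟩ := hcon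
    push Not at hc1 hc2
    have hone : ∃ v₀, ∀ v, InBlock m u v → v ≠ v₀ → GoodBlock n R v η := by
      by_cases hall : ∃ v₀ ∈ B, ¬ GoodBlock n R v₀ η
      · obtain ⟨v₀, hv₀, hbad⟩ := hall
        exact ⟨v₀, fun v hv hne => hc1 (v₀, v)
          (Finset.mem_offDiag.mpr ⟨hv₀, (hBmem v).mpr hv, hne.symm⟩) hbad⟩
      · push Not at hall
        exact ⟨u, fun v hv _ => hall v ((hBmem v).mpr hv)⟩
    obtain ⟨v₀, hv₀⟩ := hone
    refine hη (goodBlock_mul hn hR hm u η v₀ hv₀ ?_)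
    intro v d hv hvd T hT hcard
    obtain ⟨e, he, heη⟩ := hc2 (v, d) (by
      rw [hA, Finset.mem_filter, Finset.mem_product]
      exact ⟨⟨(hBmem v).mpr hv, Finset.mem_univ _⟩, (hBmem _).mpr hvd⟩) T (by
      rw [hTs, Finset.mem_filter, Finset.mem_powerset]; exact ⟨hT, hcard⟩)
    obtain ⟨t, ht, rfl⟩ := Finset.mem_image.mp he
    exact ⟨t, ht, heη⟩
  · have hoff : (B.offDiag.card : ℝ) ≤ m ^ 4 := by
      have : B.offDiag.card ≤ m ^ 4 := by
        rw [Finset.offDiag_card, hBcard]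
        calc m ^ 2 * m ^ 2 - m ^ 2 ≤ m ^ 2 * m ^ 2 := Nat.sub_le _ _
          _ = m ^ 4 := by ring
      exact_mod_cast this
    have hAc : (A.card : ℝ) ≤ 2 * m ^ 2 := by
      have : A.card ≤ 2 * m ^ 2 := by
        refine (Finset.card_filter_le _ _).trans ?_
        rw [Finset.card_product, hBcard]
        simp [mul_comm]
      exact_mod_cast this
    have hTc : (Ts.card : ℝ) ≤ 2 ^ n := by
      have : Ts.card ≤ 2 ^ n := by
        refine (Finset.card_filter_le _ _).trans ?_
        rw [Finset.card_powerset, Finset.card_range]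
      exact_mod_cast this
    simp only [Finset.sum_const, nsmul_eq_mul]
    refine add_le_add ?_ ?_
    · rw [← sq]
      exact mul_le_mul_of_nonneg_right hoff (sq_nonneg p)
    · rw [mul_pow]
      exact mul_le_mul hAc (mul_le_mul_of_nonneg_right hTc (pow_nonneg hρ n)) (by positivity)
        (by positivity)

/-- Side lengths of the squares of the renormalization. -/
def side : ℕ → ℕ
  | 0 => 1
  | k + 1 => 2 ^ (k + 5) * side k

/-- Guaranteed number of points per row and column in a good square. -/
def spread : ℕ → ℕ
  | 0 => 1
  | k + 1 => (2 ^ (k + 5) - 1) * spread k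

theorem succ_le_side (k : ℕ) : k + 1 ≤ side k := by
  induction k with
  | zero => simp [side]
  | succ k ih =>
    rw [side]
    have : 2 ≤ 2 ^ (k + 5) := by
      calc 2 = 2 ^ 1 := rfl
        _ ≤ _ := Nat.pow_le_pow_right (by norm_num) (by omega)
    nlinarith

theorem side_pos (k : ℕ) : 0 < side k := lt_of_lt_of_le (Nat.succ_pos k) (succ_le_side k)

/-- The extra term makes the induction close: with `x = 2^{-(k+5)}`, `(1 - x)(15/16 + 2x) ≥ 15/16 +
x` because `15/16 + 2x ≤ 1`. The total loss over all scales thus stays below 1/16. -/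
theorem spread_ge (k : ℕ) : (15 / 16 + (1 / 2 : ℝ) ^ (k + 4)) * side k ≤ spread k := by
  induction k with
  | zero => simp [side, spread]; norm_num
  | succ k ih =>
    have h1 : 1 ≤ 2 ^ (k + 5) := Nat.one_le_two_pow
    rw [side, spread]
    push_cast [Nat.cast_sub h1]
    have h2 : (0 : ℝ) < 2 ^ (k + 5) := by positivity
    have h3 : (1 / 2 : ℝ) ^ (k + 1 + 4) * 2 ^ (k + 5) = 1 := by
      rw [show k + 1 + 4 = k + 5 by ring, ← mul_pow]; norm_num
    have h4 : (1 / 2 : ℝ) ^ (k + 4) = 2 * (1 / 2 : ℝ) ^ (k + 1 + 4) := by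
      rw [show k + 1 + 4 = (k + 4) + 1 by ring, pow_succ]; ring
    have h5 : (1 / 2 : ℝ) ^ (k + 4) ≤ 1 / 16 := by
      calc (1 / 2 : ℝ) ^ (k + 4) ≤ (1 / 2 : ℝ) ^ 4 :=
            pow_le_pow_of_le_one (by norm_num) (by norm_num) (by omega)
        _ = 1 / 16 := by norm_num
    have h6 : (0 : ℝ) < side k := by exact_mod_cast side_pos k
    have h7 : (1 : ℝ) ≤ 2 ^ (k + 5) := by exact_mod_cast h1
    set x := (1 / 2 : ℝ) ^ (k + 1 + 4)
    set s : ℝ := (side k : ℝ)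
    set N : ℝ := 2 ^ (k + 5)
    calc (15 / 16 + x) * (N * s) = (N - 1) * ((15 / 16 + 2 * x) * s)
          - ((N * x) * s - (15 / 16 + 2 * x) * s) := by ring
      _ ≤ (N - 1) * ((15 / 16 + 2 * x) * s) := by
          rw [mul_comm x N] at h3
          rw [h3]
          have : (15 / 16 + 2 * x) * s ≤ 1 * s :=
            mul_le_mul_of_nonneg_right (by linarith) h6.le
          linarith
      _ ≤ (N - 1) * spread k := by
          rw [h4] at ih
          exact mul_le_mul_of_nonneg_left ih (by linarith)

theorem side_le_spread (k : ℕ) : 15 * side k ≤ 16 * spread k := by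
  have h1 := spread_ge k
  have h2 : (0 : ℝ) ≤ (1 / 2 : ℝ) ^ (k + 4) * side k := by positivity
  have h3 : (15 : ℝ) * side k ≤ 16 * spread k := by linarith
  exact_mod_cast h3

/-- At high density squares are bad with a probability that tends to zero with their size. -/
theorem cover_side {ρ : ℝ} (hρ : 0 ≤ ρ) (hρ' : 2 * ρ ≤ (1 / 2) ^ 41) (k : ℕ) (u : ℕ × ℕ) :
    Cover (ρ ^ 2) (EdgeIn (side k) u) (fun η => ¬ GoodBlock (side k) (spread k) u η)
      ((1 / 2) ^ (4 * k + 25)) := by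
  induction k generalizing u with
  | zero =>
    refine (Cover.of_false (fun η => ?_)).mono (fun _ h => h) (fun _ h => h) (by positivity)
    rw [not_not]
    refine ⟨{u}, by simp [InBlock, side], ?_, ?_, ?_⟩
    · intro j hj
      simp only [side, Nat.div_one] at hj
      subst hj
      simp [spread, Finset.filter_singleton]
    · intro i hi
      simp only [side, Nat.div_one] at hi
      subst hi
      simp [spread, Finset.filter_singleton]
    · intro σ _ a ha b hb
      rw [Finset.mem_singleton] at ha hb
      rw [ha, hb]
  | succ k ih =>
    have hR : 3 * side k ≤ 4 * spread k := by have := side_le_spread k; omega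
    have hm : 2 ≤ 2 ^ (k + 5) := by
      calc 2 = 2 ^ 1 := rfl
        _ ≤ _ := Nat.pow_le_pow_right (by norm_num) (by omega)
    have hρ1 : ρ ≤ 1 := by
      have : ((1 : ℝ) / 2) ^ 41 ≤ 1 := pow_le_one₀ (by norm_num) (by norm_num)
      linarith
    refine (cover_block_mul (side_pos k) hR hm hρ hρ1 (by positivity) ih u).mono (fun _ h => h)
      (fun _ h => h) ?_
    -- Exponents of two with `m = 2^{k+5}`: the pair term is at most `2^{4k+20} 2^{-8k-50} =
    -- 2^{-4k-30}`, the face term at most `2^{2k+11} 2^{-41(k+1)} ≤ 2^{-4k-30}`. Their sum is the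
    -- target `2^{-4(k+1)-25}`.
    have hx : (2 : ℝ) ^ k * (1 / 2) ^ k = 1 := by rw [← mul_pow]; norm_num
    set y : ℝ := (1 / 2) ^ k with hy
    have hy0 : 0 < y := by positivity
    have hy1 : y ≤ 1 := pow_le_one₀ (by norm_num) (by norm_num)
    have h1 : (2 * ρ) ^ side k ≤ y ^ 41 * (1 / 2) ^ 41 := by
      calc (2 * ρ) ^ side k ≤ ((1 / 2 : ℝ) ^ 41) ^ side k :=
            pow_le_pow_left₀ (by linarith) hρ' _
        _ ≤ ((1 / 2 : ℝ) ^ 41) ^ (k + 1) :=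
            pow_le_pow_of_le_one (by positivity) (pow_le_one₀ (by norm_num) (by norm_num))
              (succ_le_side k)
        _ = y ^ 41 * (1 / 2) ^ 41 := by rw [hy, ← pow_mul, ← pow_mul, ← pow_add]; ring_nf
    have h2 : ((1 : ℝ) / 2) ^ (4 * k + 25) = y ^ 4 * (1 / 2) ^ 25 := by
      rw [hy, ← pow_mul, ← pow_add]; ring_nf
    have h3 : ((1 : ℝ) / 2) ^ (4 * (k + 1) + 25) = y ^ 4 * (1 / 2) ^ 29 := by
      rw [hy, ← pow_mul, ← pow_add]; ring_nf
    have h4 : ((2 ^ (k + 5) : ℕ) : ℝ) = 2 ^ k * 32 := by push_cast; rw [pow_add]; norm_num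
    rw [h2, h3, h4]
    set X : ℝ := 2 ^ k with hX
    have hX0 : 0 < X := by positivity
    have h5 : (X * 32) ^ 4 * (y ^ 4 * (1 / 2) ^ 25) ^ 2 = y ^ 4 * (1 / 2) ^ 30 := by
      calc (X * 32) ^ 4 * (y ^ 4 * (1 / 2) ^ 25) ^ 2 = (X * y) ^ 4 * y ^ 4 * (1 / 2) ^ 30 := by ring
        _ = _ := by rw [hx]; ring
    have h6 : 2 * (X * 32) ^ 2 * (y ^ 41 * (1 / 2) ^ 41) ≤ y ^ 4 * (1 / 2) ^ 30 := by
      calc 2 * (X * 32) ^ 2 * (y ^ 41 * (1 / 2) ^ 41)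
          = (X * y) ^ 2 * (y ^ 4 * (1 / 2) ^ 30) * y ^ 35 := by ring
        _ = (y ^ 4 * (1 / 2) ^ 30) * y ^ 35 := by rw [hx]; ring
        _ ≤ (y ^ 4 * (1 / 2) ^ 30) * 1 :=
            mul_le_mul_of_nonneg_left (pow_le_one₀ hy0.le hy1) (by positivity)
        _ = _ := mul_one _
    have h7 : 2 * (X * 32) ^ 2 * (2 * ρ) ^ side k ≤ 2 * (X * 32) ^ 2 * (y ^ 41 * (1 / 2) ^ 41) :=
      mul_le_mul_of_nonneg_left h1 (by positivity)
    rw [h5]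
    have h8 : y ^ 4 * (1 / 2) ^ 29 = y ^ 4 * (1 / 2) ^ 30 + y ^ 4 * (1 / 2) ^ 30 := by ring
    linarith

end Renormalization

/-! ### Two adjacent squares embedded in a graph as a gadget. -/

section DoubleBlock

/-- The point lies in one of the two adjacent squares of side `n`. -/
def InDouble (n : ℕ) (a : ℕ × ℕ) : Prop := InBlock n (0, 0) a ∨ InBlock n (1, 0) a

/-- The edge lies inside one of the two adjacent squares of side `n`. -/
def StrongEdge (n : ℕ) (g : GridEdge) : Prop := EdgeIn n (0, 0) g ∨ EdgeIn n (1, 0) g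

/-- The `t`-th edge between the two adjacent squares of side `n`. -/
def linkEdge (n t : ℕ) : GridEdge := face n (0, 0) false t

/-- The sign of the coupling of the `t`-th link. -/
def linkSign (n t : ℕ) : ℝ := if 2 * t < n then 1 else -1

theorem linkSign_eq (n t : ℕ) : linkSign n t = 1 ∨ linkSign n t = -1 := by
  unfold linkSign; split_ifs <;> simp

theorem sum_linkSign {n : ℕ} (hn : Even n) : ∑ t : Fin n, linkSign n t = 0 := by
  obtain ⟨j, rfl⟩ := hn
  rw [Fin.sum_univ_eq_sum_range (fun t => linkSign (j + j) t), Finset.sum_range_add]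
  have h1 : ∑ x ∈ Finset.range j, linkSign (j + j) x = j := by
    rw [Finset.sum_congr rfl (g := fun _ => (1 : ℝ))]
    · simp
    · intro x hx
      rw [Finset.mem_range] at hx
      rw [linkSign, if_pos (by omega)]
  have h2 : ∑ x ∈ Finset.range j, linkSign (j + j) (j + x) = -j := by
    rw [Finset.sum_congr rfl (g := fun _ => (-1 : ℝ))]
    · simp
    · intro x hx
      rw [linkSign, if_neg (by omega)]
  rw [h1, h2]; ring

theorem StrongEdge.fst {n : ℕ} {g : GridEdge} (h : StrongEdge n g) : InDouble n g.1 :=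
  h.imp (fun h => h.1) fun h => h.1

theorem StrongEdge.snd {n : ℕ} {g : GridEdge} (h : StrongEdge n g) :
    InDouble n (step g.1 g.2) := h.imp (fun h => h.2) fun h => h.2

theorem linkEdge_fst {n t : ℕ} (ht : t < n) : InBlock n (0, 0) (linkEdge n t).1 :=
  face_fst (by omega) _ _ ht

theorem linkEdge_snd {n t : ℕ} (ht : t < n) :
    InBlock n (1, 0) (step (linkEdge n t).1 (linkEdge n t).2) :=
  face_snd (v := (0, 0)) (d := false) (by omega) ht

theorem inBlock_unique {n : ℕ} {u v a : ℕ × ℕ} (hu : InBlock n u a) (hv : InBlock n v a) : u = v :=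
  Prod.ext (hu.1.symm.trans hv.1) (hu.2.symm.trans hv.2)

theorem not_strongEdge_linkEdge {n t : ℕ} (ht : t < n) : ¬ StrongEdge n (linkEdge n t) := by
  rintro (h | h)
  · exact absurd (inBlock_unique h.2 (linkEdge_snd ht)) (by simp)
  · exact absurd (inBlock_unique h.1 (linkEdge_fst ht)) (by simp)

/-- Steps only increase coordinates, so the unordered pair of ends already determines the base point
and the direction. -/
theorem gridEdge_eq {g g' : GridEdge}
    (h : (g.1 = g'.1 ∧ step g.1 g.2 = step g'.1 g'.2) ∨
      (g.1 = step g'.1 g'.2 ∧ step g.1 g.2 = g'.1)) : g = g' := by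
  obtain ⟨⟨x, y⟩, d⟩ := g
  obtain ⟨⟨x', y'⟩, d'⟩ := g'
  cases d <;> cases d' <;> simp [step] at h ⊢ <;> omega

/-- The two squares occur in the graph `G`: the point `a` sits at the vertex `P a` and the grid edge
`g` is the edge `edge g`. -/
structure DoubleBlock {V : Type*} (G : SimpleGraph V) (n : ℕ) where
  P : ℕ × ℕ → V
  edge : GridEdge → G.edgeSet
  inj : ∀ a b, InDouble n a → InDouble n b → P a = P b → a = b
  edge_eq : ∀ g : GridEdge, InDouble n g.1 → InDouble n (step g.1 g.2) →
    (edge g : Sym2 V) = s(P g.1, P (step g.1 g.2))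

namespace DoubleBlock

variable {V : Type*} {G : SimpleGraph V} {n : ℕ} (B : DoubleBlock G n)

theorem edge_inj {g g' : GridEdge} (h1 : InDouble n g.1) (h2 : InDouble n (step g.1 g.2))
    (k1 : InDouble n g'.1) (k2 : InDouble n (step g'.1 g'.2)) (h : B.edge g = B.edge g') :
    g = g' := by
  have h3 := congrArg Subtype.val h
  rw [B.edge_eq g h1 h2, B.edge_eq g' k1 k2, Sym2.eq_iff] at h3
  apply gridEdge_eq
  rcases h3 with ⟨ha, hb⟩ | ⟨ha, hb⟩
  · exact Or.inl ⟨B.inj _ _ h1 k1 ha, B.inj _ _ h2 k2 hb⟩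
  · exact Or.inr ⟨B.inj _ _ h1 k2 ha, B.inj _ _ h2 k1 hb⟩

/-- The edges that touch the squares without belonging to the construction. -/
def IsWeak (e : G.edgeSet) : Prop :=
  (∀ g, StrongEdge n g → e ≠ B.edge g) ∧ (∀ t < n, e ≠ B.edge (linkEdge n t)) ∧
    ∃ a, InDouble n a ∧ B.P a ∈ (e : Sym2 V)

variable {J : G.edgeSet → ℝ} {β h r : ℝ}

/-- Two squares with the right couplings form a gadget. -/
def toGadget [Fintype V] (hn : Even n)
    (hpos : ∀ g, StrongEdge n g → 0 < J (B.edge g))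
    (hlarge : ∀ g, StrongEdge n g → 2 * r ≤ Real.exp (2 * (β * J (B.edge g))) - 1)
    (hlink : ∀ t < n, |β * J (B.edge (linkEdge n t)) - linkSign n t * h| ≤ h / 100)
    (hweak : ∑ e with B.IsWeak e, β * |J e| ≤ 1) : Gadget G J β n h r where
  strong := Finset.univ.filter fun e => ∃ g, StrongEdge n g ∧ e = B.edge g
  weak := Finset.univ.filter B.IsWeak
  link t := B.edge (linkEdge n t)
  left t := B.P (linkEdge n t).1
  right t := B.P (step (linkEdge n t).1 (linkEdge n t).2)
  sign t := linkSign n t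
  core := {x | ∃ a, InDouble n a ∧ B.P a = x}
  block := {x | ∃ a, InBlock n (1, 0) a ∧ B.P a = x}
  link_injective s t hst := by
    have := B.edge_inj (Or.inl (linkEdge_fst s.2)) (Or.inr (linkEdge_snd s.2))
      (Or.inl (linkEdge_fst t.2)) (Or.inr (linkEdge_snd t.2)) hst
    exact Fin.ext (face_injective _ _ this)
  link_eq t := B.edge_eq _ (Or.inl (linkEdge_fst t.2)) (Or.inr (linkEdge_snd t.2))
  disjoint_weak e he hw := by
    obtain ⟨g, hg, rfl⟩ := (Finset.mem_filter.mp he).2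
    exact (Finset.mem_filter.mp hw).2.1 g hg rfl
  link_notMem_strong t ht := by
    obtain ⟨g, hg, hgt⟩ := (Finset.mem_filter.mp ht).2
    have := B.edge_inj (Or.inl (linkEdge_fst t.2)) (Or.inr (linkEdge_snd t.2)) hg.fst hg.snd hgt
    exact not_strongEdge_linkEdge t.2 (this ▸ hg)
  link_notMem_weak t ht := (Finset.mem_filter.mp ht).2.2.1 t t.2 rfl
  strong_core e he x hx := by
    obtain ⟨g, hg, rfl⟩ := (Finset.mem_filter.mp he).2
    rw [B.edge_eq g hg.fst hg.snd, Sym2.mem_iff] at hx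
    rcases hx with rfl | rfl
    · exact ⟨_, hg.fst, rfl⟩
    · exact ⟨_, hg.snd, rfl⟩
  strong_block e he x hx y hy hxb := by
    obtain ⟨g, hg, rfl⟩ := (Finset.mem_filter.mp he).2
    rw [B.edge_eq g hg.fst hg.snd, Sym2.mem_iff] at hx hy
    obtain ⟨a, ha, rfl⟩ := hxb
    have hg' : EdgeIn n (1, 0) g := by
      rcases hg with h | h
      · exfalso
        rcases hx with hx | hx
        · have := B.inj _ _ (Or.inr ha) (Or.inl h.1) hx
          exact absurd (inBlock_unique ha (this ▸ h.1)) (by simp)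
        · have := B.inj _ _ (Or.inr ha) (Or.inl h.2) hx
          exact absurd (inBlock_unique ha (this ▸ h.2)) (by simp)
      · exact h
    rcases hy with rfl | rfl
    · exact ⟨_, hg'.1, rfl⟩
    · exact ⟨_, hg'.2, rfl⟩
  strong_pos e he := by
    obtain ⟨g, hg, rfl⟩ := (Finset.mem_filter.mp he).2
    exact hpos g hg
  strong_large e he := by
    obtain ⟨g, hg, rfl⟩ := (Finset.mem_filter.mp he).2
    exact hlarge g hg
  other_core e hs hw hl x hx := by
    rintro ⟨a, ha, rfl⟩
    refine hw (Finset.mem_filter.mpr ⟨Finset.mem_univ _, fun g hg hge => ?_, fun t ht => ?_,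
      a, ha, hx⟩)
    · exact hs (Finset.mem_filter.mpr ⟨Finset.mem_univ _, g, hg, hge⟩)
    · exact hl ⟨t, ht⟩
  block_core := by
    rintro x ⟨a, ha, rfl⟩
    exact ⟨a, Or.inr ha, rfl⟩
  left_notMem t := by
    rintro ⟨a, ha, hP⟩
    have := B.inj _ _ (Or.inr ha) (Or.inl (linkEdge_fst t.2)) hP
    exact absurd (inBlock_unique ha (this ▸ linkEdge_fst t.2)) (by simp)
  right_mem t := ⟨_, linkEdge_snd t.2, rfl⟩
  sign_eq t := linkSign_eq n t
  sign_sum := sum_linkSign hn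
  link_coupling t := hlink t t.2
  weak_small := hweak

/-- Goodness of both squares pins the links. -/
theorem exists_isPinned {D : Gadget G J β n h r}
    (hleft : ∀ t : Fin n, D.left t = B.P (linkEdge n t).1)
    (hright : ∀ t : Fin n, D.right t = B.P (step (linkEdge n t).1 (linkEdge n t).2))
    {R : ℕ} (hn : 0 < n) (hR : 15 * n ≤ 16 * R) {τ : Finset G.edgeSet}
    (h0 : GoodBlock n R (0, 0) {g | StrongEdge n g ∧ B.edge g ∈ τ})
    (h1 : GoodBlock n R (1, 0) {g | StrongEdge n g ∧ B.edge g ∈ τ}) :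
    ∃ I, D.IsPinned τ I := by
  obtain ⟨C₀, hin₀, hrow₀, hcol₀, hl₀⟩ := h0
  obtain ⟨C₁, hin₁, hrow₁, hcol₁, hl₁⟩ := h1
  have hc₀ := le_card_face_fst hn hin₀ hrow₀ hcol₀ false
  have hc₁ := le_card_face_snd (v := (0, 0)) (d := false) hn hin₁ hrow₁ hcol₁
  set A₀ := (Finset.range n).filter fun t => (face n (0, 0) false t).1 ∈ C₀
  set A₁ := (Finset.range n).filter
    fun t => step (face n (0, 0) false t).1 (face n (0, 0) false t).2 ∈ C₁
  -- Each of the two sets misses at most `n / 16` links, so both ends are linked for at least `7 n /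
  -- 8` of them.
  have hcard := Finset.card_union_add_card_inter A₀ A₁
  have hunion : (A₀ ∪ A₁).card ≤ n := by
    have := Finset.card_le_card (Finset.union_subset (Finset.filter_subset _ _)
      (Finset.filter_subset _ _) : A₀ ∪ A₁ ⊆ Finset.range n)
    rwa [Finset.card_range] at this
  set I : Finset (Fin n) := Finset.univ.filter fun t => (t : ℕ) ∈ A₀ ∩ A₁ with hI
  have hII : (A₀ ∩ A₁).card ≤ I.card := by
    have : A₀ ∩ A₁ ⊆ I.image Fin.val := by
      intro t ht
      have htn : t < n :=
        Finset.mem_range.mp (Finset.mem_filter.mp (Finset.mem_inter.mp ht).1).1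
      exact Finset.mem_image.mpr ⟨⟨t, htn⟩, Finset.mem_filter.mpr ⟨Finset.mem_univ _, ht⟩, rfl⟩
    exact (Finset.card_le_card this).trans Finset.card_image_le
  refine ⟨I, by omega, ?_⟩
  intro σ hσ
  have hresp : ∀ g ∈ {g | StrongEdge n g ∧ B.edge g ∈ τ},
      (σ ∘ B.P) g.1 = (σ ∘ B.P) (step g.1 g.2) := by
    rintro g ⟨hg, hgτ⟩
    have := hσ _ hgτ
    rwa [B.edge_eq g hg.fst hg.snd, edgeSpin_eq_one_iff] at this
  have hmem : ∀ i ∈ I, (linkEdge n i).1 ∈ C₀ ∧ step (linkEdge n i).1 (linkEdge n i).2 ∈ C₁ := by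
    intro i hi
    have := Finset.mem_inter.mp (Finset.mem_filter.mp hi).2
    exact ⟨(Finset.mem_filter.mp this.1).2, (Finset.mem_filter.mp this.2).2⟩
  constructor
  · intro i hi j hj
    rw [hleft, hleft]
    exact hl₀ (σ ∘ B.P) hresp _ (hmem i hi).1 _ (hmem j hj).1
  · intro i hi j hj
    rw [hright, hright]
    exact hl₁ (σ ∘ B.P) hresp _ (hmem i hi).2 _ (hmem j hj).2

end DoubleBlock

theorem even_side {k : ℕ} (hk : 0 < k) : Even (side k) := by
  obtain ⟨k, rfl⟩ := Nat.exists_eq_succ_of_ne_zero hk.ne'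
  rw [Nat.succ_eq_add_one, side]
  exact Even.mul_right (by rw [Nat.even_pow]; simp) _

namespace DoubleBlock

/-- Two large squares with the right couplings slow the Swendsen–Wang chain down. -/
theorem slow {V : Type*} [Fintype V] {G : SimpleGraph V} {J : G.edgeSet → ℝ} {β h : ℝ} {k : ℕ}
    (hk : 0 < k) (B : DoubleBlock G (side k)) (hβ : 0 ≤ β) (hh : 0 < h)
    (hpos : ∀ g, StrongEdge (side k) g → 0 < J (B.edge g))
    (hlarge : ∀ g, StrongEdge (side k) g →
      2 * ((2 : ℝ) ^ 84 - 1) ≤ Real.exp (2 * (β * J (B.edge g))) - 1)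
    (hlink : ∀ t < side k,
      |β * J (B.edge (linkEdge (side k) t)) - linkSign (side k) t * h| ≤ h / 100)
    (hweak : ∑ e with B.IsWeak e, β * |J e| ≤ 1)
    (hp : 2 * (1 / 2 : ℝ) ^ (4 * k + 25) ≤ Real.exp (-3 * (h * side k)))
    (hη : 16 * Real.exp (2 - 4 / 10 * (h * side k)) < 1)
    (inst : Fintype (Spins V)) :
    1 - 16 * Real.exp (2 - 4 / 10 * (h * side k)) ≤ @secondSpectralRadius _ inst (swMatrix G J β) ∧
      (ENNReal.ofReal (-Real.log (1 - 16 * Real.exp (2 - 4 / 10 * (h * side k)))))⁻¹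
        ≤ @expTime _ inst (swMatrix G J β) (gibbs G J β) := by
  obtain rfl : inst = Pi.instFintype := Subsingleton.elim _ _
  set D := B.toGadget (even_side hk) hpos hlarge hlink hweak
  have hρ : (0 : ℝ) ≤ (1 / 2) ^ 42 := by positivity
  have hρ' : 2 * (1 / 2 : ℝ) ^ 42 ≤ (1 / 2) ^ 41 := by norm_num
  obtain ⟨F, hF1, hF2, hF3⟩ := Cover.or (sq_nonneg _)
    ((cover_side hρ hρ' k (0, 0)).mono (S' := StrongEdge (side k)) (fun e he => Or.inl he)
      (fun _ h => h) le_rfl)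
    ((cover_side hρ hρ' k (1, 0)).mono (S' := StrongEdge (side k)) (fun e he => Or.inr he)
      (fun _ h => h) le_rfl)
  -- `r = 2^84 - 1` is chosen so that the closing bound `(1 + r)⁻¹` equals `ρ ^ 2` for `ρ =
  -- 2^{-42}`, the largest density admitted by `cover_side`.
  have hr : (1 + ((2 : ℝ) ^ 84 - 1))⁻¹ = ((1 / 2) ^ 42) ^ 2 := by norm_num
  refine D.slow hβ hh (side_pos k) (by norm_num) (F.image fun W => W.image B.edge) ?_ ?_
    (p := 2 * (1 / 2 : ℝ) ^ (4 * k + 25)) ?_ ?_ hp hη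
  · intro W hW e he
    obtain ⟨W, hWF, rfl⟩ := Finset.mem_image.mp hW
    obtain ⟨g, hg, rfl⟩ := Finset.mem_image.mp he
    exact Finset.mem_filter.mpr ⟨Finset.mem_univ _, g, hF1 W hWF g hg, rfl⟩
  · intro τ _ hhit
    have hgood : ¬ (¬ GoodBlock (side k) (spread k) (0, 0) {g | StrongEdge (side k) g ∧ B.edge g ∈ τ} ∨
        ¬ GoodBlock (side k) (spread k) (1, 0) {g | StrongEdge (side k) g ∧ B.edge g ∈ τ}) := by
      intro hbad
      obtain ⟨W, hW, hclosed⟩ := hF3 _ hbad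
      obtain ⟨e, he, heτ⟩ := hhit _ (Finset.mem_image_of_mem _ hW)
      obtain ⟨g, hg, rfl⟩ := Finset.mem_image.mp he
      exact hclosed g hg ⟨hF1 W hW g hg, heτ⟩
    rw [not_or, not_not, not_not] at hgood
    exact B.exists_isPinned (fun _ => rfl) (fun _ => rfl) (side_pos k) (side_le_spread k)
      hgood.1 hgood.2
  · rw [hr]
    refine le_trans (Finset.sum_image_le_of_nonneg
      (f := fun W : Finset G.edgeSet => ((((1 : ℝ) / 2) ^ 42) ^ 2) ^ W.card)
      fun W _ => by positivity) ?_
    refine le_trans (le_of_eq (Finset.sum_congr rfl fun W hW => ?_)) (hF2.trans (two_mul _).ge)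
    rw [Finset.card_image_of_injOn]
    intro g hg g' hg' hgg
    have h1 := hF1 W hW g hg
    have h2 := hF1 W hW g' hg'
    exact B.edge_inj h1.fst h1.snd h2.fst h2.snd hgg
  · have : ((1 : ℝ) / 2) ^ (4 * k + 25) ≤ (1 / 2) ^ 25 :=
      pow_le_pow_of_le_one (by norm_num) (by norm_num) (by omega)
    norm_num at this ⊢
    linarith

end DoubleBlock

end DoubleBlock

/-! ### The double square and its translates in the lattice and in boxes. -/

section LatticeGeometry

/-- The coordinate plane through the origin of `ℤ^d`. -/
def planePoint (d : ℕ) (a : ℕ × ℕ) : Fin d → ℤ :=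
  fun i => if i.val = 0 then a.1 else if i.val = 1 then a.2 else 0

theorem planePoint_injective {d : ℕ} (hd : 2 ≤ d) : Function.Injective (planePoint d) := by
  intro a b hab
  have h0 := congrFun hab ⟨0, by omega⟩
  have h1 := congrFun hab ⟨1, by omega⟩
  simp [planePoint] at h0 h1
  exact Prod.ext h0 h1

theorem planePoint_adj {d : ℕ} (hd : 2 ≤ d) (a : ℕ × ℕ) (b : Bool) :
    (latticeGraph d).Adj (planePoint d a) (planePoint d (step a b)) := by
  change ∑ i, (planePoint d a i - planePoint d (step a b) i) ^ 2 = 1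
  cases b with
  | false =>
    rw [Finset.sum_eq_single (⟨0, by omega⟩ : Fin d)]
    · simp [planePoint, step]
    · intro i _ hi
      have : i.val ≠ 0 := fun h => hi (Fin.ext h)
      simp [planePoint, step, this]
    · simp
  | true =>
    rw [Finset.sum_eq_single (⟨1, by omega⟩ : Fin d)]
    · simp [planePoint, step]
    · intro i _ hi
      have : i.val ≠ 1 := fun h => hi (Fin.ext h)
      simp [planePoint, step, this]
    · simp

/-- The two adjacent squares in the coordinate plane. -/
def planeBlock {d : ℕ} (hd : 2 ≤ d) (n : ℕ) : DoubleBlock (latticeGraph d) n where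
  P := planePoint d
  edge g := ⟨s(planePoint d g.1, planePoint d (step g.1 g.2)), planePoint_adj hd g.1 g.2⟩
  inj _ _ _ _ h := planePoint_injective hd h
  edge_eq _ _ _ := rfl

/-- Translation of the lattice by the vector `(w, …, w)`. -/
def shift (d : ℕ) (w : ℤ) : latticeGraph d ≃g latticeGraph d where
  toEquiv := Equiv.addRight (fun _ => w)
  map_rel_iff' := by intro x y; simp [latticeGraph]

/-- Translation of the edges of the lattice. -/
def shiftEdge (d : ℕ) (w : ℤ) : (latticeGraph d).edgeSet ≃ (latticeGraph d).edgeSet :=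
  (shift d w).mapEdgeSet

theorem coe_shiftEdge {d : ℕ} (w : ℤ) (e : (latticeGraph d).edgeSet) :
    (shiftEdge d w e : Sym2 (Fin d → ℤ)) = Sym2.map (fun (x : Fin d → ℤ) i => x i + w) e := rfl

/-- The inclusion of the edges of the box. -/
def boxEdge (d L : ℕ) : (boxGraph d L).edgeSet ↪ (latticeGraph d).edgeSet :=
  (SimpleGraph.Embedding.comap (Function.Embedding.subtype _) (latticeGraph d)).mapEdgeSet

theorem coe_boxEdge {d L : ℕ} (e : (boxGraph d L).edgeSet) :
    (boxEdge d L e : Sym2 (Fin d → ℤ)) = Sym2.map Subtype.val (e : Sym2 {x // x ∈ box d L}) := rfl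

theorem boxCouplings_eq {d L : ℕ} (J : (latticeGraph d).edgeSet → ℝ) (e : (boxGraph d L).edgeSet) :
    boxCouplings J L e = J (boxEdge d L e) := rfl

theorem InDouble.bounds {n : ℕ} (hn : 0 < n) {a : ℕ × ℕ} (ha : InDouble n a) :
    a.1 < 2 * n ∧ a.2 < n := by
  simp only [InDouble, InBlock, Nat.div_eq_iff hn] at ha
  omega

theorem planePoint_bounds {d n : ℕ} (hn : 0 < n) {a : ℕ × ℕ} (ha : InDouble n a) (i : Fin d) :
    0 ≤ planePoint d a i ∧ planePoint d a i < 2 * n := by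
  have := ha.bounds hn
  unfold planePoint
  split_ifs <;> omega

theorem adj_coord {d : ℕ} {x y : Fin d → ℤ} (h : (latticeGraph d).Adj x y) (i : Fin d) :
    x i - 1 ≤ y i ∧ y i ≤ x i + 1 := by
  have h1 : (x i - y i) ^ 2 ≤ 1 := by
    have h2 : ∑ i, (x i - y i) ^ 2 = 1 := h
    rw [← h2]
    exact Finset.single_le_sum (f := fun i => (x i - y i) ^ 2) (fun i _ => sq_nonneg _)
      (Finset.mem_univ i)
  constructor <;> nlinarith

/-- The edges with an end in one of the two squares. -/
def touching (d n : ℕ) : Set (latticeGraph d).edgeSet :=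
  {e | ∃ a, InDouble n a ∧ planePoint d a ∈ (e : Sym2 (Fin d → ℤ))}

theorem touching_bounds {d n : ℕ} (hn : 0 < n) {e : (latticeGraph d).edgeSet}
    (he : e ∈ touching d n) {x : Fin d → ℤ} (hx : x ∈ (e : Sym2 (Fin d → ℤ))) (i : Fin d) :
    -1 ≤ x i ∧ x i ≤ 2 * n := by
  obtain ⟨a, ha, hae⟩ := he
  have hb := planePoint_bounds (d := d) hn ha i
  by_cases hxa : planePoint d a = x
  · rw [← hxa]; omega
  · have hadj : (latticeGraph d).Adj (planePoint d a) x := by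
      have := (Sym2.mem_and_mem_iff hxa).mp ⟨hae, hx⟩
      rw [← SimpleGraph.mem_edgeSet, ← this]
      exact e.2
    have := adj_coord hadj i
    omega

theorem touching_finite {d n : ℕ} (hn : 0 < n) : (touching d n).Finite := by
  have hfin : ((Finset.Icc (fun _ : Fin d => (-1 : ℤ)) (fun _ => (2 * n : ℤ))).sym2
      : Set (Sym2 (Fin d → ℤ))).Finite := Finset.finite_toSet _
  refine (hfin.preimage (f := Subtype.val) Subtype.val_injective.injOn).subset ?_
  intro e he
  simp only [Set.mem_preimage, Finset.mem_coe, Finset.mem_sym2_iff, Finset.mem_Icc]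
  exact fun x hx => ⟨fun i => (touching_bounds hn he hx i).1,
    fun i => (touching_bounds hn he hx i).2⟩

/-- Distant translates of the set of touching edges are disjoint. -/
theorem shiftEdge_touching {d n : ℕ} (hd : 2 ≤ d) (hn : 0 < n) {j j' : ℕ}
    {e e' : (latticeGraph d).edgeSet} (he : e ∈ touching d n) (he' : e' ∈ touching d n)
    (h : shiftEdge d (j * (2 * n + 5) : ℕ) e = shiftEdge d (j' * (2 * n + 5) : ℕ) e') : j = j' := by
  obtain ⟨a, ha, hae⟩ := he
  have hb := planePoint_bounds (d := d) hn ha ⟨0, by omega⟩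
  have h1 := congrArg Subtype.val h
  rw [coe_shiftEdge, coe_shiftEdge] at h1
  have h2 : (fun i => planePoint d a i + ((j * (2 * n + 5) : ℕ) : ℤ)) ∈
      Sym2.map (fun (x : Fin d → ℤ) i => x i + ((j * (2 * n + 5) : ℕ) : ℤ)) e :=
    Sym2.mem_map.mpr ⟨_, hae, rfl⟩
  rw [h1, Sym2.mem_map] at h2
  obtain ⟨x, hx, hxa⟩ := h2
  have hb' := touching_bounds hn he' hx ⟨0, by omega⟩
  have h3 := congrFun hxa ⟨0, by omega⟩
  push_cast at h3
  -- First coordinates of touching edges lie between `-1` and `2 n`, a width smaller than the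
  -- spacing `2 n + 5` of the translates.
  by_contra hne
  rcases lt_or_gt_of_ne hne with hlt | hlt
  · have : (j : ℤ) + 1 ≤ j' := by exact_mod_cast hlt
    nlinarith
  · have : (j' : ℤ) + 1 ≤ j := by exact_mod_cast hlt
    nlinarith

/-- A value of the coupling of the edge `e` that suits the construction. -/
def Fits {d : ℕ} (hd : 2 ≤ d) (n : ℕ) (β h ε a : ℝ) (e : (latticeGraph d).edgeSet) (x : ℝ) : Prop :=
  (∀ g, StrongEdge n g → e = (planeBlock hd n).edge g → a < x) ∧
  (∀ t < n, e = (planeBlock hd n).edge (linkEdge n t) → |β * x - linkSign n t * h| ≤ h / 100) ∧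
  ((planeBlock hd n).IsWeak e → |x| ≤ ε)

theorem planePoint_mem_box {d n w L : ℕ} (hn : 0 < n) (hL : w + 2 * n ≤ L) {a : ℕ × ℕ}
    (ha : InDouble n a) : (fun i => planePoint d a i + (w : ℤ)) ∈ box d L := by
  rw [box, Finset.mem_Icc]
  constructor <;> intro i <;> have := planePoint_bounds (d := d) hn ha i <;>
    simp only <;> omega

/-- The translated squares inside the box. -/
theorem exists_boxBlock {d n w L : ℕ} (hd : 2 ≤ d) (hn : 0 < n) (hL : w + 2 * n ≤ L) :
    ∃ B : DoubleBlock (boxGraph d L) n,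
      ∀ a, InDouble n a → (B.P a : Fin d → ℤ) = fun i => planePoint d a i + (w : ℤ) := by
  have hadj : ∀ g : GridEdge, ∀ (h1 : InDouble n g.1) (h2 : InDouble n (step g.1 g.2)),
      (boxGraph d L).Adj ⟨_, planePoint_mem_box hn hL h1⟩ ⟨_, planePoint_mem_box hn hL h2⟩ := by
    intro g h1 h2
    exact (shift d w).map_rel_iff.mpr (planePoint_adj hd g.1 g.2)
  have h0 := linkEdge_fst hn
  have h1 := linkEdge_snd hn
  -- Outside the two squares the values are arbitrary, as `DoubleBlock` only constrains points and
  -- edges inside.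
  let P : ℕ × ℕ → {x // x ∈ box d L} := fun a =>
    if ha : InDouble n a then ⟨_, planePoint_mem_box hn hL ha⟩
    else ⟨_, planePoint_mem_box hn hL (Or.inl h0)⟩
  have hP : ∀ a (ha : InDouble n a), P a = ⟨_, planePoint_mem_box hn hL ha⟩ :=
    fun a ha => dif_pos ha
  refine ⟨⟨P, fun g => if hg : InDouble n g.1 ∧ InDouble n (step g.1 g.2) then
    ⟨s(⟨_, planePoint_mem_box hn hL hg.1⟩, ⟨_, planePoint_mem_box hn hL hg.2⟩), hadj g hg.1 hg.2⟩
    else ⟨s(_, _), hadj _ (Or.inl h0) (Or.inr h1)⟩, ?_, ?_⟩, ?_⟩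
  · intro a b ha hb hab
    rw [hP a ha, hP b hb] at hab
    apply planePoint_injective hd
    funext i
    have := congrFun (Subtype.ext_iff.mp hab) i
    simpa using this
  · intro g hg1 hg2
    rw [dif_pos ⟨hg1, hg2⟩, hP _ hg1, hP _ hg2]
  · intro a ha
    change (P a : Fin d → ℤ) = _
    rw [hP a ha]

theorem two_mul_le_exp_sub_one {x : ℝ} (hx : 100 ≤ x) :
    2 * ((2 : ℝ) ^ 84 - 1) ≤ Real.exp x - 1 := by
  have h2 : (2 : ℝ) ≤ Real.exp 1 := by
    have := Real.add_one_le_exp (1 : ℝ); linarith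
  have h3 : (2 : ℝ) ^ 100 ≤ Real.exp x := by
    calc (2 : ℝ) ^ 100 ≤ Real.exp 1 ^ 100 := pow_le_pow_left₀ (by norm_num) h2 _
      _ = Real.exp 100 := by rw [← Real.exp_nat_mul]; norm_num
      _ ≤ Real.exp x := Real.exp_le_exp.mpr hx
  norm_num at h3 ⊢
  linarith

/-- If the couplings near a translate of the two squares fit, the Swendsen–Wang chain in every
larger box is slow. -/
theorem box_slow {d k w L : ℕ} (hd : 2 ≤ d) (hk : 0 < k) {β h ε a : ℝ}
    (hβ : 0 ≤ β) (hh : 0 < h) (ha : 0 < a) (hβa : 100 ≤ 2 * (β * a))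
    {J : (latticeGraph d).edgeSet → ℝ}
    (hJ : ∀ e ∈ touching d (side k), Fits hd (side k) β h ε a e (J (shiftEdge d w e)))
    (hε : (touching_finite (d := d) (side_pos k)).toFinset.card * (β * ε) ≤ 1) (hε0 : 0 ≤ ε)
    (hp : 2 * (1 / 2 : ℝ) ^ (4 * k + 25) ≤ Real.exp (-3 * (h * side k)))
    (hη : 16 * Real.exp (2 - 4 / 10 * (h * side k)) < 1) (hL : w + 2 * side k ≤ L) :
    1 - 16 * Real.exp (2 - 4 / 10 * (h * side k)) ≤ boxSpectralRadius J β L ∧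
      (ENNReal.ofReal (-Real.log (1 - 16 * Real.exp (2 - 4 / 10 * (h * side k)))))⁻¹
        ≤ boxExpTime J β L := by
  have hn := side_pos k
  obtain ⟨B, hB⟩ := exists_boxBlock hd hn hL
  have hedge : ∀ g : GridEdge, InDouble (side k) g.1 → InDouble (side k) (step g.1 g.2) →
      boxEdge d L (B.edge g) = shiftEdge d w ((planeBlock hd (side k)).edge g) := by
    intro g h1 h2
    apply Subtype.ext
    rw [coe_boxEdge, coe_shiftEdge, B.edge_eq g h1 h2]
    simp only [planeBlock, Sym2.map_mk, hB _ h1, hB _ h2]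
  have htouch : ∀ g : GridEdge, InDouble (side k) g.1 →
      (planeBlock hd (side k)).edge g ∈ touching d (side k) := fun g h1 =>
    ⟨g.1, h1, by simp [planeBlock]⟩
  have hstrong : ∀ g, StrongEdge (side k) g → a < boxCouplings J L (B.edge g) := by
    intro g hg
    rw [boxCouplings_eq, hedge g hg.fst hg.snd]
    exact (hJ _ (htouch g hg.fst)).1 g hg rfl
  have hweak : ∀ e, B.IsWeak e → ((shiftEdge d w).symm (boxEdge d L e)) ∈ touching d (side k) ∧
      |boxCouplings J L e| ≤ ε := by
    rintro e ⟨hw1, hw2, b, hb, hbe⟩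
    set e' := (shiftEdge d w).symm (boxEdge d L e) with he'
    have hee' : shiftEdge d w e' = boxEdge d L e := (shiftEdge d w).apply_symm_apply _
    have hmem : planePoint d b ∈ (e' : Sym2 (Fin d → ℤ)) := by
      have h1 : (B.P b : Fin d → ℤ) ∈ (boxEdge d L e : Sym2 (Fin d → ℤ)) := by
        rw [coe_boxEdge]; exact Sym2.mem_map.mpr ⟨_, hbe, rfl⟩
      rw [← hee', coe_shiftEdge, hB b hb, Sym2.mem_map] at h1
      obtain ⟨x, hx, hxb⟩ := h1
      have : x = planePoint d b := by
        funext i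
        have := congrFun hxb i
        simpa using this
      rwa [← this]
    have ht : e' ∈ touching d (side k) := ⟨b, hb, hmem⟩
    refine ⟨ht, ?_⟩
    rw [boxCouplings_eq, ← hee']
    refine (hJ e' ht).2.2 ⟨?_, ?_, b, hb, hmem⟩
    · intro g hg hge
      apply hw1 g hg
      apply (boxEdge d L).injective
      rw [← hee', hge, hedge g hg.fst hg.snd]
    · intro t ht' hte
      apply hw2 t ht'
      apply (boxEdge d L).injective
      rw [← hee', hte, hedge _ (Or.inl (linkEdge_fst ht')) (Or.inr (linkEdge_snd ht'))]
  unfold boxSpectralRadius boxExpTime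
  refine B.slow hk hβ hh (fun g hg => ha.trans (hstrong g hg)) ?_ ?_ ?_ hp hη _
  · intro g hg
    have h1 : 100 ≤ 2 * (β * boxCouplings J L (B.edge g)) := by
      have := mul_le_mul_of_nonneg_left (hstrong g hg).le hβ
      linarith
    exact two_mul_le_exp_sub_one h1
  · intro t ht
    rw [boxCouplings_eq, hedge _ (Or.inl (linkEdge_fst ht)) (Or.inr (linkEdge_snd ht))]
    exact (hJ _ (htouch _ (Or.inl (linkEdge_fst ht)))).2.1 t ht rfl
  · have hcard : (Finset.univ.filter B.IsWeak).card
        ≤ (touching_finite (d := d) (side_pos k)).toFinset.card := by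
      refine Finset.card_le_card_of_injOn (fun e => (shiftEdge d w).symm (boxEdge d L e)) ?_ ?_
      · intro e he
        rw [Set.Finite.coe_toFinset]
        exact (hweak e (Finset.mem_filter.mp he).2).1
      · intro e _ e' _ hee
        exact (boxEdge d L).injective ((shiftEdge d w).symm.injective hee)
    calc ∑ e with B.IsWeak e, β * |boxCouplings J L e|
        ≤ ∑ e with B.IsWeak e, β * ε := Finset.sum_le_sum fun e he =>
          mul_le_mul_of_nonneg_left (hweak e (Finset.mem_filter.mp he).2).2 hβ
      _ = (Finset.univ.filter B.IsWeak).card * (β * ε) := by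
          rw [Finset.sum_const, nsmul_eq_mul]
      _ ≤ _ := mul_le_mul_of_nonneg_right (by exact_mod_cast hcard) (mul_nonneg hβ hε0)
      _ ≤ 1 := hε

end LatticeGeometry

/-! ### Almost sure occurrence of the required couplings. -/

section RarePatterns

open MeasureTheory

/-- A finite pattern of positive probability occurs at one of infinitely many disjoint places. -/
theorem ae_exists_pattern {E : Type*} (Q : Measure ℝ) [IsProbabilityMeasure Q] (S : ℕ → Finset E)
    (hS : ∀ i j, i ≠ j → Disjoint (S i) (S j)) (O : E → Set ℝ) (hO : ∀ e, MeasurableSet (O e))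
    {c : ℝ≥0∞} (hc : c ≠ 0) (hcO : ∀ j, ∏ e ∈ S j, Q (O e) = c) :
    ∀ᵐ J ∂(Measure.infinitePi fun _ : E => Q), ∃ j, ∀ e ∈ S j, J e ∈ O e := by
  set μ := Measure.infinitePi fun _ : E => Q
  set A : ℕ → Set (E → ℝ) := fun j => Set.pi (S j) O with hA
  have hmeas : ∀ j, MeasurableSet (A j) := fun j =>
    MeasurableSet.pi (S j).countable_toSet fun e _ => hO e
  have hμA : ∀ j, μ (A j) = c := fun j => by
    rw [← hcO j]; exact Measure.infinitePi_pi _ fun e _ => hO e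
  have hind : ProbabilityTheory.iIndepSet A μ := by
    rw [ProbabilityTheory.iIndepSet_iff_meas_biInter hmeas]
    intro K
    have h1 : ⋂ j ∈ K, A j = Set.pi (K.biUnion S : Finset E) O := by
      ext J
      simp only [hA, Set.mem_iInter, Set.mem_pi, Finset.mem_coe, Finset.mem_biUnion]
      exact ⟨fun h e ⟨j, hj, he⟩ => h j hj e he, fun h j hj e he => h e ⟨j, hj, he⟩⟩
    rw [h1, Measure.infinitePi_pi _ fun e _ => hO e,
      Finset.prod_biUnion fun i _ j _ hij => hS i j hij]
    exact Finset.prod_congr rfl fun j _ => by rw [hμA, hcO]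
  -- Second Borel–Cantelli lemma: independent events of constant positive probability.
  have hlim := ProbabilityTheory.measure_limsup_eq_one hmeas hind (by
    simp only [hμA]; exact ENNReal.tsum_const_eq_top_of_ne_zero hc)
  have hae : ∀ᵐ J ∂μ, J ∈ Filter.limsup A Filter.atTop := by
    rw [← prob_compl_eq_zero_iff (MeasurableSet.measurableSet_limsup hmeas)] at hlim
    exact hlim
  filter_upwards [hae] with J hJ
  rw [Filter.mem_limsup_iff_frequently_mem] at hJ
  obtain ⟨j, hj⟩ := hJ.exists
  exact ⟨j, fun e he => hj e he⟩

/-- Every edge admits fitting couplings with positive probability. -/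
theorem exists_fits {d n : ℕ} (hd : 2 ≤ d) {Q : Measure ℝ} {s β h ε a : ℝ}
    (hQ : ∀ x : ℝ, |x| < s → x ∈ Q.support) (ha : 0 < a) (has : 2 * a < s) (hβ : 0 < β)
    (hh : 0 < h) (hhs : h / β < s) (hε : 0 < ε) (e : (latticeGraph d).edgeSet) :
    ∃ O : Set ℝ, MeasurableSet O ∧ 0 < Q O ∧ ∀ x ∈ O, Fits hd n β h ε a e x := by
  have hpos : ∀ (O : Set ℝ) (x : ℝ), IsOpen O → x ∈ O → |x| < s → 0 < Q O := fun O x hO hx hs =>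
    (Measure.mem_support_iff_forall x).mp (hQ x hs) O (hO.mem_nhds hx)
  have hne : ∀ g, StrongEdge n g → ∀ t < n,
      (planeBlock hd n).edge g ≠ (planeBlock hd n).edge (linkEdge n t) := by
    intro g hg t ht heq
    have := (planeBlock hd n).edge_inj hg.fst hg.snd (Or.inl (linkEdge_fst ht))
      (Or.inr (linkEdge_snd ht)) heq
    exact not_strongEdge_linkEdge ht (this ▸ hg)
  -- The kinds of edge exclude each other, so one open set suffices in each case: around `2 a` for
  -- strong edges, `± h / β` for links and `0` for the rest. These centres lie within distance `s`
  -- of the origin, hence in the support.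
  by_cases h1 : ∃ g, StrongEdge n g ∧ e = (planeBlock hd n).edge g
  · obtain ⟨g, hg, rfl⟩ := h1
    refine ⟨Set.Ioi a, measurableSet_Ioi, hpos _ (2 * a) isOpen_Ioi (by simp; linarith) ?_, ?_⟩
    · rw [abs_of_pos (by linarith)]; exact has
    · intro x hx
      refine ⟨fun _ _ _ => hx, fun t ht heq => absurd heq (hne g hg t ht), ?_⟩
      rintro ⟨hw, -, -⟩
      exact absurd rfl (hw g hg)
  by_cases h2 : ∃ t < n, e = (planeBlock hd n).edge (linkEdge n t)
  · obtain ⟨t, ht, rfl⟩ := h2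
    have hopen : IsOpen {x : ℝ | |β * x - linkSign n t * h| < h / 100} :=
      isOpen_lt (by fun_prop) continuous_const
    refine ⟨_, hopen.measurableSet, hpos _ (linkSign n t * (h / β)) hopen ?_ ?_, ?_⟩
    · have : β * (linkSign n t * (h / β)) - linkSign n t * h = 0 := by field_simp; ring
      simp only [Set.mem_ofPred_eq, this, abs_zero]
      positivity
    · rw [abs_mul, abs_of_pos (div_pos hh hβ)]
      rcases linkSign_eq n t with hs | hs <;> rw [hs] <;> simpa using hhs
    · intro x hx
      refine ⟨fun g hg heq => absurd heq.symm (hne g hg t ht), ?_, ?_⟩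
      · intro t' ht' heq
        have := (planeBlock hd n).edge_inj (Or.inl (linkEdge_fst ht)) (Or.inr (linkEdge_snd ht))
          (Or.inl (linkEdge_fst ht')) (Or.inr (linkEdge_snd ht')) heq
        rw [← face_injective _ _ this]
        exact le_of_lt hx
      · rintro ⟨-, hw, -⟩
        exact absurd rfl (hw t ht)
  · have hopen : IsOpen {x : ℝ | |x| < ε} := isOpen_lt (by fun_prop) continuous_const
    refine ⟨_, hopen.measurableSet, hpos _ 0 hopen (by simpa using hε) ?_, ?_⟩
    · rw [abs_zero]; linarith
    · intro x hx
      exact ⟨fun g hg heq => absurd ⟨g, hg, heq⟩ h1, fun t ht heq => absurd ⟨t, ht, heq⟩ h2,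
        fun _ => le_of_lt hx⟩

/-- Almost surely, somewhere in the lattice the couplings fit. -/
theorem ae_exists_shift_fits {d n : ℕ} (hd : 2 ≤ d) (hn : 0 < n) (Q : Measure ℝ)
    [IsProbabilityMeasure Q] {s β h ε a : ℝ}
    (hQ : ∀ x : ℝ, |x| < s → x ∈ Q.support) (ha : 0 < a) (has : 2 * a < s) (hβ : 0 < β)
    (hh : 0 < h) (hhs : h / β < s) (hε : 0 < ε) :
    ∀ᵐ J ∂(Measure.infinitePi fun _ : (latticeGraph d).edgeSet => Q), ∃ w : ℕ,
      ∀ e ∈ touching d n, Fits hd n β h ε a e (J (shiftEdge d w e)) := by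
  choose O hOm hOpos hOfit using
    fun e => exists_fits (n := n) hd hQ ha has hβ hh hhs hε e
  set T := (touching_finite (d := d) hn).toFinset with hT
  have hTmem : ∀ e, e ∈ T ↔ e ∈ touching d n := fun e => Set.Finite.mem_toFinset _
  set v : ℕ → ℤ := fun j => ((j * (2 * n + 5) : ℕ) : ℤ) with hv
  set S : ℕ → Finset (latticeGraph d).edgeSet := fun j => T.image (shiftEdge d (v j)) with hS
  -- Translates are disjoint, so an edge lies in at most one of them and inherits the condition of
  -- its preimage; other edges are unconstrained.
  set O' : (latticeGraph d).edgeSet → Set ℝ := fun e =>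
    if hj : ∃ j, e ∈ S j then O ((shiftEdge d (v hj.choose)).symm e) else Set.univ with hO'
  have huniq : ∀ i j e, e ∈ S i → e ∈ S j → i = j := by
    intro i j e hi hj
    obtain ⟨f, hf, rfl⟩ := Finset.mem_image.mp hi
    obtain ⟨f', hf', heq⟩ := Finset.mem_image.mp hj
    exact (shiftEdge_touching hd hn ((hTmem _).mp hf') ((hTmem _).mp hf) heq).symm
  have hO'eq : ∀ j, ∀ e ∈ T, O' (shiftEdge d (v j) e) = O e := by
    intro j e he
    have hmem : shiftEdge d (v j) e ∈ S j := Finset.mem_image_of_mem _ he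
    have hj : ∃ j', shiftEdge d (v j) e ∈ S j' := ⟨j, hmem⟩
    simp only [hO', dif_pos hj]
    rw [huniq _ _ _ hj.choose_spec hmem, Equiv.symm_apply_apply]
  have hae := ae_exists_pattern Q S
    (fun i j hij => Finset.disjoint_left.mpr fun e hi hj => hij (huniq i j e hi hj)) O'
    (fun e => by
      simp only [hO']
      split_ifs
      · exact hOm _
      · exact MeasurableSet.univ)
    (c := ∏ e ∈ T, Q (O e)) (Finset.prod_ne_zero_iff.mpr fun e _ => (hOpos e).ne')
    (fun j => by
      rw [hS, Finset.prod_image fun e _ e' _ h => (shiftEdge d (v j)).injective h]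
      exact Finset.prod_congr rfl fun e he => by rw [hO'eq j e he])
  filter_upwards [hae] with J hJ
  obtain ⟨j, hj⟩ := hJ
  refine ⟨j * (2 * n + 5), fun e he => ?_⟩
  have heT := (hTmem e).mpr he
  have := hj (shiftEdge d (v j) e) (Finset.mem_image_of_mem _ heT)
  rw [hO'eq j e heT] at this
  exact hOfit e _ this

end RarePatterns

/-! ### Choice of the parameters and conclusion. -/

section Main

open MeasureTheory Filter Topology

theorem secondSpectralRadius_swMatrix_le_one {V : Type*} [Fintype V] (G : SimpleGraph V)
    (J : G.edgeSet → ℝ) {β : ℝ} (hβ : 0 ≤ β) (inst : Fintype (Spins V)) :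
    @secondSpectralRadius _ inst (swMatrix G J β) ≤ 1 := by
  obtain rfl : inst = Pi.instFintype := Subsingleton.elim _ _
  exact secondSpectralRadius_le_one (isReversibleChain_swMatrix hβ)

theorem boxSpectralRadius_le_one {d : ℕ} (J : (latticeGraph d).edgeSet → ℝ) {β : ℝ} (hβ : 0 ≤ β)
    (L : ℕ) : boxSpectralRadius J β L ≤ 1 :=
  secondSpectralRadius_swMatrix_le_one _ _ hβ _

/-- For large `β` and every `M`, almost surely all large boxes are slow to the degree given by
`M`. -/
theorem ae_eventually_slow {d : ℕ} (hd : 2 ≤ d) (Q : Measure ℝ) [IsProbabilityMeasure Q] {s : ℝ}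
    (hs : 0 < s) (hQ : ∀ x : ℝ, |x| < s → x ∈ Q.support) {β : ℝ} (hβ : 200 / s < β)
    {M : ℝ} (hM : 0 < M) (hη : 16 * Real.exp (2 - 4 / 10 * M) < 1) :
    ∀ᵐ J ∂(Measure.infinitePi fun _ : (latticeGraph d).edgeSet => Q), ∀ᶠ L : ℕ in atTop,
      1 - 16 * Real.exp (2 - 4 / 10 * M) ≤ boxSpectralRadius J β L ∧
      (ENNReal.ofReal (-Real.log (1 - 16 * Real.exp (2 - 4 / 10 * M))))⁻¹
        ≤ boxExpTime J β L := by
  have hβ0 : 0 < β := lt_trans (by positivity) hβ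
  have hβs : 200 < β * s := by rwa [div_lt_iff₀ hs] at hβ
  -- The scale is chosen after `M`: large enough that the pinning error is below `exp (-3 M)` and
  -- that the link couplings `h / β`, with `h = M / side k`, fit into the support.
  obtain ⟨k, hk, hkp, hks⟩ : ∃ k : ℕ, 0 < k ∧
      2 * (1 / 2 : ℝ) ^ (4 * k + 25) ≤ Real.exp (-3 * M) ∧ M / (s * β) < k := by
    have h1 : Tendsto (fun k : ℕ => (1 / 2 : ℝ) ^ k) atTop (𝓝 0) :=
      tendsto_pow_atTop_nhds_zero_of_lt_one (by norm_num) (by norm_num)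
    have h2 := (h1.eventually (gt_mem_nhds (Real.exp_pos (-3 * M)))).and
      ((eventually_gt_atTop 0).and
        (tendsto_natCast_atTop_atTop.eventually (eventually_gt_atTop (M / (s * β)))))
    obtain ⟨k, hk1, hk2, hk3⟩ := h2.exists
    refine ⟨k, hk2, ?_, hk3⟩
    calc 2 * (1 / 2 : ℝ) ^ (4 * k + 25) = (1 / 2 : ℝ) ^ (4 * k + 24) := by rw [pow_succ]; ring
      _ ≤ (1 / 2 : ℝ) ^ k := pow_le_pow_of_le_one (by norm_num) (by norm_num) (by omega)
      _ ≤ _ := hk1.le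
  have hn : (0 : ℝ) < side k := by exact_mod_cast side_pos k
  set h := M / side k with hh
  have hh0 : 0 < h := div_pos hM hn
  have hhM : h * side k = M := div_mul_cancel₀ _ hn.ne'
  have hhs : h / β < s := by
    have hkn : (k : ℝ) < side k := by exact_mod_cast succ_le_side k
    have h3 : M / (s * β) < side k := hks.trans hkn
    rw [div_lt_iff₀ (by positivity)] at h3
    rw [div_lt_iff₀ hβ0, hh, div_lt_iff₀ hn]
    linarith
  set T := (touching_finite (d := d) (side_pos k)).toFinset.card with hT
  set ε : ℝ := 1 / ((T + 1) * β) with hε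
  have hT0 : (0 : ℝ) ≤ T := Nat.cast_nonneg T
  have hε0 : 0 < ε := by positivity
  have hεT : T * (β * ε) ≤ 1 := by
    have : T * (β * ε) = T / (T + 1) := by rw [hε]; field_simp
    rw [this, div_le_one (by positivity)]
    linarith
  -- With `a = s / 4`, the condition `2 a < s` holds and `2 β a = β s / 2 ≥ 100`; this is the origin
  -- of the threshold `200 / s`.
  filter_upwards [ae_exists_shift_fits hd (side_pos k) Q (s := s) (β := β) (h := h) (ε := ε)
    (a := s / 4) hQ (by positivity) (by linarith) hβ0 hh0 hhs hε0] with J hJ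
  obtain ⟨w, hw⟩ := hJ
  filter_upwards [eventually_ge_atTop (w + 2 * side k)] with L hL
  have := box_slow hd hk hβ0.le hh0 (by positivity : 0 < s / 4) (by linarith) hw hεT hε0.le
    (by rw [hhM]; exact hkp) (by rw [hhM]; exact hη) hL
  rwa [hhM] at this

end Main

end SwendsenWang

end

theorem theorem4p8 (d : ℕ) (hd : 2 ≤ d) (Q : MeasureTheory.Measure ℝ)
    [MeasureTheory.IsProbabilityMeasure Q]
    (hQ : (0 : ℝ) ∈ interior Q.support) (δ : ℝ) (hδ : δ ∈ Set.Ioo (0 : ℝ) (1 / 2)) :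
    ∃ β₀ : ℝ, 0 < β₀ ∧ ∀ β : ℝ, β₀ < β →
      ∀ᵐ J ∂(MeasureTheory.Measure.infinitePi
          fun _ : (SwendsenWang.latticeGraph d).edgeSet => Q),
        Filter.Tendsto (fun L : ℕ => SwendsenWang.boxSpectralRadius J β L)
          Filter.atTop (nhds 1) ∧
        Filter.Tendsto (fun L : ℕ => SwendsenWang.boxExpTime J β L)
          Filter.atTop (nhds ⊤) := by
  obtain ⟨s, hs, hball⟩ := Metric.mem_nhds_iff.mp (mem_interior_iff_mem_nhds.mp hQ)
  have hsupp : ∀ x : ℝ, |x| < s → x ∈ Q.support := fun x hx => hball (by simpa using hx)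
  refine ⟨200 / s, by positivity, fun β hβ => ?_⟩
  have hβ0 : 0 < β := lt_trans (by positivity) hβ
  set η : ℕ → ℝ := fun m => 16 * Real.exp (2 - 4 / 10 * (m : ℝ)) with hη
  have hη0 : Filter.Tendsto η Filter.atTop (nhds 0) := by
    have h1 : Filter.Tendsto (fun m : ℕ => 2 - 4 / 10 * (m : ℝ)) Filter.atTop Filter.atBot := by
      have h2 : Filter.Tendsto (fun m : ℕ => 4 / 10 * (m : ℝ)) Filter.atTop Filter.atTop :=
        tendsto_natCast_atTop_atTop.const_mul_atTop (by norm_num)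
      simpa only [sub_eq_add_neg, Function.comp_def] using
        Filter.tendsto_atBot_add_const_left _ (2 : ℝ) (Filter.tendsto_neg_atTop_atBot.comp h2)
    simpa using (Real.tendsto_exp_atBot.comp h1).const_mul 16
  have hη1 : Filter.Tendsto (fun m => 1 - η m) Filter.atTop (nhds 1) := by
    simpa using hη0.const_sub 1
  have hηlog : Filter.Tendsto (fun m => (ENNReal.ofReal (-Real.log (1 - η m)))⁻¹) Filter.atTop
      (nhds ⊤) := by
    have h1 : Filter.Tendsto (fun m => -Real.log (1 - η m)) Filter.atTop (nhds 0) := by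
      simpa using (hη1.log one_ne_zero).neg
    have h2 := ENNReal.tendsto_ofReal h1
    rw [ENNReal.ofReal_zero] at h2
    simpa using tendsto_inv_iff.mpr h2
  have hsmall : ∀ᶠ m in Filter.atTop, 0 < m ∧ η m < 1 :=
    (Filter.eventually_gt_atTop 0).and (hη0.eventually (gt_mem_nhds one_pos))
  have hae : ∀ᵐ J ∂(MeasureTheory.Measure.infinitePi
      fun _ : (SwendsenWang.latticeGraph d).edgeSet => Q), ∀ m : ℕ, 0 < m ∧ η m < 1 →
        ∀ᶠ L : ℕ in Filter.atTop, 1 - η m ≤ SwendsenWang.boxSpectralRadius J β L ∧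
          (ENNReal.ofReal (-Real.log (1 - η m)))⁻¹ ≤ SwendsenWang.boxExpTime J β L := by
    -- Only integer values of `M` are used, so a countable union of null sets is discarded before
    -- `M` tends to infinity.
    rw [MeasureTheory.ae_all_iff]
    intro m
    by_cases hm : 0 < m ∧ η m < 1
    · filter_upwards [SwendsenWang.ae_eventually_slow hd Q hs hsupp hβ (M := m)
        (by exact_mod_cast hm.1) hm.2] with J hJ _ using hJ
    · exact Filter.Eventually.of_forall fun J h => absurd h hm
  filter_upwards [hae] with J hJ
  constructor
  · rw [tendsto_order]
    constructor
    · intro a ha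
      obtain ⟨m, hm, ham⟩ := (hsmall.and (hη1.eventually (lt_mem_nhds ha))).exists
      filter_upwards [hJ m hm] with L hL using ham.trans_le hL.1
    · intro a ha
      exact Filter.Eventually.of_forall fun L =>
        (SwendsenWang.boxSpectralRadius_le_one J hβ0.le L).trans_lt ha
  · rw [tendsto_order]
    constructor
    · intro a ha
      obtain ⟨m, hm, ham⟩ := (hsmall.and (hηlog.eventually (lt_mem_nhds ha))).exists
      filter_upwards [hJ m hm] with L hL using ham.trans_le hL.2
    · intro a ha
      exact absurd ha not_top_lt
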